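/- All graphs are finite and simple. A red-blue graph is a graph each of whose edges is coloured red or blue; a partial colouring of a graph $G$ is a red-blue colouring of a subset of the edges of $G$. For a red-blue graph $K$, let $r_K(P_t)$ and $b_K(P_t)$ denote the numbers of connected components of its red, respectively blue, spanning subgraph that are paths of length $t$ (with $t$ edges); "monochromatic components" are the components of these two subgraphs. A geodesic in $G$ is a shortest path in $G$ between two vertices. For $\ell\ge 3$, a blue $\ell$-gadget is a red-blue graph $H$ of maximum degree at most $3$ that contains a blue path of length exactly $\ell$ each of whose two ends is incident with two red edges of $H$, and for which there is another red-blue colouring $H'$ of the same graph, differing from $H$ on at most two edges, such that the following holds for every red-blue cubic graph $K$ that contains $H$ (as a coloured subgraph) and whose monochromatic components are all paths: if $K'$ is obtained from $K$ by replacing $H$ by $H'$, then all monochromatic components of $K'$ are paths, $r_{K'}(P_t)=r_K(P_t)$ for every $t$, $b_{K'}(P_t)=b_K(P_t)$ for every $t>\ell$, and $b_{K'}(P_\ell)=b_K(P_\ell)-1$. **Lemma.** Let $\ell\ge 3$, let $G$ be a cubic graph and let $P$ be a geodesic in $G$ of length at least $5\ell+200$. Then there is a partial colouring $\phi$ of $G$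 such that: 1. every edge coloured by $\phi$ is at distance at most $4$ from $P$ (that is, it has an end at distance at most $4$ in $G$ from some vertex of $P$), and the coloured edges form a connected subgraph; 2. the red-blue graph formed by the coloured edges contains a blue $\ell$-gadget as a coloured subgraph; 3. (E1) every vertex incident with at least two coloured edges is incident with both a red and a blue edge; 4. (E3) every cycle of $G$ that does not contain both a red edge and a blue edge from the same connected component of the coloured subgraph has two consecutive uncoloured edges. -/

import Mathlib

universe u

/-- A red-blue edge-coloured (simple) graph on the vertex set `V`, given by its red and its blue
edges.  Every edge has exactly one of the two colours. -/
structure RedBlueGraph (V : Type u) where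
  red : SimpleGraph V
  blue : SimpleGraph V
  disj : Disjoint red blue

namespace RedBlueGraph

variable {V U W : Type*}

/-- The underlying uncoloured graph: all red and all blue edges. -/
def graph (K : RedBlueGraph V) : SimpleGraph V := K.red ⊔ K.blue

/-- `f` exhibits a copy of the coloured graph `H` as a (not necessarily induced) subgraph of the
coloured graph `K`, with the colours of all edges of `H` preserved. -/
def IsCopy (H : RedBlueGraph U) (K : RedBlueGraph W) (f : U ↪ W) : Prop :=
  H.red.map f ≤ K.red ∧ H.blue.map f ≤ K.blue

/-- The coloured graph obtained from `K` by giving the edges of the copy of `H'` under `f` the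
colours that they have in `H'`; all other edges of `K` keep their colour. -/
def overwrite (K : RedBlueGraph W) (H' : RedBlueGraph U) (f : U ↪ W) : RedBlueGraph W where
  red := (K.red \ H'.graph.map f) ⊔ H'.red.map f
  blue := (K.blue \ H'.graph.map f) ⊔ H'.blue.map f
  disj := by
    have hr : H'.red.map f ≤ H'.graph.map f := SimpleGraph.map_monotone f le_sup_left
    have hb : H'.blue.map f ≤ H'.graph.map f := SimpleGraph.map_monotone f le_sup_right
    refine Disjoint.sup_left (Disjoint.sup_right ?_ ?_) (Disjoint.sup_right ?_ ?_)
    · exact K.disj.mono sdiff_le sdiff_le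
    · exact disjoint_sdiff_self_left.mono_right hb
    · exact disjoint_sdiff_self_right.mono_left hr
    · rw [SimpleGraph.disjoint_left]
      intro x y h1 h2
      rw [SimpleGraph.map_adj] at h1 h2
      obtain ⟨a, b, hab, rfl, rfl⟩ := h1
      obtain ⟨c, d, hcd, hc, hd⟩ := h2
      rw [f.injective hc, f.injective hd] at hcd
      exact SimpleGraph.disjoint_left.mp H'.disj a b hab hcd

end RedBlueGraph

/-- The connected component `c` of `R` is a path with exactly `t` edges. -/
def IsPathComponent {W : Type*} {R : SimpleGraph W} (c : R.ConnectedComponent) (t : ℕ) : Prop :=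
  ∃ (x y : W) (p : R.Walk x y), p.IsPath ∧ p.length = t ∧
    (∀ w, w ∈ c.supp ↔ w ∈ p.support) ∧
    (∀ w z, w ∈ c.supp → R.Adj w z → s(w, z) ∈ p.edges)

/-- The number of connected components of `R` that are paths with exactly `t` edges. -/
noncomputable def numPathComponents {W : Type*} (R : SimpleGraph W) (t : ℕ) : ℕ :=
  Nat.card {c : R.ConnectedComponent // IsPathComponent c t}

namespace RedBlueGraph

variable {V U W : Type*}

/-- Every monochromatic component is a path. -/
def ComponentsArePaths (K : RedBlueGraph W) : Prop :=
  (∀ c : K.red.ConnectedComponent, ∃ t, IsPathComponent c t) ∧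
  (∀ c : K.blue.ConnectedComponent, ∃ t, IsPathComponent c t)

/-- `H` is a blue `ℓ`-gadget: it is subcubic, it contains a blue path with `ℓ` edges both of whose
ends are incident with two red edges, and it has another red-blue colouring `H'`, which differs
from `H` on at most two edges, such that replacing `H` by `H'` in any (finite) red-blue coloured
cubic graph whose monochromatic components are paths keeps all monochromatic components paths,
keeps the number of red components that are paths of length `t` for every `t`, keeps the number
of blue components that are paths of length `t` for every `t > ℓ`, and decreases by one the number
of blue components that are paths of length `ℓ`. -/
def IsBlueGadget (H : RedBlueGraph U) (ℓ : ℕ) : Prop :=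
  (∀ v, (H.graph.neighborSet v).encard ≤ 3) ∧
  (∃ (x y : U) (p : H.blue.Walk x y), p.IsPath ∧ p.length = ℓ ∧
    (H.red.neighborSet x).encard = 2 ∧ (H.red.neighborSet y).encard = 2) ∧
  ∃ H' : RedBlueGraph U, H'.graph = H.graph ∧
    (symmDiff H.red.edgeSet H'.red.edgeSet).encard ≤ 2 ∧
    ∀ (W : Type) [Finite W] (K : RedBlueGraph W) [K.graph.LocallyFinite] (f : U ↪ W),
      K.graph.IsRegularOfDegree 3 → K.ComponentsArePaths → H.IsCopy K f →
        (K.overwrite H' f).ComponentsArePaths ∧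
        (∀ t, numPathComponents (K.overwrite H' f).red t = numPathComponents K.red t) ∧
        (∀ t, ℓ < t → numPathComponents (K.overwrite H' f).blue t = numPathComponents K.blue t) ∧
        numPathComponents (K.overwrite H' f).blue ℓ + 1 = numPathComponents K.blue ℓ

/-- `K` contains a blue `ℓ`-gadget as a coloured subgraph. -/
def ContainsBlueGadget {V : Type u} (K : RedBlueGraph V) (ℓ : ℕ) : Prop :=
  ∃ (U : Type u) (_ : Finite U) (H : RedBlueGraph U) (f : U ↪ V),
    H.IsBlueGadget ℓ ∧ H.IsCopy K f

/-- `φ` is a partial red-blue edge-colouring of `G`: its coloured edges are edges of `G`. -/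
def IsPartialColouring (φ : RedBlueGraph V) (G : SimpleGraph V) : Prop := φ.graph ≤ G

/-- Every vertex incident with at least two coloured edges is incident with a red edge and with a
blue edge. -/
def SeesBothColours (φ : RedBlueGraph V) : Prop :=
  ∀ v, 2 ≤ (φ.graph.neighborSet v).encard → (∃ w, φ.red.Adj v w) ∧ (∃ w, φ.blue.Adj v w)

/-- Every cycle of `G` that does not contain both a red and a blue edge from the same component of
the coloured graph has two consecutive uncoloured edges (two distinct edges of a cycle are
consecutive exactly if they share a vertex). -/
def CyclesHaveGap (φ : RedBlueGraph V) (G : SimpleGraph V) : Prop :=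
  ∀ (v : V) (C : G.Walk v v), C.IsCycle →
    (¬ ∃ a b c d : V, s(a, b) ∈ C.edges ∧ φ.red.Adj a b ∧ s(c, d) ∈ C.edges ∧ φ.blue.Adj c d ∧
      φ.graph.Reachable a c) →
    ∃ x y z : V, x ≠ z ∧ s(x, y) ∈ C.edges ∧ s(y, z) ∈ C.edges ∧
      ¬ φ.graph.Adj x y ∧ ¬ φ.graph.Adj y z

end RedBlueGraph

/-! The gadget. Let x₀, …, x_ℓ be a blue path component, vy a blue component with a single edge, and
x₀y a red edge. Exchanging the colours of x₀x₁ and x₀y turns the two blue components into paths with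
ℓ - 1 and 2 edges. As 2 < ℓ, this destroys one blue path with ℓ edges and creates none with ℓ or
more. In red, x₀y gives way to x₀x₁, and the new red graph is isomorphic to the old one as soon as
the red tails at y and x₁ are mirror images: either y and x₁ are joined by a red path with 1, 2 or 4
edges, which is reversed, or each of them is, apart from x₀y, on one red edge that ends at a vertex
with two blue edges, and these two edges are interchanged. `IsGadgetFrame` records such a
configuration by local conditions. In a cubic graph with path components they force the rest, so
every subcubic coloured graph with a frame is a gadget (`isBlueGadget_of_frame`).

The cycles. Take a connected partial colouring with acyclic colour classes that shows both colours
at every vertex with two coloured edges, and extend it, without new vertices, to a maximal colouring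
of this kind. A cycle violating `CyclesHaveGap` would contain an uncoloured edge xy between two
edges of one colour. By maximality x and y are joined by a red path and by a blue path, and the
coloured edges at x and y belong to the initial colouring. It therefore suffices that, initially,
every uncoloured edge xy whose ends see both colours has an anchor: a monochromatic path from x or y
to a fully coloured vertex at which that colour ends (`exists_complete_extension`,
`exists_completion`).

The initial colouring. It follows a path q that contains the geodesic. The edges of q are blue
except for three red ones, which cut out the blue path and the edge vy. Edges leaving q are red, and
a vertex off q with two red edges gets its remaining edge coloured blue. Three things could go
wrong: a vertex off q with three red edges, a vertex with two blue edges and no red one, or a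
monochromatic cycle. A red triangle over an outer red edge of q is broken by making one of its edges
blue. `ColourScheme.Valid` lists local conditions under which the construction works
(`exists_colouring`); both colours are then acyclic because there are height functions for which
each vertex has at most one neighbour at least as high.

The geodesic. Two geodesic neighbours of a vertex are at most two places apart, and an inner
geodesic vertex has only one neighbour outside. Apices of triangles over geodesic edges are inserted
into the path whenever some neighbour could otherwise be left with blue edges only. Vertices joined
to p i and p (i+2) cannot be inserted; two of them with a common neighbour t form a rigid
configuration (`BranchAt`), and the third edge at t is coloured red. This handles everything away
from the gadget (`insScheme_valid`). The gadget itself uses a short cycle near the middle part of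
the geodesic if there is one. Otherwise a long stretch has private outer neighbours, and the two
next to x₀ either are joined by a red path with two edges or are saturated with blue edges
(`IsLegs.exists_valid`). -/

/-! ### Path components as vertex sets -/

/-- `S` is the vertex set of a component of `R` which is a path with `t` edges. -/
def IsPathSet {W : Type*} (R : SimpleGraph W) (S : Set W) (t : ℕ) : Prop :=
  ∃ g : ℕ → W, (∀ i ≤ t, ∀ j ≤ t, g i = g j → i = j) ∧ (∀ w, w ∈ S ↔ ∃ i ≤ t, g i = w) ∧
    ∀ i ≤ t, ∀ w, R.Adj (g i) w ↔ ∃ j ≤ t, (j = i + 1 ∨ i = j + 1) ∧ g j = w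

theorem IsPathSet.nonempty {W : Type*} {R : SimpleGraph W} {S : Set W} {t : ℕ}
    (h : IsPathSet R S t) : S.Nonempty := by
  obtain ⟨g, -, h2, -⟩ := h
  exact ⟨g 0, (h2 _).2 ⟨0, Nat.zero_le _, rfl⟩⟩

theorem IsPathSet.closed {W : Type*} {R : SimpleGraph W} {S : Set W} {t : ℕ}
    (h : IsPathSet R S t) {a b : W} (ha : a ∈ S) (hab : R.Adj a b) : b ∈ S := by
  obtain ⟨g, -, h2, h3⟩ := h
  obtain ⟨i, hi, rfl⟩ := (h2 a).1 ha
  obtain ⟨j, hj, -, rfl⟩ := (h3 i hi b).1 hab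
  exact (h2 _).2 ⟨j, hj, rfl⟩

theorem IsPathSet.reachable {W : Type*} {R : SimpleGraph W} {S : Set W} {t : ℕ}
    (h : IsPathSet R S t) {a b : W} (ha : a ∈ S) : b ∈ S ↔ R.Reachable a b := by
  constructor
  · intro hb
    obtain ⟨g, -, h2, h3⟩ := h
    have key : ∀ i ≤ t, R.Reachable (g 0) (g i) := by
      intro i
      induction i with
      | zero => intro _; exact SimpleGraph.Reachable.refl _
      | succ n ih =>
        intro hn
        refine (ih (by omega)).trans (SimpleGraph.Adj.reachable ?_)
        exact (h3 n (by omega) _).2 ⟨n + 1, hn, Or.inl rfl, rfl⟩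
    obtain ⟨i, hi, rfl⟩ := (h2 a).1 ha
    obtain ⟨j, hj, rfl⟩ := (h2 b).1 hb
    exact (key i hi).symm.trans (key j hj)
  · rintro ⟨p⟩
    induction p with
    | nil => exact ha
    | cons hadj p ih => exact ih (h.closed ha hadj)

theorem IsPathSet.eq_of_mem {W : Type*} {R : SimpleGraph W} {S S' : Set W} {t t' : ℕ}
    (h : IsPathSet R S t) (h' : IsPathSet R S' t') {a : W} (ha : a ∈ S) (ha' : a ∈ S') :
    S = S' := by
  ext b
  rw [h.reachable ha, h'.reachable ha']

theorem IsPathSet.ncard_eq {W : Type*} {R : SimpleGraph W} {S : Set W} {t : ℕ}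
    (h : IsPathSet R S t) : S.ncard = t + 1 := by
  obtain ⟨g, h1, h2, -⟩ := h
  have : S = g '' (Finset.range (t + 1) : Set ℕ) := by
    ext w
    rw [h2]
    simp [Nat.lt_succ_iff]
  rw [this, Set.InjOn.ncard_image, Set.ncard_coe_finset, Finset.card_range]
  intro i hi j hj hij
  simp [Nat.lt_succ_iff] at hi hj
  exact h1 i hi j hj hij

theorem IsPathSet.card_nbrs {W : Type*} {R : SimpleGraph W} {S : Set W} {t : ℕ}
    (h : IsPathSet R S t) {a b c d : W} (ha : a ∈ S) (hb : R.Adj a b) (hc : R.Adj a c)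
    (hd : R.Adj a d) : b = c ∨ b = d ∨ c = d := by
  obtain ⟨g, -, h2, h3⟩ := h
  obtain ⟨i, hi, rfl⟩ := (h2 a).1 ha
  obtain ⟨j, hj, hj', rfl⟩ := (h3 i hi b).1 hb
  obtain ⟨k, hk, hk', rfl⟩ := (h3 i hi c).1 hc
  obtain ⟨l, hl, hl', rfl⟩ := (h3 i hi d).1 hd
  have : j = k ∨ j = l ∨ k = l := by omega
  rcases this with h | h | h <;> simp [h]

/-- A sequence of successively adjacent vertices spans a walk. -/
theorem SimpleGraph.exists_walk_getVert {W : Type*} (R : SimpleGraph W) (g : ℕ → W) (t : ℕ)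
    (h : ∀ i < t, R.Adj (g i) (g (i + 1))) :
    ∃ p : R.Walk (g 0) (g t), p.support = (List.range (t + 1)).map g ∧
      p.edges = (List.range t).map (fun i => s(g i, g (i + 1))) := by
  induction t with
  | zero => exact ⟨SimpleGraph.Walk.nil, by simp⟩
  | succ n ih =>
    obtain ⟨p, hp, he⟩ := ih (fun i hi => h i (by omega))
    refine ⟨p.concat (h n (by omega)), ?_, ?_⟩
    · rw [SimpleGraph.Walk.support_concat, hp, List.range_succ (n := n + 1)]
      simp
    · rw [SimpleGraph.Walk.edges_concat, he, List.range_succ (n := n)]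
      simp

theorem isPathComponent_iff {W : Type*} {R : SimpleGraph W} (c : R.ConnectedComponent) (t : ℕ) :
    IsPathComponent c t ↔ IsPathSet R c.supp t := by
  constructor
  · rintro ⟨x, y, p, hp, hl, hs, he⟩
    have hinj : ∀ i ≤ t, ∀ j ≤ t, p.getVert i = p.getVert j → i = j := by
      intro i hi j hj hij
      exact hp.getVert_injOn (by simpa [hl] using hi) (by simpa [hl] using hj) hij
    refine ⟨p.getVert, hinj, ?_, ?_⟩
    · intro w
      rw [hs, SimpleGraph.Walk.mem_support_iff_exists_getVert, hl]
      constructor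
      · rintro ⟨n, h1, h2⟩; exact ⟨n, h2, h1⟩
      · rintro ⟨n, h1, h2⟩; exact ⟨n, h2, h1⟩
    · intro i hi w
      constructor
      · intro hadj
        have hmem : p.getVert i ∈ c.supp := by
          rw [hs]; exact SimpleGraph.Walk.getVert_mem_support p i
        have := he _ _ hmem hadj
        rw [SimpleGraph.Walk.mk_mem_edges_iff_exists] at this
        obtain ⟨j, hj, h1⟩ := this
        have h1 := Sym2.eq_iff.1 h1.symm
        rcases h1 with ⟨h1, h2⟩ | ⟨h1, h2⟩
        · have := hinj _ hi _ (by omega) h1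
          exact ⟨j + 1, by omega, by omega, h2.symm⟩
        · have := hinj _ hi _ (by omega) h1
          exact ⟨j, by omega, by omega, h2.symm⟩
      · rintro ⟨j, hj, h | h, rfl⟩
        · subst h; exact p.adj_getVert_succ (by omega)
        · subst h; exact (p.adj_getVert_succ (by omega)).symm
  · rintro ⟨g, h1, h2, h3⟩
    obtain ⟨p, hp, he⟩ := R.exists_walk_getVert g t
      (fun i hi => (h3 i hi.le _).2 ⟨i + 1, hi, Or.inl rfl, rfl⟩)
    refine ⟨_, _, p, ?_, ?_, ?_, ?_⟩
    · rw [SimpleGraph.Walk.isPath_def, hp]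
      refine List.Nodup.map_on ?_ List.nodup_range
      intro a ha b hb hab
      rw [List.mem_range] at ha hb
      exact h1 a (by omega) b (by omega) hab
    · have := p.length_support
      rw [hp] at this
      simpa using this.symm
    · intro w
      rw [h2, hp]
      simp [Nat.lt_succ_iff]
    · intro w z hw hwz
      obtain ⟨i, hi, rfl⟩ := (h2 w).1 hw
      obtain ⟨j, hj, hij, rfl⟩ := (h3 i hi z).1 hwz
      rw [he, List.mem_map]
      rcases hij with rfl | rfl
      · exact ⟨i, by simpa using hj, rfl⟩
      · exact ⟨j, by simpa using hi, Sym2.eq_swap⟩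

theorem IsPathSet.exists_component {W : Type*} {R : SimpleGraph W} {S : Set W} {t : ℕ}
    (h : IsPathSet R S t) : ∃ c : R.ConnectedComponent, c.supp = S := by
  obtain ⟨a, ha⟩ := h.nonempty
  refine ⟨R.connectedComponentMk a, ?_⟩
  ext b
  rw [h.reachable ha, SimpleGraph.ConnectedComponent.mem_supp_iff,
    SimpleGraph.ConnectedComponent.eq]
  exact ⟨fun h => h.symm, fun h => h.symm⟩

/-- Counting vertex sets makes the numbers for two graphs on the same vertices comparable by
equalities of families of sets, although the types of their components differ. -/
theorem numPathComponents_eq {W : Type*} (R : SimpleGraph W) (t : ℕ) :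
    numPathComponents R t = {S | IsPathSet R S t}.ncard := by
  unfold numPathComponents
  rw [← Nat.card_coe_set_eq]
  refine Nat.card_congr (Equiv.ofBijective
    (fun c => ⟨c.1.supp, (isPathComponent_iff _ _).1 c.2⟩) ⟨?_, ?_⟩)
  · intro c d hcd
    simp only [Subtype.mk.injEq] at hcd
    exact Subtype.ext (SimpleGraph.ConnectedComponent.supp_injective hcd)
  · rintro ⟨S, hS⟩
    obtain ⟨c, rfl⟩ := IsPathSet.exists_component hS
    exact ⟨⟨c, (isPathComponent_iff _ _).2 hS⟩, rfl⟩

theorem forall_isPathComponent_iff {W : Type*} (R : SimpleGraph W) :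
    (∀ c : R.ConnectedComponent, ∃ t, IsPathComponent c t) ↔
      ∀ w, ∃ S t, w ∈ S ∧ IsPathSet R S t := by
  constructor
  · intro h w
    obtain ⟨t, ht⟩ := h (R.connectedComponentMk w)
    exact ⟨_, t, SimpleGraph.ConnectedComponent.connectedComponentMk_mem, (isPathComponent_iff _ _).1 ht⟩
  · intro h c
    induction c using SimpleGraph.ConnectedComponent.ind with
    | h w =>
      obtain ⟨S, t, hw, hS⟩ := h w
      obtain ⟨c, rfl⟩ := hS.exists_component
      refine ⟨t, ?_⟩
      have : R.connectedComponentMk w = c := hw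
      rw [this]
      exact (isPathComponent_iff _ _).2 hS

theorem IsPathSet.image_perm {W : Type*} {R R' : SimpleGraph W} (σ : Equiv.Perm W)
    (h : ∀ a b, R'.Adj (σ a) (σ b) ↔ R.Adj a b) {S : Set W} {t : ℕ} (hS : IsPathSet R S t) :
    IsPathSet R' (σ '' S) t := by
  obtain ⟨g, h1, h2, h3⟩ := hS
  refine ⟨fun i => σ (g i), fun i hi j hj hij => h1 i hi j hj (σ.injective hij), ?_, ?_⟩
  · intro w
    constructor
    · rintro ⟨a, ha, rfl⟩
      obtain ⟨i, hi, rfl⟩ := (h2 a).1 ha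
      exact ⟨i, hi, rfl⟩
    · rintro ⟨i, hi, rfl⟩
      exact ⟨g i, (h2 _).2 ⟨i, hi, rfl⟩, rfl⟩
  · intro i hi w
    obtain ⟨b, rfl⟩ := σ.surjective w
    rw [h, h3 i hi]
    simp only [EmbeddingLike.apply_eq_iff_eq]

/-- A recolouring that amounts to a relabelling of the vertices changes no count; this handles all
red lengths at once. -/
theorem numPathComponents_perm {W : Type*} {R R' : SimpleGraph W} (σ : Equiv.Perm W)
    (h : ∀ a b, R'.Adj (σ a) (σ b) ↔ R.Adj a b) (t : ℕ) :
    numPathComponents R' t = numPathComponents R t := by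
  rw [numPathComponents_eq, numPathComponents_eq]
  have : {S | IsPathSet R' S t} = (fun S => σ '' S) '' {S | IsPathSet R S t} := by
    ext S
    constructor
    · intro hS
      refine ⟨σ.symm '' S, IsPathSet.image_perm (R := R') (R' := R) σ.symm ?_ hS, ?_⟩
      · intro a b
        rw [← h]; simp
      · simp
    · rintro ⟨T, hT, rfl⟩
      exact hT.image_perm σ h
  rw [this, Set.ncard_image_of_injective _ (Set.image_injective.2 σ.injective)]

/-- Being a path component depends only on the edges at its own vertices, so components away from
the changed edges survive. -/
theorem IsPathSet.congr_on {W : Type*} {R R' : SimpleGraph W} {S : Set W} {t : ℕ}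
    (hS : IsPathSet R S t) (h : ∀ a ∈ S, ∀ b, R'.Adj a b ↔ R.Adj a b) : IsPathSet R' S t := by
  obtain ⟨g, h1, h2, h3⟩ := hS
  refine ⟨g, h1, h2, fun i hi w => ?_⟩
  rw [h _ ((h2 _).2 ⟨i, hi, rfl⟩), h3 i hi]

/-! ### Exchanging the colours of two edges -/

/-- Replace the edge `ab` of `R` by the edge `cd`. -/
def SimpleGraph.exchange {W : Type*} (R : SimpleGraph W) (a b c d : W) : SimpleGraph W :=
  (R \ SimpleGraph.edge a b) ⊔ SimpleGraph.edge c d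

theorem SimpleGraph.exchange_adj {W : Type*} (R : SimpleGraph W) {a b c d : W} (hcd : c ≠ d)
    (x y : W) : (R.exchange a b c d).Adj x y ↔
      (R.Adj x y ∧ ¬ (x = a ∧ y = b) ∧ ¬ (x = b ∧ y = a)) ∨ (x = c ∧ y = d) ∨ (x = d ∧ y = c) := by
  simp only [SimpleGraph.exchange, SimpleGraph.sup_adj, SimpleGraph.sdiff_adj,
    SimpleGraph.edge_adj]
  constructor
  · rintro (⟨h, h'⟩ | ⟨h, -⟩)
    · have := h.ne
      left; refine ⟨h, ?_, ?_⟩ <;> tauto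
    · tauto
  · rintro (⟨h, h1, h2⟩ | ⟨rfl, rfl⟩ | ⟨rfl, rfl⟩)
    · left; refine ⟨h, ?_⟩; tauto
    · right; tauto
    · right; have := hcd.symm; tauto

theorem isPathSet_pair {W : Type*} {B : SimpleGraph W} {v y : W} (hv : ∀ w, B.Adj v w ↔ w = y)
    (hy : ∀ w, B.Adj y w ↔ w = v) : IsPathSet B {v, y} 1 := by
  have hne : v ≠ y := ((hv y).2 rfl).ne
  refine ⟨fun i => if i = 0 then v else y, ?_, ?_, ?_⟩
  · intro i hi j hj hij
    grind
  · intro w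
    constructor
    · rintro (rfl | rfl)
      · exact ⟨0, by omega, rfl⟩
      · exact ⟨1, le_rfl, rfl⟩
    · rintro ⟨i, -, rfl⟩
      dsimp only
      split_ifs <;> simp
  · intro i hi w
    have : i = 0 ∨ i = 1 := by omega
    rcases this with rfl | rfl
    · simp only [if_true, hv]
      constructor
      · rintro rfl
        exact ⟨1, le_rfl, by omega, rfl⟩
      · rintro ⟨j, hj, h, rfl⟩
        have : j = 1 := by omega
        simp [this]
    · simp only [one_ne_zero, if_false, hy]
      constructor
      · rintro rfl
        exact ⟨0, by omega, by omega, rfl⟩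
      · rintro ⟨j, hj, h, rfl⟩
        have : j = 0 := by omega
        simp [this]

theorem isPathSet_triple {W : Type*} {B : SimpleGraph W} {v y x : W} (hxv : x ≠ v)
    (hv : ∀ w, B.Adj v w ↔ w = y) (hy : ∀ w, B.Adj y w ↔ w = v ∨ w = x)
    (hx : ∀ w, B.Adj x w ↔ w = y) : IsPathSet B {v, y, x} 2 := by
  have hne : v ≠ y := ((hv y).2 rfl).ne
  have hne' : x ≠ y := ((hx y).2 rfl).ne
  refine ⟨fun i => if i = 0 then v else if i = 1 then y else x, ?_, ?_, ?_⟩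
  · intro i hi j hj hij
    grind
  · intro w
    constructor
    · rintro (rfl | rfl | rfl)
      · exact ⟨0, by omega, rfl⟩
      · exact ⟨1, by omega, rfl⟩
      · exact ⟨2, by omega, rfl⟩
    · rintro ⟨i, -, rfl⟩
      dsimp only
      split_ifs <;> simp
  · intro i hi w
    have : i = 0 ∨ i = 1 ∨ i = 2 := by omega
    rcases this with rfl | rfl | rfl
    · simp only [if_true, hv]
      constructor
      · rintro rfl
        exact ⟨1, by omega, by omega, rfl⟩
      · rintro ⟨j, hj, h, rfl⟩
        have : j = 1 := by omega
        simp [this]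
    · simp only [one_ne_zero, if_false, if_true, hy]
      constructor
      · rintro (rfl | rfl)
        · exact ⟨0, by omega, by omega, rfl⟩
        · exact ⟨2, by omega, by omega, rfl⟩
      · rintro ⟨j, hj, h, rfl⟩
        have : j = 0 ∨ j = 2 := by omega
        rcases this with rfl | rfl <;> simp
    · simp only [OfNat.ofNat_ne_zero, OfNat.ofNat_ne_one, if_false, hx]
      constructor
      · rintro rfl
        exact ⟨1, by omega, by omega, rfl⟩
      · rintro ⟨j, hj, h, rfl⟩
        have : j = 1 := by omega
        simp [this]

/-- Moving the end edge x₀x₁ of the long path to x₀y leaves the components x₁ … x_ℓ and v y x₀, with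
ℓ - 1 and 2 edges. Both are shorter than ℓ because 3 ≤ ℓ, so they enter none of the counts in the
conclusion, and just one path with ℓ edges is lost. -/
theorem blue_exchange {W : Type*} [Finite W] {B : SimpleGraph W} {ℓ : ℕ} (hℓ : 3 ≤ ℓ) (x : ℕ → W)
    (hinj : ∀ i ≤ ℓ, ∀ j ≤ ℓ, x i = x j → i = j)
    (hx : ∀ i ≤ ℓ, ∀ w, B.Adj (x i) w ↔ ∃ j ≤ ℓ, (j = i + 1 ∨ i = j + 1) ∧ x j = w)
    {v y : W} (hv : ∀ w, B.Adj v w ↔ w = y) (hy : ∀ w, B.Adj y w ↔ w = v)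
    (hcomp : ∀ w, ∃ S t, w ∈ S ∧ IsPathSet B S t) :
    (∀ w, ∃ S t, w ∈ S ∧ IsPathSet (B.exchange (x 0) (x 1) (x 0) y) S t) ∧
    (∀ t, ℓ < t → numPathComponents (B.exchange (x 0) (x 1) (x 0) y) t =
      numPathComponents B t) ∧
    numPathComponents (B.exchange (x 0) (x 1) (x 0) y) ℓ + 1 = numPathComponents B ℓ := by
  set X : Set W := {w | ∃ i ≤ ℓ, x i = w} with hX
  have hXP : IsPathSet B X ℓ := ⟨x, hinj, fun w => Iff.rfl, hx⟩
  have hvyP : IsPathSet B {v, y} 1 := isPathSet_pair hv hy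
  have hvy : v ≠ y := ((hv y).2 rfl).ne
  have hXne : X ≠ {v, y} := by
    intro h
    have h1 := hXP.ncard_eq
    rw [h, hvyP.ncard_eq] at h1
    omega
  have hvX : v ∉ X := fun h => hXne (hXP.eq_of_mem hvyP h (by simp))
  have hyX : y ∉ X := fun h => hXne (hXP.eq_of_mem hvyP h (by simp))
  have hmem : ∀ i ≤ ℓ, x i ∈ X := fun i hi => ⟨i, hi, rfl⟩
  have hx0y : x 0 ≠ y := fun h => hyX (h ▸ hmem 0 (by omega))
  have hx0v : x 0 ≠ v := fun h => hvX (h ▸ hmem 0 (by omega))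
  have hx1y : x 1 ≠ y := fun h => hyX (h ▸ hmem 1 (by omega))
  have hx1v : x 1 ≠ v := fun h => hvX (h ▸ hmem 1 (by omega))
  have hx01 : x 0 ≠ x 1 := fun h => by have := hinj 0 (by omega) 1 (by omega) h; omega
  set B' := B.exchange (x 0) (x 1) (x 0) y with hB'
  have hadj := B.exchange_adj (a := x 0) (b := x 1) hx0y
  rw [← hB'] at hadj
  have hx0 : ∀ w, B.Adj (x 0) w ↔ w = x 1 := by
    intro w
    rw [hx 0 (by omega)]
    constructor
    · rintro ⟨j, hj, h, rfl⟩
      have : j = 1 := by omega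
      rw [this]
    · rintro rfl
      exact ⟨1, by omega, by omega, rfl⟩
  have hv' : ∀ w, B'.Adj v w ↔ w = y := by
    intro w
    rw [hadj, hv]
    constructor
    · rintro (h | ⟨h, -⟩ | ⟨h, -⟩)
      · exact h.1
      · exact (hx0v h.symm).elim
      · exact (hvy h).elim
    · rintro rfl
      refine Or.inl ⟨rfl, fun h => hx0v h.1.symm, fun h => hx1v h.1.symm⟩
  have hy' : ∀ w, B'.Adj y w ↔ w = v ∨ w = x 0 := by
    intro w
    rw [hadj, hy]
    constructor
    · rintro (h | ⟨h, -⟩ | ⟨-, h⟩)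
      · exact Or.inl h.1
      · exact (hx0y h.symm).elim
      · exact Or.inr h
    · rintro (rfl | rfl)
      · exact Or.inl ⟨rfl, fun h => hx0y h.1.symm, fun h => hx1y h.1.symm⟩
      · exact Or.inr (Or.inr ⟨rfl, rfl⟩)
  have hx0' : ∀ w, B'.Adj (x 0) w ↔ w = y := by
    intro w
    rw [hadj, hx0]
    constructor
    · rintro (h | ⟨-, h⟩ | ⟨h, -⟩)
      · exact (h.2.1 ⟨rfl, h.1⟩).elim
      · exact h
      · exact (hx0y h).elim
    · rintro rfl
      exact Or.inr (Or.inl ⟨rfl, rfl⟩)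
  have hY : IsPathSet B' {v, y, x 0} 2 := isPathSet_triple hx0v hv' hy' hx0'
  set X1 : Set W := {w | ∃ i ≤ ℓ - 1, x (i + 1) = w} with hX1
  have hX1P : IsPathSet B' X1 (ℓ - 1) := by
    refine ⟨fun i => x (i + 1), ?_, fun w => Iff.rfl, ?_⟩
    · intro i hi j hj hij
      have := hinj (i + 1) (by omega) (j + 1) (by omega) hij
      omega
    · intro i hi w
      rw [hadj, hx (i + 1) (by omega)]
      have hne : x (i + 1) ≠ x 0 := fun h => by
        have := hinj _ (by omega) _ (by omega) h
        omega
      have hney : x (i + 1) ≠ y := fun h => hyX (h ▸ hmem _ (by omega))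
      constructor
      · rintro (⟨⟨j, hj, hij, rfl⟩, h1, h2⟩ | ⟨h, -⟩ | ⟨h, -⟩)
        · have hj0 : j ≠ 0 := by
            rintro rfl
            have hi0 : i = 0 := by omega
            subst hi0
            exact h2 ⟨rfl, rfl⟩
          exact ⟨j - 1, by omega, by omega, congrArg x (by omega)⟩
        · exact (hne h).elim
        · exact (hney h).elim
      · rintro ⟨j, hj, hij, rfl⟩
        refine Or.inl ⟨⟨j + 1, by omega, by omega, rfl⟩, fun h => hne h.1, fun h => ?_⟩
        have := hinj _ (by omega) _ (by omega) h.2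
        omega
  have hsame : ∀ a, a ∉ X → a ≠ y → ∀ b, B'.Adj a b ↔ B.Adj a b := by
    intro a ha hay b
    have h0 : a ≠ x 0 := fun h => ha (h ▸ hmem 0 (by omega))
    have h1 : a ≠ x 1 := fun h => ha (h ▸ hmem 1 (by omega))
    rw [hadj]
    tauto
  have hXsub : ∀ w ∈ X, w = x 0 ∨ w ∈ X1 := by
    rintro w ⟨i, hi, rfl⟩
    rcases Nat.eq_zero_or_pos i with rfl | h
    · exact Or.inl rfl
    · refine Or.inr ⟨i - 1, by omega, ?_⟩
      congr 1
      omega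
  -- path sets away from the gadget agree
  have hto : ∀ S t, IsPathSet B S t → S ≠ X → S ≠ {v, y} → IsPathSet B' S t := by
    intro S t hS h1 h2
    refine hS.congr_on fun a ha => hsame a ?_ ?_
    · intro haX
      exact h1 (hS.eq_of_mem hXP ha haX)
    · rintro rfl
      exact h2 (hS.eq_of_mem hvyP ha (by simp))
  have hfrom : ∀ S t, IsPathSet B' S t → S ≠ X1 → S ≠ {v, y, x 0} → IsPathSet B S t := by
    intro S t hS h1 h2
    refine hS.congr_on fun a ha => (fun b => (hsame a ?_ ?_ b).symm)
    · intro haX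
      rcases hXsub a haX with rfl | h
      · exact h2 (hS.eq_of_mem hY ha (by simp))
      · exact h1 (hS.eq_of_mem hX1P ha h)
    · rintro rfl
      exact h2 (hS.eq_of_mem hY ha (by simp))
  have hsize : ∀ S t, IsPathSet B' S t → ℓ ≤ t → S ≠ X1 ∧ S ≠ {v, y, x 0} := by
    intro S t hS ht
    have h1 := hS.ncard_eq
    constructor
    · rintro rfl
      rw [hX1P.ncard_eq] at h1; omega
    · rintro rfl
      rw [hY.ncard_eq] at h1; omega
  refine ⟨?_, ?_, ?_⟩
  · intro w
    by_cases hw : w ∈ X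
    · rcases hXsub w hw with rfl | h
      · exact ⟨_, _, by simp, hY⟩
      · exact ⟨_, _, h, hX1P⟩
    by_cases hwy : w = y
    · subst hwy; exact ⟨_, _, by simp, hY⟩
    by_cases hwv : w = v
    · subst hwv; exact ⟨_, _, by simp, hY⟩
    obtain ⟨S, t, hwS, hS⟩ := hcomp w
    refine ⟨S, t, hwS, hto S t hS ?_ ?_⟩
    · rintro rfl; exact hw hwS
    · rintro rfl
      rcases hwS with h | h
      · exact hwv h
      · exact hwy h
  · intro t ht
    rw [numPathComponents_eq, numPathComponents_eq]
    congr 1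
    ext S
    constructor
    · intro hS
      have := hsize S t hS ht.le
      exact hfrom S t hS this.1 this.2
    · intro hS
      have h1 := IsPathSet.ncard_eq hS
      refine hto S t hS ?_ ?_
      · rintro rfl
        rw [hXP.ncard_eq] at h1; omega
      · rintro rfl
        rw [hvyP.ncard_eq] at h1; omega
  · rw [numPathComponents_eq, numPathComponents_eq]
    have : {S | IsPathSet B S ℓ} = insert X {S | IsPathSet B' S ℓ} := by
      ext S
      constructor
      · intro hS
        by_cases hSX : S = X
        · exact Or.inl hSX
        · right
          refine hto S ℓ hS hSX ?_
          rintro rfl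
          have h1 := IsPathSet.ncard_eq hS
          rw [hvyP.ncard_eq] at h1; omega
      · rintro (rfl | hS)
        · exact hXP
        · have := hsize S ℓ hS le_rfl
          exact hfrom S ℓ hS this.1 this.2
    rw [this, Set.ncard_insert_of_notMem]
    intro hS
    have hyx : x 0 ∈ X := hmem 0 (by omega)
    have hX' : IsPathSet B' X ℓ := hS
    exact hyX (hX'.closed hyx ((hx0' y).2 rfl))

/-- The map σ is a symmetry of the red graph without x₀y and takes x₀y to x₀x₁, so it is an
isomorphism from the red graph before the exchange to the one after it. As σ is an involution, it
only has to preserve edges in one direction. -/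
theorem red_exchange {W : Type*} {R : SimpleGraph W} {x₀ x₁ y : W} (h0y : x₀ ≠ y) (h01 : x₀ ≠ x₁)
    (hadj : R.Adj x₀ y) (hnadj : ¬ R.Adj x₀ x₁) (σ : Equiv.Perm W) (hσ : ∀ a, σ (σ a) = a)
    (hσ0 : σ x₀ = x₀) (hσy : σ y = x₁)
    (hP : ∀ a b, R.Adj a b → ¬ (a = x₀ ∧ b = y) → ¬ (a = y ∧ b = x₀) → R.Adj (σ a) (σ b))
    (a b : W) : (R.exchange x₀ y x₀ x₁).Adj (σ a) (σ b) ↔ R.Adj a b := by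
  have hσ1 : σ x₁ = y := by rw [← hσy, hσ]
  have key : ∀ c d, σ c = d ↔ c = σ d := fun c d =>
    ⟨fun h => by rw [← h, hσ], fun h => by rw [h, hσ]⟩
  rw [R.exchange_adj h01, key, key, key, key, key a x₁, key b x₁, hσ0, hσy, hσ1]
  constructor
  · rintro (⟨h, h1, h2⟩ | ⟨rfl, rfl⟩ | ⟨rfl, rfl⟩)
    · have := hP _ _ h (by rw [key, key, hσ0, hσy]; exact h1) (by rw [key, key, hσ0, hσy]; exact h2)
      rwa [hσ, hσ] at this
    · exact hadj
    · exact hadj.symm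
  · intro h
    by_cases h1 : a = x₀ ∧ b = y
    · exact Or.inr (Or.inl h1)
    by_cases h2 : a = y ∧ b = x₀
    · exact Or.inr (Or.inr h2)
    refine Or.inl ⟨hP _ _ h h1 h2, ?_, ?_⟩
    · rintro ⟨rfl, rfl⟩; exact hnadj h
    · rintro ⟨rfl, rfl⟩; exact hnadj h.symm

open Classical in
/-- The reflections of a red path `y u t w x₁` (or degenerations of it). -/
theorem exists_reflection {W : Type*} {R : SimpleGraph W} {x₀ x₁ y : W} (h0y : x₀ ≠ y)
    (h01 : x₀ ≠ x₁) (hy1 : y ≠ x₁) {u w : W}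
    (hy : ∀ c, R.Adj y c ↔ c = x₀ ∨ c = u) (hx1 : ∀ c, R.Adj x₁ c ↔ c = w)
    (hu0 : u ≠ x₀) (hw0 : w ≠ x₀)
    (h : u = x₁ ∨ u = w ∨ (u ≠ w ∧ u ≠ x₁ ∧ w ≠ y ∧
      ((∃ t, t ≠ u ∧ t ≠ w ∧ t ≠ y ∧ t ≠ x₁ ∧ t ≠ x₀ ∧ (∀ c, R.Adj u c ↔ c = y ∨ c = t) ∧
        (∀ c, R.Adj w c ↔ c = x₁ ∨ c = t)) ∨
      ((∀ c, R.Adj u c ↔ c = y) ∧ (∀ c, R.Adj w c ↔ c = x₁))))) :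
    ∃ σ : Equiv.Perm W, (∀ a, σ (σ a) = a) ∧ σ x₀ = x₀ ∧ σ y = x₁ ∧
      ∀ a b, R.Adj a b → ¬ (a = x₀ ∧ b = y) → ¬ (a = y ∧ b = x₀) → R.Adj (σ a) (σ b) := by
  have hsy : ∀ c, R.Adj c y ↔ c = x₀ ∨ c = u := fun c => by rw [R.adj_comm, hy]
  have hsx1 : ∀ c, R.Adj c x₁ ↔ c = w := fun c => by rw [R.adj_comm, hx1]
  have hyu : y ≠ u := ((hy u).2 (Or.inr rfl)).ne
  have hxw : x₁ ≠ w := ((hx1 w).2 rfl).ne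
  by_cases huw : u = x₁ ∨ u = w
  · refine ⟨Equiv.swap y x₁, fun a => Equiv.swap_apply_self _ _ _, ?_, ?_, ?_⟩
    · exact Equiv.swap_apply_of_ne_of_ne h0y h01
    · exact Equiv.swap_apply_left _ _
    · intro a b hab h1 h2
      simp only [Equiv.swap_apply_def]
      -- In the first case the tail is the edge y x₁ itself, so w = y; in the second both y and x₁
      -- are next to the fixed vertex u.
      rcases huw with rfl | rfl
      · have : w = y := ((hx1 y).1 ((hsy _).2 (Or.inr rfl)).symm.symm).symm ▸ rfl
        grind
      · grind
  · push Not at huw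
    rcases h with h | h | ⟨-, -, hwy, h⟩
    · exact (huw.1 h).elim
    · exact (huw.2 h).elim
    obtain ⟨hux, huw⟩ := huw
    -- The two transpositions are disjoint. Their product reverses y u t w x₁ with t fixed, or
    -- interchanges the separate edges yu and x₁w.
    have hσ : ∀ a, (Equiv.swap y x₁ * Equiv.swap u w) a =
        if a = y then x₁ else if a = x₁ then y else if a = u then w else if a = w then u else a := by
      intro a
      simp only [Equiv.Perm.mul_apply, Equiv.swap_apply_def]
      grind
    refine ⟨Equiv.swap y x₁ * Equiv.swap u w, ?_, ?_, ?_, ?_⟩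
    · intro a
      rw [hσ, hσ]
      grind
    · rw [hσ]; grind
    · rw [hσ]; grind
    · intro a b hab h1 h2
      rw [hσ, hσ]
      rcases h with ⟨t, ht1, ht2, ht3, ht4, ht5, hu, hw⟩ | ⟨hu, hw⟩
      · have hsu : ∀ c, R.Adj c u ↔ c = y ∨ c = t := fun c => by rw [R.adj_comm, hu]
        have hsw : ∀ c, R.Adj c w ↔ c = x₁ ∨ c = t := fun c => by rw [R.adj_comm, hw]
        grind
      · have hsu : ∀ c, R.Adj c u ↔ c = y := fun c => by rw [R.adj_comm, hu]
        have hsw : ∀ c, R.Adj c w ↔ c = x₁ := fun c => by rw [R.adj_comm, hw]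
        grind

/-! ### Frames of gadgets -/

/-- The vertices `x 0, …, x ℓ`, `y`, `v` carry the configuration whose recolouring (exchanging the
colours of the edges `x₀ y` and `x₀ x₁`) shortens the blue path `x 0, …, x ℓ`. -/
structure IsGadgetFrame {U : Type*} (R B : SimpleGraph U) (ℓ : ℕ) (x : ℕ → U) (y v : U) :
    Prop where
  inj : ∀ i ≤ ℓ, ∀ j ≤ ℓ, x i = x j → i = j
  path : ∀ i < ℓ, B.Adj (x i) (x (i + 1))
  adj_y : R.Adj (x 0) y
  red_start : ∃ z, z ≠ y ∧ R.Adj (x 0) z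
  adj_v : B.Adj y v
  red_v : ∃ a b, a ≠ b ∧ R.Adj v a ∧ R.Adj v b
  red_end : ∃ a b, a ≠ b ∧ R.Adj (x ℓ) a ∧ R.Adj (x ℓ) b
  kind : ∃ u w, R.Adj y u ∧ u ≠ x 0 ∧ R.Adj (x 1) w ∧ (u = x 1 ∨ u = w ∨ (u ≠ w ∧
    ((∃ t, t ≠ y ∧ t ≠ x 1 ∧ R.Adj u t ∧ R.Adj t w) ∨
      ((∃ a b, a ≠ b ∧ B.Adj u a ∧ B.Adj u b) ∧ ∃ a b, a ≠ b ∧ B.Adj w a ∧ B.Adj w b))))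

/-- A frame asserts that certain edges exist and certain vertices differ, never that an edge is
absent. Hence it carries over to every coloured graph containing a copy. -/
theorem IsGadgetFrame.map {U W : Type*} {R B : SimpleGraph U} {ℓ : ℕ} {x : ℕ → U} {y v : U}
    (h : IsGadgetFrame R B ℓ x y v) {R' B' : SimpleGraph W} (f : U ↪ W)
    (hR : ∀ a b, R.Adj a b → R'.Adj (f a) (f b)) (hB : ∀ a b, B.Adj a b → B'.Adj (f a) (f b)) :
    IsGadgetFrame R' B' ℓ (fun i => f (x i)) (f y) (f v) := by
  have hne : ∀ a b, f a ≠ f b ↔ a ≠ b := fun a b => f.injective.ne_iff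
  constructor
  · exact fun i hi j hj hij => h.inj i hi j hj (f.injective hij)
  · exact fun i hi => hB _ _ (h.path i hi)
  · exact hR _ _ h.adj_y
  · obtain ⟨z, hz, hz'⟩ := h.red_start
    exact ⟨f z, (hne _ _).2 hz, hR _ _ hz'⟩
  · exact hB _ _ h.adj_v
  · obtain ⟨a, b, h1, h2, h3⟩ := h.red_v
    exact ⟨f a, f b, (hne _ _).2 h1, hR _ _ h2, hR _ _ h3⟩
  · obtain ⟨a, b, h1, h2, h3⟩ := h.red_end
    exact ⟨f a, f b, (hne _ _).2 h1, hR _ _ h2, hR _ _ h3⟩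
  · obtain ⟨u, w, h1, h2, h3, h4⟩ := h.kind
    refine ⟨f u, f w, hR _ _ h1, (hne _ _).2 h2, hR _ _ h3, ?_⟩
    rcases h4 with h4 | h4 | ⟨h4, ⟨t, h5, h6, h7, h8⟩ | ⟨⟨a, b, h5, h6, h7⟩, c, d, h8, h9, h10⟩⟩
    · exact Or.inl (by rw [h4])
    · exact Or.inr (Or.inl (by rw [h4]))
    · exact Or.inr (Or.inr ⟨(hne _ _).2 h4, Or.inl
        ⟨f t, (hne _ _).2 h5, (hne _ _).2 h6, hR _ _ h7, hR _ _ h8⟩⟩)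
    · exact Or.inr (Or.inr ⟨(hne _ _).2 h4, Or.inr
        ⟨⟨f a, f b, (hne _ _).2 h5, hB _ _ h6, hB _ _ h7⟩,
          f c, f d, (hne _ _).2 h8, hB _ _ h9, hB _ _ h10⟩⟩)

/-- With path components and at most three edges at a vertex, two edges of one colour leave room for
at most one of the other and exclude a third of the same. So the frame determines the neighbourhoods
that matter: vy and x₀ … x_ℓ are whole blue components, and the red edges at y, x₁, u, t, w are
known as far as `exists_reflection` requires. -/
theorem IsGadgetFrame.exchange {W : Type*} [Finite W] {R B : SimpleGraph W} (hdisj : Disjoint R B)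
    {ℓ : ℕ} (hℓ : 3 ≤ ℓ) {x : ℕ → W} {y v : W} (h : IsGadgetFrame R B ℓ x y v)
    (hR : ∀ w, ∃ S t, w ∈ S ∧ IsPathSet R S t) (hB : ∀ w, ∃ S t, w ∈ S ∧ IsPathSet B S t)
    (hdeg : ∀ a b c d e, (R.Adj a b ∨ B.Adj a b) → (R.Adj a c ∨ B.Adj a c) →
      (R.Adj a d ∨ B.Adj a d) → (R.Adj a e ∨ B.Adj a e) → b ≠ c → b ≠ d → c ≠ d →
      e = b ∨ e = c ∨ e = d) :
    ((∀ w, ∃ S t, w ∈ S ∧ IsPathSet (R.exchange (x 0) y (x 0) (x 1)) S t) ∧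
      ∀ t, numPathComponents (R.exchange (x 0) y (x 0) (x 1)) t = numPathComponents R t) ∧
    (∀ w, ∃ S t, w ∈ S ∧ IsPathSet (B.exchange (x 0) (x 1) (x 0) y) S t) ∧
    (∀ t, ℓ < t → numPathComponents (B.exchange (x 0) (x 1) (x 0) y) t =
      numPathComponents B t) ∧
    numPathComponents (B.exchange (x 0) (x 1) (x 0) y) ℓ + 1 = numPathComponents B ℓ := by
  have hRB : ∀ a b, R.Adj a b → B.Adj a b → False := fun a b h1 h2 =>
    SimpleGraph.disjoint_left.1 hdisj a b h1 h2
  have hne : ∀ a b c, R.Adj a b → B.Adj a c → b ≠ c := by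
    rintro a b c h1 h2 rfl
    exact hRB _ _ h1 h2
  have hR2 : ∀ a b c d, R.Adj a b → R.Adj a c → b ≠ c → R.Adj a d → d = b ∨ d = c := by
    intro a b c d h1 h2 h3 h4
    obtain ⟨S, t, ha, hS⟩ := hR a
    have := hS.card_nbrs ha h1 h2 h4
    grind
  have hB2 : ∀ a b c d, B.Adj a b → B.Adj a c → b ≠ c → B.Adj a d → d = b ∨ d = c := by
    intro a b c d h1 h2 h3 h4
    obtain ⟨S, t, ha, hS⟩ := hB a
    have := hS.card_nbrs ha h1 h2 h4
    grind
  have hR1 : ∀ a b c d e, B.Adj a b → B.Adj a c → b ≠ c → R.Adj a d → R.Adj a e → e = d := by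
    intro a b c d e h1 h2 h3 h4 h5
    have := hdeg a b c d e (Or.inr h1) (Or.inr h2) (Or.inl h4) (Or.inl h5) h3
      (hne _ _ _ h4 h1).symm (hne _ _ _ h4 h2).symm
    have := hne _ _ _ h5 h1
    have := hne _ _ _ h5 h2
    tauto
  have hB1 : ∀ a b c d e, R.Adj a b → R.Adj a c → b ≠ c → B.Adj a d → B.Adj a e → e = d := by
    intro a b c d e h1 h2 h3 h4 h5
    have := hdeg a b c d e (Or.inl h1) (Or.inl h2) (Or.inr h4) (Or.inr h5) h3
      (hne _ _ _ h1 h4) (hne _ _ _ h2 h4)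
    have := hne _ _ _ h1 h5
    have := hne _ _ _ h2 h5
    grind
  obtain ⟨z, hzy, hz⟩ := h.red_start
  have h01 : B.Adj (x 0) (x 1) := h.path 0 (by omega)
  have h12 : B.Adj (x 1) (x 2) := h.path 1 (by omega)
  have hx02 : x 0 ≠ x 2 := fun h' => by have := h.inj 0 (by omega) 2 (by omega) h'; omega
  obtain ⟨u, w, hyu, hu0, hw, hkind⟩ := h.kind
  have hyB : ∀ c, B.Adj y c ↔ c = v := fun c =>
    ⟨fun hc => hB1 y (x 0) u v c h.adj_y.symm hyu hu0.symm h.adj_v hc, fun hc => hc ▸ h.adj_v⟩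
  have hvB : ∀ c, B.Adj v c ↔ c = y := by
    obtain ⟨a, b, hab, ha, hb⟩ := h.red_v
    exact fun c => ⟨fun hc => hB1 v a b y c ha hb hab h.adj_v.symm hc, fun hc => hc ▸ h.adj_v.symm⟩
  have hx0B : ∀ c, B.Adj (x 0) c ↔ c = x 1 := fun c =>
    ⟨fun hc => hB1 (x 0) y z (x 1) c h.adj_y hz hzy.symm h01 hc, fun hc => hc ▸ h01⟩
  have hxB : ∀ i ≤ ℓ, ∀ w, B.Adj (x i) w ↔ ∃ j ≤ ℓ, (j = i + 1 ∨ i = j + 1) ∧ x j = w := by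
    intro i hi c
    constructor
    · intro hc
      rcases Nat.eq_zero_or_pos i with rfl | hpos
      · exact ⟨1, by omega, Or.inl rfl, ((hx0B c).1 hc).symm⟩
      have hprev : B.Adj (x i) (x (i - 1)) := by
        have := h.path (i - 1) (by omega)
        rw [Nat.sub_add_cancel hpos] at this
        exact this.symm
      rcases hi.lt_or_eq with hlt | rfl
      · have hne : x (i - 1) ≠ x (i + 1) := fun h' => by
          have := h.inj _ (by omega) _ (by omega) h'; omega
        rcases hB2 _ _ _ c hprev (h.path i hlt) hne hc with h' | h'
        · exact ⟨i - 1, by omega, by omega, h'.symm⟩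
        · exact ⟨i + 1, by omega, by omega, h'.symm⟩
      · obtain ⟨a, b, hab, ha, hb⟩ := h.red_end
        exact ⟨i - 1, by omega, by omega, (hB1 _ _ _ _ _ ha hb hab hprev hc).symm⟩
    · rintro ⟨j, hj, rfl | rfl, rfl⟩
      · exact h.path i (by omega)
      · exact (h.path j (by omega)).symm
  -- The vertex y has only one blue edge, whereas x₁ has two.
  have hyx1 : y ≠ x 1 := by
    intro h'
    rw [← h'] at h01 h12
    exact hx02 (((hyB _).1 h01.symm).trans ((hyB _).1 h12).symm)
  have hyR : ∀ c, R.Adj y c ↔ c = x 0 ∨ c = u := fun c =>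
    ⟨fun hc => hR2 _ _ _ c h.adj_y.symm hyu hu0.symm hc, by
      rintro (rfl | rfl)
      · exact h.adj_y.symm
      · exact hyu⟩
  have hx1R : ∀ c, R.Adj (x 1) c ↔ c = w := fun c =>
    ⟨fun hc => hR1 _ _ _ _ c h01.symm h12 hx02 hw hc, fun hc => hc ▸ hw⟩
  have hw0 : w ≠ x 0 := by
    rintro rfl
    exact hRB _ _ hw h01.symm
  obtain ⟨σ, hσ, hσ0, hσy, hσP⟩ := exists_reflection (R := R) (x₀ := x 0) (x₁ := x 1) (y := y)
    h.adj_y.ne h01.ne hyx1 hyR hx1R hu0 hw0 (by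
      by_cases hux : u = x 1
      · exact Or.inl hux
      rcases hkind with h1 | h1 | ⟨h1, h2⟩
      · exact Or.inl h1
      · exact Or.inr (Or.inl h1)
      refine Or.inr (Or.inr ⟨h1, hux, ?_, ?_⟩)
      · rintro rfl
        rcases (hyR _).1 hw.symm with h3 | h3
        · exact h01.ne h3.symm
        · exact hux h3.symm
      · have hwy : w ≠ y := by
          rintro rfl
          rcases (hyR _).1 hw.symm with h3 | h3
          · exact h01.ne h3.symm
          · exact hux h3.symm
        rcases h2 with ⟨t, ht1, ht2, ht3, ht4⟩ | ⟨⟨a, b, hab, ha, hb⟩, c, d, hcd, hc, hd⟩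
        · refine Or.inl ⟨t, ht3.ne.symm, ht4.ne, ht1, ht2, ?_, fun c => ⟨fun h' =>
            hR2 _ _ _ c hyu.symm ht3 ht1.symm h', ?_⟩, fun c => ⟨fun h' =>
            hR2 _ _ _ c hw.symm ht4.symm ht2.symm h', ?_⟩⟩
          -- If t were x₀, then u and w would be red neighbours of x₀ other than y, hence both equal
          -- to z.
          · rintro rfl
            have e1 := hR2 _ _ _ _ h.adj_y hz hzy.symm ht3.symm
            have e2 := hR2 _ _ _ _ h.adj_y hz hzy.symm ht4
            have := hyu.ne
            grind
          · rintro (rfl | rfl)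
            · exact hyu.symm
            · exact ht3
          · rintro (rfl | rfl)
            · exact hw.symm
            · exact ht4.symm
        · refine Or.inr ⟨fun e => ⟨fun h' => hR1 _ _ _ _ e ha hb hab hyu.symm h', ?_⟩,
            fun e => ⟨fun h' => hR1 _ _ _ _ e hc hd hcd hw.symm h', ?_⟩⟩
          · rintro rfl; exact hyu.symm
          · rintro rfl; exact hw.symm)
  have hiso := red_exchange (R := R) h.adj_y.ne h01.ne h.adj_y (fun h' => hRB _ _ h' h01) σ hσ hσ0
    hσy hσP
  refine ⟨⟨fun a => ?_, numPathComponents_perm σ hiso⟩,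
    blue_exchange hℓ x h.inj hxB hvB hyB hB⟩
  obtain ⟨S, t, ha, hS⟩ := hR (σ a)
  exact ⟨σ '' S, t, ⟨σ a, ha, hσ a⟩, hS.image_perm σ hiso⟩

namespace RedBlueGraph

/-- Except at the two exchanged edges, the new colouring of the copy agrees with the one that `K`
has there, so overwriting acts on each colour as a single exchange. The colour considered is `A` and
the other one is `C`; both assignments to red and blue are used. -/
theorem overwrite_exchange_adj {U W : Type*} {H : RedBlueGraph U} {K : RedBlueGraph W} {f : U ↪ W}
    {x₀ x₁ y : U} (H' : RedBlueGraph U) (hg : H'.graph = H.graph) {A C : SimpleGraph W}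
    {A₀ C₀ : SimpleGraph U} (hgr : H.graph = A₀ ⊔ C₀) (hAC : Disjoint A C)
    (hA : A₀.map f ≤ A) (hC : C₀.map f ≤ C) (h01 : x₀ ≠ x₁) (hC1 : C₀.Adj x₀ x₁)
    (hA1 : A₀.Adj x₀ y) :
    (A \ H'.graph.map f) ⊔ (A₀.exchange x₀ y x₀ x₁).map f =
      A.exchange (f x₀) (f y) (f x₀) (f x₁) := by
  have hAC' : ∀ a b, A.Adj a b → C.Adj a b → False := fun a b h1 h2 =>
    SimpleGraph.disjoint_left.1 hAC a b h1 h2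
  have hAf : ∀ a b, A₀.Adj a b → A.Adj (f a) (f b) := fun a b h =>
    hA ((SimpleGraph.map_adj _ _ _ _).2 ⟨a, b, h, rfl, rfl⟩)
  have hCf : ∀ a b, C₀.Adj a b → C.Adj (f a) (f b) := fun a b h =>
    hC ((SimpleGraph.map_adj _ _ _ _).2 ⟨a, b, h, rfl, rfl⟩)
  ext a b
  rw [SimpleGraph.exchange_adj _ (f.injective.ne h01), SimpleGraph.sup_adj, SimpleGraph.sdiff_adj,
    hg, hgr, SimpleGraph.map_adj, SimpleGraph.map_adj]
  constructor
  · rintro (⟨h1, h2⟩ | ⟨c, d, hcd, rfl, rfl⟩)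
    · refine Or.inl ⟨h1, ?_, ?_⟩
      · rintro ⟨rfl, rfl⟩
        exact h2 ⟨_, _, Or.inl hA1, rfl, rfl⟩
      · rintro ⟨rfl, rfl⟩
        exact h2 ⟨_, _, Or.inl hA1.symm, rfl, rfl⟩
    · rw [SimpleGraph.exchange_adj _ h01] at hcd
      rcases hcd with ⟨h1, h2, h3⟩ | ⟨rfl, rfl⟩ | ⟨rfl, rfl⟩
      · refine Or.inl ⟨hAf _ _ h1, fun h => h2 ?_, fun h => h3 ?_⟩
        · exact ⟨f.injective h.1, f.injective h.2⟩
        · exact ⟨f.injective h.1, f.injective h.2⟩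
      · exact Or.inr (Or.inl ⟨rfl, rfl⟩)
      · exact Or.inr (Or.inr ⟨rfl, rfl⟩)
  · rintro (⟨h1, h2, h3⟩ | ⟨rfl, rfl⟩ | ⟨rfl, rfl⟩)
    · by_cases h4 : ∃ c d, (A₀ ⊔ C₀).Adj c d ∧ f c = a ∧ f d = b
      · obtain ⟨c, d, hcd | hcd, rfl, rfl⟩ := h4
        · refine Or.inr ⟨c, d, (SimpleGraph.exchange_adj _ h01 _ _).2 (Or.inl ⟨hcd, ?_, ?_⟩), rfl, rfl⟩
          · rintro ⟨rfl, rfl⟩; exact h2 ⟨rfl, rfl⟩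
          · rintro ⟨rfl, rfl⟩; exact h3 ⟨rfl, rfl⟩
        · exact (hAC' _ _ h1 (hCf _ _ hcd)).elim
      · exact Or.inl ⟨h1, h4⟩
    · exact Or.inr ⟨x₀, x₁, (SimpleGraph.exchange_adj _ h01 _ _).2 (Or.inr (Or.inl ⟨rfl, rfl⟩)), rfl, rfl⟩
    · exact Or.inr ⟨x₁, x₀, (SimpleGraph.exchange_adj _ h01 _ _).2 (Or.inr (Or.inr ⟨rfl, rfl⟩)), rfl, rfl⟩

/-- Four distinct neighbours contradict an upper bound of three. -/
theorem eq_of_encard_neighborSet_le {W : Type*} {G : SimpleGraph W} {a b c d e : W}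
    (hdeg : (G.neighborSet a).encard ≤ 3) (hb : G.Adj a b) (hc : G.Adj a c) (hd : G.Adj a d)
    (he : G.Adj a e) (hbc : b ≠ c) (hbd : b ≠ d) (hcd : c ≠ d) : e = b ∨ e = c ∨ e = d := by
  by_contra hcon
  push Not at hcon
  have hsub : ({e, b, c, d} : Set W) ⊆ G.neighborSet a := by
    rintro _ (rfl | rfl | rfl | rfl) <;> assumption
  have h1 := Set.encard_le_encard hsub
  have h2 : ({e, b, c, d} : Set W).encard = 4 := by
    rw [Set.encard_insert_of_notMem (by simp [hcon]), Set.encard_insert_of_notMem (by simp [hbc, hbd]),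
      Set.encard_pair hcd]
    norm_num
  rw [h2] at h1
  exact absurd (h1.trans hdeg) (by decide)

/-- The second colouring exchanges the colours of x₀x₁ and x₀y, so the red edge sets differ in these
two edges only. The counts come from `IsGadgetFrame.exchange`, applied to the image of the frame in
`K`. -/
theorem isBlueGadget_of_frame {U : Type*} (H : RedBlueGraph U) {ℓ : ℕ} (hℓ : 3 ≤ ℓ)
    (hdeg : ∀ v, (H.graph.neighborSet v).encard ≤ 3) {x : ℕ → U} {y v : U}
    (h : IsGadgetFrame H.red H.blue ℓ x y v) : H.IsBlueGadget ℓ := by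
  have hRB : ∀ a b, H.red.Adj a b → H.blue.Adj a b → False := fun a b h1 h2 =>
    SimpleGraph.disjoint_left.1 H.disj a b h1 h2
  have h01 : H.blue.Adj (x 0) (x 1) := h.path 0 (by omega)
  have htwo : ∀ a b c d, c ≠ d → H.red.Adj a c → H.red.Adj a d → H.blue.Adj a b →
      (H.red.neighborSet a).encard = 2 := by
    intro a b c d hcd hc hd hb
    have : H.red.neighborSet a = {c, d} := by
      ext e
      constructor
      · intro he
        have he : H.red.Adj a e := he
        rcases eq_of_encard_neighborSet_le (hdeg a) (Or.inl hc) (Or.inl hd) (Or.inr hb) (Or.inl he) hcd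
          (fun h' => hRB _ _ hc (h' ▸ hb)) (fun h' => hRB _ _ hd (h' ▸ hb)) with h' | h' | h'
        · exact Or.inl h'
        · exact Or.inr h'
        · exact (hRB _ _ he (h' ▸ hb)).elim
      · rintro (rfl | rfl) <;> assumption
    rw [this, Set.encard_pair hcd]
  have hxy : x 1 ≠ y := by
    intro h'
    exact hRB _ _ h.adj_y (h' ▸ h01)
  have hgraph : H.red.exchange (x 0) y (x 0) (x 1) ⊔ H.blue.exchange (x 0) (x 1) (x 0) y
      = H.graph := by
    have hy := h.adj_y
    ext a b
    rw [SimpleGraph.sup_adj, SimpleGraph.exchange_adj _ h01.ne, SimpleGraph.exchange_adj _ h.adj_y.ne]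
    constructor
    · rintro ((h1 | ⟨rfl, rfl⟩ | ⟨rfl, rfl⟩) | (h1 | ⟨rfl, rfl⟩ | ⟨rfl, rfl⟩))
      · exact Or.inl h1.1
      · exact Or.inr h01
      · exact Or.inr h01.symm
      · exact Or.inr h1.1
      · exact Or.inl hy
      · exact Or.inl hy.symm
    · rintro (h1 | h1) <;> tauto
  have hdj : Disjoint (H.red.exchange (x 0) y (x 0) (x 1)) (H.blue.exchange (x 0) (x 1) (x 0) y) := by
    rw [SimpleGraph.disjoint_left]
    intro a b h1 h2
    rw [SimpleGraph.exchange_adj _ h01.ne] at h1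
    rw [SimpleGraph.exchange_adj _ h.adj_y.ne] at h2
    have := h01.ne
    have := h.adj_y.ne
    have := hRB a b
    rcases h1 with h1 | ⟨rfl, rfl⟩ | ⟨rfl, rfl⟩ <;> tauto
  refine ⟨hdeg, ?_, ⟨H.red.exchange (x 0) y (x 0) (x 1), H.blue.exchange (x 0) (x 1) (x 0) y, hdj⟩,
    hgraph, ?_, ?_⟩
  · obtain ⟨p, hp, he⟩ := H.blue.exists_walk_getVert x ℓ h.path
    refine ⟨x 0, x ℓ, p, ?_, ?_, ?_, ?_⟩
    · rw [SimpleGraph.Walk.isPath_def, hp]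
      refine List.Nodup.map_on ?_ List.nodup_range
      intro a ha b hb hab
      rw [List.mem_range] at ha hb
      exact h.inj a (by omega) b (by omega) hab
    · have := p.length_support
      rw [hp] at this
      simpa using this.symm
    · obtain ⟨z, hz, hz'⟩ := h.red_start
      exact htwo _ _ _ _ hz.symm h.adj_y hz' h01
    · obtain ⟨a, b, hab, ha, hb⟩ := h.red_end
      refine htwo _ (x (ℓ - 1)) _ _ hab ha hb ?_
      have := h.path (ℓ - 1) (by omega)
      rw [Nat.sub_add_cancel (by omega)] at this
      exact this.symm
  · have hsub : symmDiff H.red.edgeSet (H.red.exchange (x 0) y (x 0) (x 1)).edgeSet ⊆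
        {s(x 0, y), s(x 0, x 1)} := by
      intro e he
      induction e using Sym2.ind with
      | h a b =>
        rw [Set.mem_symmDiff, SimpleGraph.mem_edgeSet, SimpleGraph.mem_edgeSet,
          SimpleGraph.exchange_adj _ h01.ne] at he
        simp only [Set.mem_insert_iff, Set.mem_singleton_iff, Sym2.eq_iff]
        tauto
    exact (Set.encard_le_encard hsub).trans (Set.encard_insert_le _ _ |>.trans (by
      rw [Set.encard_singleton]; norm_num))
  · intro W _ K _ f hreg hpaths hcopy
    have hmap : IsGadgetFrame K.red K.blue ℓ (fun i => f (x i)) (f y) (f v) :=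
      h.map f (fun a b hab => hcopy.1 ((SimpleGraph.map_adj _ _ _ _).2 ⟨a, b, hab, rfl, rfl⟩))
        (fun a b hab => hcopy.2 ((SimpleGraph.map_adj _ _ _ _).2 ⟨a, b, hab, rfl, rfl⟩))
    have hKdeg : ∀ w, (K.graph.neighborSet w).encard ≤ 3 := by
      intro w
      have h1 := hreg w
      rw [← SimpleGraph.coe_neighborFinset, Set.encard_coe_eq_coe_finsetCard,
        SimpleGraph.card_neighborFinset_eq_degree, h1]
      norm_num
    have key := hmap.exchange K.disj hℓ ((forall_isPathComponent_iff _).1 hpaths.1)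
      ((forall_isPathComponent_iff _).1 hpaths.2)
      (fun a b c d e hb hc hd he h1 h2 h3 =>
        eq_of_encard_neighborSet_le (hKdeg a) hb hc hd he h1 h2 h3)
    have hr := overwrite_exchange_adj (H := H) (K := K) (f := f)
      ⟨H.red.exchange (x 0) y (x 0) (x 1), H.blue.exchange (x 0) (x 1) (x 0) y, hdj⟩
      hgraph rfl K.disj hcopy.1 hcopy.2 h01.ne h01 h.adj_y
    have hb := overwrite_exchange_adj (H := H) (K := K) (f := f)
      ⟨H.red.exchange (x 0) y (x 0) (x 1), H.blue.exchange (x 0) (x 1) (x 0) y, hdj⟩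
      hgraph (sup_comm _ _) K.disj.symm hcopy.2 hcopy.1 h.adj_y.ne h.adj_y h01
    unfold ComponentsArePaths
    rw [forall_isPathComponent_iff, forall_isPathComponent_iff]
    simp only [overwrite]
    rw [hr, hb]
    exact ⟨⟨key.1.1, key.2.1⟩, key.1.2, key.2.2⟩

end RedBlueGraph

/-! ### Maximal acyclic extensions of a partial colouring -/

theorem SimpleGraph.Walk.IsCycle.exists_other_edge {V : Type*} {G : SimpleGraph V} {v : V}
    {C : G.Walk v v} (hC : C.IsCycle) {x y : V} (hxy : s(x, y) ∈ C.edges) :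
    ∃ x', x' ≠ y ∧ s(x, x') ∈ C.edges := by
  classical
  have hx : x ∈ C.support := C.fst_mem_support_of_mem_edges hxy
  have hrot := hC.rotate hx
  have hmem : ∀ e, e ∈ (C.rotate x hx).edges ↔ e ∈ C.edges := fun e =>
    (SimpleGraph.Walk.rotate_edges C x hx).mem_iff
  have hlen := hrot.three_le_length
  have hnil : ¬ (C.rotate x hx).Nil := hrot.not_nil
  have h1 : s(x, (C.rotate x hx).snd) ∈ (C.rotate x hx).edges := by
    rw [SimpleGraph.Walk.mk_mem_edges_iff_exists]
    exact ⟨0, by omega, by simp⟩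
  have h2 : s(x, (C.rotate x hx).penultimate) ∈ (C.rotate x hx).edges := by
    rw [SimpleGraph.Walk.mk_mem_edges_iff_exists]
    refine ⟨(C.rotate x hx).length - 1, by omega, ?_⟩
    rw [Nat.sub_add_cancel (by omega), SimpleGraph.Walk.getVert_length]
    exact Sym2.eq_swap
  by_cases h : (C.rotate x hx).snd = y
  · exact ⟨_, fun h' => hrot.snd_ne_penultimate (h.trans h'.symm), (hmem _).1 h2⟩
  · exact ⟨_, h, (hmem _).1 h1⟩

/-- In a graph of maximum degree two, if `x ≠ y` are connected and have degree at most one then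
all other vertices in their component have degree two. -/
theorem exists_two_nbrs_of_between {V : Type*} {R : SimpleGraph V}
    (hmax : ∀ a b c d, R.Adj a b → R.Adj a c → R.Adj a d → b = c ∨ b = d ∨ c = d) {x y : V}
    (hxy : x ≠ y) (hx : ∀ a b, R.Adj x a → R.Adj x b → a = b)
    (hy : ∀ a b, R.Adj y a → R.Adj y b → a = b) (hr : R.Reachable x y) {z : V}
    (hz : R.Reachable x z) (hzx : z ≠ x) (hzy : z ≠ y) :
    ∃ a b, a ≠ b ∧ R.Adj z a ∧ R.Adj z b := by
  classical
  obtain ⟨p, hp⟩ := hr.exists_isPath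
  have hpos : 0 < p.length := by
    rcases Nat.eq_zero_or_pos p.length with h | h
    · exact (hxy (SimpleGraph.Walk.eq_of_length_eq_zero h)).elim
    · exact h
  have hinj : ∀ i ≤ p.length, ∀ j ≤ p.length, p.getVert i = p.getVert j → i = j :=
    fun i hi j hj h => hp.getVert_injOn hi hj h
  -- The path is closed under adjacency, its ends having degree one and its inner vertices degree
  -- two; so it fills the component.
  have hcl : ∀ i ≤ p.length, ∀ w, R.Adj (p.getVert i) w → ∃ j ≤ p.length, p.getVert j = w := by
    intro i hi w hw
    rcases Nat.eq_zero_or_pos i with rfl | h0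
    · have h1 := p.adj_getVert_succ hpos
      refine ⟨1, hpos, ?_⟩
      rw [SimpleGraph.Walk.getVert_zero] at hw h1
      exact hx _ _ h1 hw
    rcases hi.eq_or_lt with rfl | hlt
    · have h1 := p.adj_getVert_succ (i := p.length - 1) (by omega)
      rw [Nat.sub_add_cancel hpos, SimpleGraph.Walk.getVert_length] at h1
      rw [SimpleGraph.Walk.getVert_length] at hw
      exact ⟨p.length - 1, by omega, hy _ _ h1.symm hw⟩
    · have h1 := p.adj_getVert_succ (i := i - 1) (by omega)
      rw [Nat.sub_add_cancel h0] at h1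
      have h2 := p.adj_getVert_succ hlt
      rcases hmax _ _ _ _ h1.symm h2 hw with h | h | h
      · have := hinj _ (by omega) _ (by omega) h; omega
      · exact ⟨i - 1, by omega, h⟩
      · exact ⟨i + 1, by omega, h⟩
  have hall : ∀ w, R.Reachable x w → ∃ j ≤ p.length, p.getVert j = w := by
    rintro w ⟨q⟩
    have : ∀ a b, R.Walk a b → (∃ j ≤ p.length, p.getVert j = a) →
        ∃ j ≤ p.length, p.getVert j = b := by
      intro a b q
      induction q with
      | nil => exact id
      | cons hab _ ih =>
        rintro ⟨j, hj, rfl⟩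
        exact ih (hcl j hj _ hab)
    exact this _ _ q ⟨0, by omega, by simp⟩
  obtain ⟨i, hi, rfl⟩ := hall z hz
  have h0 : i ≠ 0 := by
    rintro rfl; exact hzx (by simp)
  have h1 : i ≠ p.length := by
    rintro rfl; exact hzy (by simp)
  have h2 := p.adj_getVert_succ (i := i - 1) (by omega)
  rw [Nat.sub_add_cancel (by omega)] at h2
  refine ⟨p.getVert (i - 1), p.getVert (i + 1), fun h => ?_, h2.symm,
    p.adj_getVert_succ (by omega)⟩
  have := hinj _ (by omega) _ (by omega) h
  omega

/-- A pair of disjoint acyclic colour classes in `G` extending `D`, on the same vertices, such that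
no vertex sees two edges of one colour and none of the other one. -/
structure IsExtension {V : Type*} (G : SimpleGraph V) (D C : Bool → SimpleGraph V) : Prop where
  le_ext : ∀ c, D c ≤ C c
  le_graph : ∀ c, C c ≤ G
  not_both : ∀ c a b, C c |>.Adj a b → ¬ (C (!c)).Adj a b
  acyclic : ∀ c, (C c).IsAcyclic
  both : ∀ c v a b, a ≠ b → (C c).Adj v a → (C c).Adj v b → ∃ d, (C (!c)).Adj v d
  supp : ∀ c a b, (C c).Adj a b → ∃ c' d, (D c').Adj a d

section extension

variable {V : Type*} {G : SimpleGraph V} {D C : Bool → SimpleGraph V}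

/-- Two edges of one colour force an edge of the other; with a third edge of the first colour there
would be four. -/
theorem IsExtension.max_two (hdeg : ∀ v, (G.neighborSet v).encard ≤ 3) (h : IsExtension G D C)
    (c : Bool) (v x y z : V) (hx : (C c).Adj v x) (hy : (C c).Adj v y) (hz : (C c).Adj v z) :
    x = y ∨ x = z ∨ y = z := by
  by_contra hcon
  push Not at hcon
  obtain ⟨d, hd⟩ := h.both c v x y hcon.1 hx hy
  have key : ∀ e, (C c).Adj v e → e ≠ d := by
    rintro e he rfl
    exact h.not_both c _ _ he hd
  have := RedBlueGraph.eq_of_encard_neighborSet_le (hdeg v) (h.le_graph _ hx) (h.le_graph _ hy)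
    (h.le_graph _ hz) (h.le_graph _ hd) hcon.1 hcon.2.1 hcon.2.2
  have := key x hx
  have := key y hy
  have := key z hz
  grind

/-- Colour the edge `xy` with `c`. -/
def colourEdge (C : Bool → SimpleGraph V) (c : Bool) (x y : V) : Bool → SimpleGraph V :=
  fun c' => if c' = c then C c ⊔ SimpleGraph.edge x y else C c'

theorem colourEdge_adj {C : Bool → SimpleGraph V} {c : Bool} {x y : V} (hxy : x ≠ y) (c' : Bool)
    (a b : V) : (colourEdge C c x y c').Adj a b ↔
      (C c').Adj a b ∨ (c' = c ∧ ((a = x ∧ b = y) ∨ (a = y ∧ b = x))) := by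
  unfold colourEdge
  split_ifs with h
  · subst h
    rw [SimpleGraph.sup_adj, SimpleGraph.edge_adj]
    constructor
    · rintro (h | h)
      · exact Or.inl h
      · exact Or.inr ⟨rfl, by tauto⟩
    · rintro (h | ⟨-, ⟨rfl, rfl⟩ | ⟨rfl, rfl⟩⟩)
      · exact Or.inl h
      · exact Or.inr ⟨by tauto, hxy⟩
      · exact Or.inr ⟨by tauto, hxy.symm⟩
  · simp [h]

/-- Both ends already see the other colour, so `both` is kept, and the new edge joins two components
of its colour, so no cycle arises. -/
theorem IsExtension.colour (h : IsExtension G D C) {c : Bool} {x y : V} (hG : G.Adj x y)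
    (hunc : ∀ c, ¬ (C c).Adj x y) (hr : ¬ (C c).Reachable x y)
    (hx : (∃ a, (C (!c)).Adj x a)) (hy : (∃ a, (C (!c)).Adj y a)) :
    IsExtension G D (colourEdge C c x y) := by
  have hadj := fun c' a b => colourEdge_adj (C := C) (c := c) hG.ne c' a b
  refine ⟨fun c' a b hab => (hadj _ _ _).2 (Or.inl (h.le_ext c' hab)), ?_, ?_, ?_, ?_, ?_⟩
  · intro c' a b hab
    rcases (hadj _ _ _).1 hab with h1 | ⟨-, ⟨rfl, rfl⟩ | ⟨rfl, rfl⟩⟩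
    · exact h.le_graph c' h1
    · exact hG
    · exact hG.symm
  · intro c' a b h1 h2
    rw [hadj] at h1 h2
    have := h.not_both c' a b
    have h3 := hunc
    have h4 : ∀ c, ¬ (C c).Adj y x := fun c h' => hunc c h'.symm
    rcases h1 with h1 | ⟨rfl, ⟨rfl, rfl⟩ | ⟨rfl, rfl⟩⟩
    · rcases h2 with h2 | ⟨-, ⟨rfl, rfl⟩ | ⟨rfl, rfl⟩⟩
      · exact this h1 h2
      · exact h3 _ h1
      · exact h4 _ h1
    · simp at h2
      exact h3 _ h2
    · simp at h2
      exact h4 _ h2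
  · intro c'
    unfold colourEdge
    split_ifs with hc
    · exact (h.acyclic c).sup_edge_of_not_reachable hr
    · exact h.acyclic c'
  · intro c' v a b hab ha hb
    have hgoal : ∀ v, (∃ d, (C (!c')).Adj v d) → ∃ d, (colourEdge C c x y (!c')).Adj v d :=
      fun v ⟨d, hd⟩ => ⟨d, (hadj _ _ _).2 (Or.inl hd)⟩
    rw [hadj] at ha hb
    rcases ha with ha | ⟨rfl, ⟨rfl, rfl⟩ | ⟨rfl, rfl⟩⟩
    · rcases hb with hb | ⟨rfl, ⟨rfl, rfl⟩ | ⟨rfl, rfl⟩⟩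
      · exact hgoal _ (h.both _ _ _ _ hab ha hb)
      · exact hgoal _ hx
      · exact hgoal _ hy
    · exact hgoal _ hx
    · exact hgoal _ hy
  · intro c' a b hab
    rcases (hadj _ _ _).1 hab with h1 | ⟨-, ⟨rfl, rfl⟩ | ⟨rfl, rfl⟩⟩
    · exact h.supp _ _ _ h1
    · obtain ⟨d, hd⟩ := hx; exact h.supp _ _ _ hd
    · obtain ⟨d, hd⟩ := hy; exact h.supp _ _ _ hd

/-- Give the edge `xh` of colour `c` the other colour and the edge `xy` the colour `c`. -/
def shiftEdge (C : Bool → SimpleGraph V) (c : Bool) (x h y : V) : Bool → SimpleGraph V :=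
  fun c' => if c' = c then (C c).exchange x h x y else C c' ⊔ SimpleGraph.edge x h

theorem shiftEdge_adj {C : Bool → SimpleGraph V} {c : Bool} {x h y : V} (hxy : x ≠ y) (hxh : x ≠ h)
    (c' : Bool) (a b : V) : (shiftEdge C c x h y c').Adj a b ↔
      (c' = c ∧ (((C c).Adj a b ∧ ¬ (a = x ∧ b = h) ∧ ¬ (a = h ∧ b = x)) ∨
        (a = x ∧ b = y) ∨ (a = y ∧ b = x))) ∨
      (c' = !c ∧ ((C (!c)).Adj a b ∨ (a = x ∧ b = h) ∨ (a = h ∧ b = x))) := by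
  unfold shiftEdge
  split_ifs with hc
  · subst hc
    rw [SimpleGraph.exchange_adj _ hxy]
    simp
  · have : c' = !c := by
      revert hc; cases c <;> cases c' <;> simp
    subst this
    rw [SimpleGraph.sup_adj, SimpleGraph.edge_adj]
    simp
    constructor
    · tauto
    · rintro (h | ⟨rfl, rfl⟩ | ⟨rfl, rfl⟩)
      · exact Or.inl h
      · exact Or.inr ⟨by tauto, hxh⟩
      · exact Or.inr ⟨by tauto, hxh.symm⟩

/-- The edge xy replaces xz as the only edge of colour c at x and so lies on no cycle of that
colour, while xz joins two components of the other colour. Afterwards x sees c through xy, and z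
sees it through its other edge of colour c. -/
theorem IsExtension.shift (h : IsExtension G D C) {c : Bool} {x y z : V} (hG : G.Adj x y)
    (hunc : ∀ c, ¬ (C c).Adj x y) (hxz : (C c).Adj x z) (hD : ¬ (D c).Adj x z)
    (hx1 : ∀ a, (C c).Adj x a → a = z)
    (hr : ¬ (C (!c)).Reachable x z)
    (hx : (∃ a, (C (!c)).Adj x a)) (hy : (∃ a, (C (!c)).Adj y a))
    (hz : ∃ a, a ≠ x ∧ (C c).Adj z a) :
    IsExtension G D (shiftEdge C c x z y) := by
  have hzy : z ≠ y := by
    rintro rfl; exact hunc _ hxz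
  have hadj := fun c' a b => shiftEdge_adj (C := C) (c := c) hG.ne hxz.ne c' a b
  have hnot : ∀ c' : Bool, c' = c ∨ c' = !c := by
    intro c'; cases c <;> cases c' <;> simp
  have hcc : c ≠ !c := by cases c <;> simp
  have hA : ∀ a b, (shiftEdge C c x z y c).Adj a b ↔
      (((C c).Adj a b ∧ ¬ (a = x ∧ b = z) ∧ ¬ (a = z ∧ b = x)) ∨
        (a = x ∧ b = y) ∨ (a = y ∧ b = x)) := by
    intro a b; rw [hadj]; simp
  have hB : ∀ a b, (shiftEdge C c x z y (!c)).Adj a b ↔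
      ((C (!c)).Adj a b ∨ (a = x ∧ b = z) ∨ (a = z ∧ b = x)) := by
    intro a b; rw [hadj]; simp
  have hnb : ∀ a b, (C c).Adj a b → ¬ (C (!c)).Adj a b := h.not_both c
  refine ⟨?_, ?_, ?_, ?_, ?_, ?_⟩
  · intro c' a b hab
    have h1 := h.le_ext c' hab
    rcases hnot c' with rfl | rfl
    · rw [hA]
      refine Or.inl ⟨h1, ?_, ?_⟩
      · rintro ⟨rfl, rfl⟩; exact hD hab
      · rintro ⟨rfl, rfl⟩; exact hD hab.symm
    · rw [hB]; exact Or.inl h1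
  · intro c' a b hab
    rcases hnot c' with rfl | rfl
    · rw [hA] at hab
      rcases hab with ⟨h1, -⟩ | ⟨rfl, rfl⟩ | ⟨rfl, rfl⟩
      · exact h.le_graph _ h1
      · exact hG
      · exact hG.symm
    · rw [hB] at hab
      rcases hab with h1 | ⟨rfl, rfl⟩ | ⟨rfl, rfl⟩
      · exact h.le_graph _ h1
      · exact h.le_graph _ hxz
      · exact h.le_graph _ hxz.symm
  · have key : ∀ a b, (shiftEdge C c x z y c).Adj a b → ¬ (shiftEdge C c x z y (!c)).Adj a b := by
      intro a b
      rw [hA, hB]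
      have h1 := hunc (!c)
      have h2 := hnb a b
      have h3 : ¬ (C (!c)).Adj y x := fun h' => h1 h'.symm
      have h4 := hG.ne
      rintro (⟨h5, h6, h7⟩ | ⟨rfl, rfl⟩ | ⟨rfl, rfl⟩)
      · tauto
      · rintro (h5 | ⟨-, h5⟩ | ⟨h5, -⟩)
        · exact h1 h5
        · exact hzy h5.symm
        · exact hxz.ne h5
      · rintro (h5 | ⟨h5, -⟩ | ⟨h5, -⟩)
        · exact h3 h5
        · exact h4 h5.symm
        · exact hzy h5.symm
    intro c' a b h1 h2
    rcases hnot c' with rfl | rfl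
    · exact key _ _ h1 h2
    · rw [Bool.not_not] at h2
      exact key _ _ h2 h1
  · intro c'
    rcases hnot c' with rfl | rfl
    · unfold shiftEdge
      rw [if_pos rfl]
      unfold SimpleGraph.exchange
      refine ((h.acyclic c').anti sdiff_le).sup_edge_of_not_reachable ?_
      rintro ⟨p⟩
      cases p with
      | nil => exact hG.ne rfl
      | cons hxa _ =>
        rw [SimpleGraph.sdiff_adj, SimpleGraph.edge_adj] at hxa
        have := hx1 _ hxa.1
        exact hxa.2 ⟨Or.inl ⟨rfl, this⟩, hxa.1.ne⟩
    · unfold shiftEdge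
      rw [if_neg (by simp)]
      exact (h.acyclic _).sup_edge_of_not_reachable hr
  · have hBmono : ∀ v, (∃ d, (C (!c)).Adj v d) → ∃ d, (shiftEdge C c x z y (!c)).Adj v d :=
      fun v ⟨d, hd⟩ => ⟨d, (hB _ _).2 (Or.inl hd)⟩
    intro c' v a b hab ha hb
    rcases hnot c' with rfl | rfl
    · by_cases hvx : v = x
      · subst hvx; exact hBmono _ hx
      by_cases hvy : v = y
      · subst hvy; exact hBmono _ hy
      rw [hA] at ha hb
      refine hBmono _ (h.both c' v a b hab ?_ ?_) <;> tauto
    · rw [Bool.not_not]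
      by_cases hvx : v = x
      · subst hvx; exact ⟨y, (hA _ _).2 (Or.inr (Or.inl ⟨rfl, rfl⟩))⟩
      by_cases hvz : v = z
      · subst hvz
        obtain ⟨d, hd, hd'⟩ := hz
        exact ⟨d, (hA _ _).2 (Or.inl ⟨hd', by tauto, by tauto⟩)⟩
      rw [hB] at ha hb
      obtain ⟨d, hd⟩ := h.both (!c) v a b hab (by tauto) (by tauto)
      rw [Bool.not_not] at hd
      exact ⟨d, (hA _ _).2 (Or.inl ⟨hd, by tauto, by tauto⟩)⟩
  · intro c' a b hab
    rcases (hadj _ _ _).1 hab with ⟨-, h1 | ⟨rfl, rfl⟩ | ⟨rfl, rfl⟩⟩ |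
      ⟨-, h1 | ⟨rfl, rfl⟩ | ⟨rfl, rfl⟩⟩
    · exact h.supp _ _ _ h1.1
    · exact h.supp _ _ _ hxz
    · obtain ⟨d, hd⟩ := hy; exact h.supp _ _ _ hd
    · exact h.supp _ _ _ h1
    · exact h.supp _ _ _ hxz
    · exact h.supp _ _ _ hxz.symm

end extension

section extension

variable {V : Type*} {G : SimpleGraph V} {D C : Bool → SimpleGraph V}

theorem shiftEdge_sup_adj {c : Bool} {x y z : V} (hxy : x ≠ y) (hz : (C c).Adj x z) (a b : V) :
    (shiftEdge C c x z y true ⊔ shiftEdge C c x z y false).Adj a b ↔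
      (C true ⊔ C false).Adj a b ∨ (a = x ∧ b = y) ∨ (a = y ∧ b = x) := by
  have h2 : (a = x ∧ b = z) → (C c).Adj a b := by rintro ⟨rfl, rfl⟩; exact hz
  have h3 : (a = z ∧ b = x) → (C c).Adj a b := by rintro ⟨rfl, rfl⟩; exact hz.symm
  rw [SimpleGraph.sup_adj, SimpleGraph.sup_adj, shiftEdge_adj hxy hz.ne, shiftEdge_adj hxy hz.ne]
  clear hz
  generalize (a = x ∧ b = z) = p at *
  generalize (a = z ∧ b = x) = q at *
  generalize (a = x ∧ b = y) = r at *
  generalize (a = y ∧ b = x) = s at *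
  cases c
  · simp only [reduceCtorEq, Bool.not_false, false_and, true_and, false_or, or_false,
      Bool.not_true] at *
    generalize (C true).Adj a b = t at *
    generalize (C false).Adj a b = u at *
    tauto
  · simp only [reduceCtorEq, Bool.not_false, false_and, true_and, false_or, or_false,
      Bool.not_true] at *
    generalize (C true).Adj a b = t at *
    generalize (C false).Adj a b = u at *
    tauto

/-- A maximal extension contains every edge of colour `c` at an end of an uncoloured edge whose
ends are connected in both colours. -/
theorem IsExtension.old_edge_of_maximal [Finite V] (hdeg : ∀ v, (G.neighborSet v).encard ≤ 3)
    (h : IsExtension G D C)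
    (hmaxi : ∀ C', IsExtension G D C' →
      (C' true ⊔ C' false).edgeSet.ncard ≤ (C true ⊔ C false).edgeSet.ncard)
    {x y : V} (hG : G.Adj x y) (hunc : ∀ c, ¬ (C c).Adj x y)
    (hreach : ∀ c, (C c).Reachable x y)
    (hx1 : ∀ c a b, (C c).Adj x a → (C c).Adj x b → a = b)
    (hy1 : ∀ c a b, (C c).Adj y a → (C c).Adj y b → a = b)
    (hx : ∀ c, ∃ a, (C c).Adj x a) (hy : ∀ c, ∃ a, (C c).Adj y a) (c : Bool) :
    ∃ a, (D c).Adj x a := by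
  obtain ⟨z, hz⟩ := hx c
  by_contra hD
  push Not at hD
  have hzx : z ≠ x := hz.ne.symm
  have hzy : z ≠ y := by rintro rfl; exact hunc _ hz
  -- The component of x in colour c is a path from x to y, and z is an inner vertex of it.
  obtain ⟨a, b, hab, ha, hb⟩ := exists_two_nbrs_of_between (h.max_two hdeg c) hG.ne (hx1 c) (hy1 c)
    (hreach c) hz.reachable hzx hzy
  have hext : IsExtension G D (shiftEdge C c x z y) := by
    refine h.shift hG hunc hz (hD z) (fun a ha => hx1 c _ _ ha hz) ?_ (hx _) (hy _) ?_
    -- If z were connected to x in the other colour as well, it would be an inner vertex of two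
    -- paths and have four edges.
    · intro hr
      obtain ⟨a', b', hab', ha', hb'⟩ := exists_two_nbrs_of_between (h.max_two hdeg (!c)) hG.ne
        (hx1 _) (hy1 _) (hreach _) hr hzx hzy
      have h1 := h.not_both c z a ha
      have h2 := h.not_both c z b hb
      rcases RedBlueGraph.eq_of_encard_neighborSet_le (hdeg z) (h.le_graph _ ha) (h.le_graph _ hb)
        (h.le_graph _ ha') (h.le_graph _ hb') hab (by rintro rfl; exact h1 ha')
        (by rintro rfl; exact h2 ha') with rfl | rfl | rfl
      · exact h1 hb'
      · exact h2 hb'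
      · exact hab' rfl
    · by_cases hax : a = x
      · exact ⟨b, fun hbx => hab (hax.trans hbx.symm), hb⟩
      · exact ⟨a, hax, ha⟩
  have h1 := hmaxi _ hext
  have hmem := shiftEdge_sup_adj (C := C) (c := c) hG.ne hz
  have hsub : insert s(x, y) (C true ⊔ C false).edgeSet ⊆
      (shiftEdge C c x z y true ⊔ shiftEdge C c x z y false).edgeSet := by
    intro e he
    induction e using Sym2.ind with
    | h a b =>
      rw [SimpleGraph.mem_edgeSet, hmem]
      rcases he with he | he
      · rw [Sym2.eq_iff] at he
        exact Or.inr he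
      · exact Or.inl he
  have h2 := Set.ncard_le_ncard hsub
  rw [Set.ncard_insert_of_notMem (by
    rw [SimpleGraph.mem_edgeSet, SimpleGraph.sup_adj]
    exact fun h' => h'.elim (hunc _) (hunc _))] at h2
  omega

theorem IsExtension.reachable_of_maximal [Finite V]
    (h : IsExtension G D C)
    (hmaxi : ∀ C', IsExtension G D C' →
      (C' true ⊔ C' false).edgeSet.ncard ≤ (C true ⊔ C false).edgeSet.ncard)
    {x y : V} (hG : G.Adj x y) (hunc : ∀ c, ¬ (C c).Adj x y) (c : Bool)
    (hx : ∃ a, (C (!c)).Adj x a) (hy : ∃ a, (C (!c)).Adj y a) :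
    (C c).Reachable x y := by
  by_contra hr
  have h1 := hmaxi _ (h.colour hG hunc hr hx hy)
  have hadj := fun c' a b => colourEdge_adj (C := C) (c := c) hG.ne c' a b
  have hsub : insert s(x, y) (C true ⊔ C false).edgeSet ⊆
      (colourEdge C c x y true ⊔ colourEdge C c x y false).edgeSet := by
    intro e he
    induction e using Sym2.ind with
    | h a b =>
      rw [SimpleGraph.mem_edgeSet, SimpleGraph.sup_adj, hadj, hadj]
      rcases he with he | he
      · rw [Sym2.eq_iff] at he
        cases c <;> simp <;> tauto
      · have he : (C true ⊔ C false).Adj a b := he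
        rw [SimpleGraph.sup_adj] at he
        tauto
  have h2 := Set.ncard_le_ncard hsub
  rw [Set.ncard_insert_of_notMem (by
    rw [SimpleGraph.mem_edgeSet, SimpleGraph.sup_adj]
    exact fun h' => h'.elim (hunc _) (hunc _))] at h2
  omega

/-- Take an extension with the most edges and a cycle on which only the colour c occurs, without two
consecutive uncoloured edges. As c is acyclic, the cycle has an uncoloured edge xy, whose neighbours
on it have colour c. Maximality connects x and y first in the other colour, because both ends see c,
and then also in c. By `old_edge_of_maximal` both ends see both colours already in `D`, so `hanchor`
applies. The vertex it provides lies on a path of one colour from x to y and would be an inner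
vertex there, but it has only one edge of that colour. -/
theorem exists_complete_extension [Finite V] (hdeg : ∀ v, (G.neighborSet v).encard ≤ 3)
    (h0 : IsExtension G D D)
    (hanchor : ∀ x y, G.Adj x y → (∀ c, ¬ (D c).Adj x y) → (∀ c, ∃ a, (D c).Adj x a) →
      (∀ c, ∃ a, (D c).Adj y a) → ∃ c z, ((D c).Reachable x z ∨ (D c).Reachable y z) ∧
        (∀ a, G.Adj z a → ∃ c', (D c').Adj z a) ∧ ∀ a b, (D c).Adj z a → (D c).Adj z b → a = b) :
    ∃ C, IsExtension G D C ∧ ∀ (v : V) (W : G.Walk v v), W.IsCycle →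
      ∀ c, (∀ a b, s(a, b) ∈ W.edges → ¬ (C (!c)).Adj a b) →
      ∃ x y z : V, x ≠ z ∧ s(x, y) ∈ W.edges ∧ s(y, z) ∈ W.edges ∧
        (∀ c, ¬ (C c).Adj x y) ∧ (∀ c, ¬ (C c).Adj y z) := by
  obtain ⟨C, h, hmaxi⟩ := Set.exists_max_image {C | IsExtension G D C}
    (fun C => (C true ⊔ C false).edgeSet.ncard) (Set.toFinite _) ⟨D, h0⟩
  have h : IsExtension G D C := h
  have hmaxi : ∀ C', IsExtension G D C' →
      (C' true ⊔ C' false).edgeSet.ncard ≤ (C true ⊔ C false).edgeSet.ncard := hmaxi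
  refine ⟨C, h, fun v W hW c hc => ?_⟩
  by_contra hgap
  push Not at hgap
  have hcol : ∀ c' : Bool, c' = c ∨ c' = !c := by
    intro c'; cases c <;> cases c' <;> simp
  by_cases hall : ∀ a b, s(a, b) ∈ W.edges → (C c).Adj a b
  · have hall' : ∀ e ∈ W.edges, e ∈ (C c).edgeSet := by
      intro e he
      induction e using Sym2.ind with
      | h a b => exact hall a b he
    exact h.acyclic c _ (hW.transfer hall')
  push Not at hall
  obtain ⟨x, y, hxyW, hxyc⟩ := hall
  have hG : G.Adj x y := W.adj_of_mem_edges hxyW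
  have hunc : ∀ c', ¬ (C c').Adj x y := by
    intro c'
    rcases hcol c' with rfl | rfl
    · exact hxyc
    · exact hc _ _ hxyW
  have hend : ∀ x y, s(x, y) ∈ W.edges → (∀ c', ¬ (C c').Adj x y) → ∃ a, (C c).Adj x a := by
    intro x y hxy hun
    obtain ⟨x', hx', hxx'⟩ := hW.exists_other_edge hxy
    obtain ⟨c', hc'⟩ := hgap y x x' hx'.symm (Sym2.eq_swap ▸ hxy) hxx' (fun c' h' => hun c' h'.symm)
    rcases hcol c' with rfl | rfl
    · exact ⟨x', hc'⟩
    · exact (hc _ _ hxx' hc').elim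
  have hxa := hend x y hxyW hunc
  have hya := hend y x (Sym2.eq_swap ▸ hxyW) (fun c' h' => hunc c' h'.symm)
  have hr1 : (C (!c)).Reachable x y :=
    h.reachable_of_maximal hmaxi hG hunc (!c) (by rwa [Bool.not_not]) (by rwa [Bool.not_not])
  have hfirst : ∀ x y, x ≠ y → (C (!c)).Reachable x y → ∃ a, (C (!c)).Adj x a := by
    rintro x y hxy ⟨p⟩
    cases p with
    | nil => exact (hxy rfl).elim
    | cons hxa _ => exact ⟨_, hxa⟩
  have hxb := hfirst x y hG.ne hr1
  have hyb := hfirst y x hG.ne.symm hr1.symm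
  have hr2 : (C c).Reachable x y := h.reachable_of_maximal hmaxi hG hunc c hxb hyb
  have hx : ∀ c', ∃ a, (C c').Adj x a := by
    intro c'; rcases hcol c' with rfl | rfl <;> assumption
  have hy : ∀ c', ∃ a, (C c').Adj y a := by
    intro c'; rcases hcol c' with rfl | rfl <;> assumption
  have hreach : ∀ c', (C c').Reachable x y := by
    intro c'; rcases hcol c' with rfl | rfl <;> assumption
  have hone : ∀ x y, G.Adj x y → (∀ c', ¬ (C c').Adj x y) → (∀ c', ∃ a, (C c').Adj x a) →
      ∀ c' a b, (C c').Adj x a → (C c').Adj x b → a = b := by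
    intro x y hG hunc hx c' a b ha hb
    by_contra hab
    obtain ⟨d, hd⟩ := hx (!c')
    have h1 := h.not_both c' x a ha
    have h2 := h.not_both c' x b hb
    rcases RedBlueGraph.eq_of_encard_neighborSet_le (hdeg x) (h.le_graph _ ha) (h.le_graph _ hb)
      (h.le_graph _ hd) hG hab (by rintro rfl; exact h1 hd) (by rintro rfl; exact h2 hd)
      with rfl | rfl | rfl
    · exact hunc _ ha
    · exact hunc _ hb
    · exact hunc _ hd
  have hx1 := hone x y hG hunc hx
  have hunc' : ∀ c', ¬ (C c').Adj y x := fun c' h' => hunc c' h'.symm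
  have hy1 := hone y x hG.symm hunc' hy
  have hxD := h.old_edge_of_maximal hdeg hmaxi hG hunc hreach hx1 hy1 hx hy
  have hyD := h.old_edge_of_maximal hdeg hmaxi hG.symm hunc' (fun c' => (hreach c').symm)
    hy1 hx1 hy hx
  obtain ⟨c', z, hz, hfull, huniq⟩ := hanchor x y hG (fun c' h' => hunc c' (h.le_ext c' h')) hxD hyD
  -- All edges at an anchor are coloured, but xy is not.
  have hzx : z ≠ x := by
    rintro rfl
    obtain ⟨d, hd⟩ := hfull y hG
    exact hunc d (h.le_ext _ hd)
  have hzy : z ≠ y := by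
    rintro rfl
    obtain ⟨d, hd⟩ := hfull x hG.symm
    exact hunc d (h.le_ext _ hd).symm
  have hz' : (C c').Reachable x z := by
    rcases hz with hz | hz
    · exact hz.mono (h.le_ext c')
    · exact (hreach c').trans (hz.mono (h.le_ext c'))
  obtain ⟨a, b, hab, ha, hb⟩ := exists_two_nbrs_of_between (h.max_two hdeg c') hG.ne (hx1 c')
    (hy1 c') (hreach c') hz' hzx hzy
  -- Since `D` colours all edges at z, the extension adds none there.
  have hold : ∀ a, (C c').Adj z a → (D c').Adj z a := by
    intro a ha
    obtain ⟨d, hd⟩ := hfull a (h.le_graph _ ha)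
    by_cases hdc : d = c'
    · rwa [hdc] at hd
    · have : d = !c' := by revert hdc; cases d <;> cases c' <;> simp
      subst this
      exact (h.not_both c' z a ha (h.le_ext _ hd)).elim
  exact hab (huniq a b (hold a ha) (hold b hb))

end extension

namespace RedBlueGraph

/-- The extension only adds edges between vertices that already carry coloured edges, so the
coloured graph stays connected. Then a cycle without a red and a blue edge from the same component
misses one colour altogether, which is the situation of `exists_complete_extension`. -/
theorem exists_completion {V : Type*} [Finite V] {G : SimpleGraph V}
    (hdeg : ∀ v, (G.neighborSet v).encard ≤ 3) (φ : RedBlueGraph V) (hφ : φ.graph ≤ G)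
    (hred : φ.red.IsAcyclic) (hblue : φ.blue.IsAcyclic)
    (hboth : ∀ v a b, a ≠ b → φ.graph.Adj v a → φ.graph.Adj v b →
      (∃ w, φ.red.Adj v w) ∧ (∃ w, φ.blue.Adj v w))
    (hconn : ∀ x ∈ φ.graph.support, ∀ y ∈ φ.graph.support, φ.graph.Reachable x y)
    (hanchor : ∀ x y, G.Adj x y → ¬ φ.graph.Adj x y → (∃ a, φ.red.Adj x a) →
      (∃ a, φ.blue.Adj x a) → (∃ a, φ.red.Adj y a) → (∃ a, φ.blue.Adj y a) →
      (∃ z, (φ.red.Reachable x z ∨ φ.red.Reachable y z) ∧ (∀ a, G.Adj z a → φ.graph.Adj z a) ∧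
        ∀ a b, φ.red.Adj z a → φ.red.Adj z b → a = b) ∨
      (∃ z, (φ.blue.Reachable x z ∨ φ.blue.Reachable y z) ∧ (∀ a, G.Adj z a → φ.graph.Adj z a) ∧
        ∀ a b, φ.blue.Adj z a → φ.blue.Adj z b → a = b)) :
    ∃ ψ : RedBlueGraph V, φ.red ≤ ψ.red ∧ φ.blue ≤ ψ.blue ∧ ψ.graph ≤ G ∧
      ψ.graph.support ⊆ φ.graph.support ∧
      (∀ x ∈ ψ.graph.support, ∀ y ∈ ψ.graph.support, ψ.graph.Reachable x y) ∧
      ψ.SeesBothColours ∧ ψ.CyclesHaveGap G := by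
  set D : Bool → SimpleGraph V := fun c => if c then φ.red else φ.blue with hD
  have hDt : D true = φ.red := rfl
  have hDf : D false = φ.blue := rfl
  have hφadj : ∀ a b, φ.graph.Adj a b ↔ ∃ c, (D c).Adj a b := by
    intro a b
    rw [Bool.exists_bool, hDt, hDf, or_comm]
    rfl
  have h0 : IsExtension G D D := by
    refine ⟨fun c => le_rfl, ?_, ?_, ?_, ?_, fun c a b h => ⟨c, b, h⟩⟩
    · intro c a b h; exact hφ ((hφadj _ _).2 ⟨c, h⟩)
    · intro c a b h1 h2
      have := SimpleGraph.disjoint_left.1 φ.disj a b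
      cases c
      · exact this h2 h1
      · exact this h1 h2
    · intro c; cases c <;> assumption
    · intro c v a b hab ha hb
      have := hboth v a b hab ((hφadj _ _).2 ⟨c, ha⟩) ((hφadj _ _).2 ⟨c, hb⟩)
      cases c
      · exact this.1
      · exact this.2
  obtain ⟨C, h, hC⟩ := exists_complete_extension hdeg h0 (by
    intro x y hG hunc hx hy
    rcases hanchor x y hG (fun h' => by
      obtain ⟨c, hc⟩ := (hφadj _ _).1 h'
      exact hunc c hc) (hx true) (hx false) (hy true) (hy false) with ⟨z, h1, h2, h3⟩ | ⟨z, h1, h2, h3⟩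
    · exact ⟨true, z, h1, fun a ha => (hφadj _ _).1 (h2 a ha), h3⟩
    · exact ⟨false, z, h1, fun a ha => (hφadj _ _).1 (h2 a ha), h3⟩)
  have hdisj : Disjoint (C true) (C false) := by
    rw [SimpleGraph.disjoint_left]
    exact h.not_both true
  have hle : φ.graph ≤ C true ⊔ C false := sup_le_sup (h.le_ext true) (h.le_ext false)
  have hsupp : (C true ⊔ C false).support ⊆ φ.graph.support := by
    rintro a ⟨b, hab | hab⟩
    · obtain ⟨c', d, hd⟩ := h.supp _ _ _ hab
      exact ⟨d, (hφadj _ _).2 ⟨c', hd⟩⟩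
    · obtain ⟨c', d, hd⟩ := h.supp _ _ _ hab
      exact ⟨d, (hφadj _ _).2 ⟨c', hd⟩⟩
  have hconn' : ∀ x ∈ (C true ⊔ C false).support, ∀ y ∈ (C true ⊔ C false).support,
      (C true ⊔ C false).Reachable x y :=
    fun x hx y hy => (hconn x (hsupp hx) y (hsupp hy)).mono hle
  refine ⟨⟨C true, C false, hdisj⟩, h.le_ext true, h.le_ext false,
    sup_le (h.le_graph _) (h.le_graph _), hsupp, hconn', ?_, ?_⟩
  · intro v hv
    obtain ⟨a, b, ha, hb, hab⟩ : ∃ a b, (C true ⊔ C false).Adj v a ∧ (C true ⊔ C false).Adj v b ∧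
        a ≠ b := by
      have h1 : 1 < ((C true ⊔ C false).neighborSet v).encard := lt_of_lt_of_le (by norm_num) hv
      rw [Set.one_lt_encard_iff] at h1
      exact h1
    rcases ha with ha | ha <;> rcases hb with hb | hb
    · exact ⟨⟨a, ha⟩, h.both true v a b hab ha hb⟩
    · exact ⟨⟨a, ha⟩, ⟨b, hb⟩⟩
    · exact ⟨⟨b, hb⟩, ⟨a, ha⟩⟩
    · exact ⟨h.both false v a b hab ha hb, ⟨a, ha⟩⟩
  · intro v W hW hno
    have hex : ∃ c, ∀ a b, s(a, b) ∈ W.edges → ¬ (C (!c)).Adj a b := by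
      by_contra hcon
      push Not at hcon
      obtain ⟨a, b, hab, hab'⟩ := hcon false
      obtain ⟨c, d, hcd, hcd'⟩ := hcon true
      exact hno ⟨a, b, c, d, hab, hab', hcd, hcd',
        hconn' _ ⟨b, Or.inl hab'⟩ _ ⟨d, Or.inr hcd'⟩⟩
    obtain ⟨c, hc⟩ := hex
    obtain ⟨x, y, z, h1, h2, h3, h4, h5⟩ := hC v W hW c hc
    exact ⟨x, y, z, h1, h2, h3, fun h' => h'.elim (h4 _) (h4 _), fun h' => h'.elim (h5 _) (h5 _)⟩

end RedBlueGraph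

/-! ### Colour schemes -/

/-- The data from which a partial colouring is built: a path `q 0, …, q M` in `G`, the place `m`
of the gadget on it, additional red edges `Er`, a set `U0` of additional vertices all of whose
edges get coloured, and a set `P` of vertices from which distances are measured. -/
structure ColourScheme (V : Type*) where
  G : SimpleGraph V
  P : Set V
  q : ℕ → V
  M : ℕ
  m : ℕ
  ℓ : ℕ
  Er : V → V → Prop
  U0 : Set V

namespace ColourScheme

variable {V : Type*} (S : ColourScheme V)

/-- The vertices of the path. -/
def Z (x : V) : Prop := ∃ j ≤ S.M, S.q j = x

/-- The edges of the path. -/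
def PE (a b : V) : Prop :=
  ∃ j < S.M, (a = S.q j ∧ b = S.q (j + 1)) ∨ (a = S.q (j + 1) ∧ b = S.q j)

/-- The red edges of the path. -/
def BR (a b : V) : Prop :=
  ∃ j < S.M, (j + 1 = S.m ∨ j = S.m + 1 ∨ j = S.m + S.ℓ + 2) ∧
    ((a = S.q j ∧ b = S.q (j + 1)) ∨ (a = S.q (j + 1) ∧ b = S.q j))

/-- Vertices of the path whose edge leaving the path is blue. -/
def Flip (x : V) : Prop :=
  ((∃ j, j + 1 = S.m ∧ x = S.q j) ∧ ∃ t, ¬ S.Z t ∧ S.G.Adj t x ∧ S.G.Adj t (S.q S.m)) ∨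
  (x = S.q (S.m + S.ℓ + 3) ∧ ∃ t, ¬ S.Z t ∧ S.G.Adj t x ∧ S.G.Adj t (S.q (S.m + S.ℓ + 2)))

/-- The red edges outside of the path. -/
def Fr (a b : V) : Prop :=
  S.G.Adj a b ∧ ¬ S.PE a b ∧ (((S.Z a ∨ S.Z b) ∧ ¬ S.Flip a ∧ ¬ S.Flip b) ∨ S.Er a b)

/-- Vertices off the path with two red edges. -/
def S2 (x : V) : Prop := ¬ S.Z x ∧ ∃ a b, a ≠ b ∧ S.Fr x a ∧ S.Fr x b

/-- Vertices off the path all of whose edges get coloured. -/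
def Sat (x : V) : Prop := x ∈ S.U0 ∨ S.S2 x

/-- The second alternative breaks red triangles: if a vertex off the path is adjacent to both ends
of the first or the last red path edge, the leaving edge at the outer end is made blue. The third
alternative completes the colouring at saturated vertices. -/
def Blue (a b : V) : Prop :=
  (S.PE a b ∧ ¬ S.BR a b) ∨ (S.G.Adj a b ∧ ¬ S.PE a b ∧ (S.Flip a ∨ S.Flip b)) ∨
    (S.G.Adj a b ∧ ¬ S.Z a ∧ ¬ S.Z b ∧ ¬ S.Er a b ∧ (S.Sat a ∨ S.Sat b))

def Red (a b : V) : Prop := S.BR a b ∨ S.Fr a b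

/-- The indices of path vertices that are critical for red cycles. -/
def Crit (i : ℕ) : Prop :=
  i = 0 ∨ i + 1 = S.m ∨ i = S.m ∨ i = S.m + S.ℓ + 2 ∨ i = S.m + S.ℓ + 3 ∨ i = S.M

def Near (d : ℕ) (x : V) : Prop := ∃ w ∈ S.P, S.G.edist x w ≤ d

/-- `a` has an edge to `b` which may be red, being an edge to the path or an extra edge. -/
def Mark (a b : V) : Prop := S.G.Adj a b ∧ (S.Z b ∨ S.Er a b)

/-- Vertices off the path with two possibly red edges. -/
def Mark2 (x : V) : Prop := ¬ S.Z x ∧ ∃ a b, a ≠ b ∧ S.Mark x a ∧ S.Mark x b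

/-- The only red edge off the path at `a` is `ab`, and all other edges at `a` lead to saturated
vertices. -/
def Leaf (a b : V) : Prop :=
  (∀ c, S.Fr a c → c = b) ∧ ∀ c, S.G.Adj a c → c = b ∨ S.Sat c

/-- A combinatorial condition ensuring `Leaf`. -/
def IsTip (a b : V) : Prop :=
  (∀ c, S.Mark a c → c = b) ∧ ∀ c, S.G.Adj a c → c = b ∨ c ∈ S.U0 ∨
    (¬ S.Z c ∧ ∃ z z', z ≠ z' ∧ S.Z z ∧ S.Z z' ∧ S.G.Adj c z ∧ S.G.Adj c z' ∧ ¬ S.G.Adj z z' ∧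
      ∀ y, S.Z y → S.G.Adj c y → y = z ∨ y = z')

/-- A red path `u t w` (possibly degenerate) that closes the gadget. -/
def Loop (u t w : V) : Prop :=
  ¬ S.Z u ∧ ¬ S.Z w ∧ S.G.Adj u (S.q (S.m + 1)) ∧ S.G.Adj w (S.q (S.m + 3)) ∧
    ((u = t ∧ t = w) ∨ (u ≠ w ∧ S.Er u t ∧ S.Er t w))

/-- Two saturated vertices `u`, `w` next to the gadget. -/
structure Lane (u w : V) : Prop where
  ne : u ≠ w
  set : S.U0 = {u, w}
  not_Z_u : ¬ S.Z u
  not_Z_w : ¬ S.Z w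
  adj_u : S.G.Adj u (S.q (S.m + 1))
  adj_w : S.G.Adj w (S.q (S.m + 3))
  mark_u : ∀ c, S.Mark u c → c = S.q (S.m + 1)
  mark_w : ∀ c, S.Mark w c → c = S.q (S.m + 3)
  common : ∀ s t, ¬ S.Z s → ¬ S.Z t → S.G.Adj u s → S.G.Adj w s → S.G.Adj u t → S.G.Adj w t → s = t
  not_adj : S.G.Adj u w → ∀ t, ¬ S.Z t → S.G.Adj u t → ¬ S.G.Adj w t
  single : ∀ x z z', (S.G.Adj u x ∨ S.G.Adj w x) → ¬ S.Z x → S.Z z → S.Z z' → S.G.Adj x z →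
    S.G.Adj x z' → z = z'
  not_mark : ∀ x c, (S.G.Adj u x ∨ S.G.Adj w x) → ¬ S.Z x → S.G.Adj x c → ¬ S.Mark2 c
  no_square : ∀ x y i j, (S.G.Adj u x ∨ S.G.Adj w x) → (S.G.Adj u y ∨ S.G.Adj w y) →
    ¬ S.Z x → ¬ S.Z y → S.G.Adj x y → S.Crit i → S.Crit j → S.G.Adj x (S.q i) →
    S.G.Adj y (S.q j) → x ∈ S.U0 ∨ y ∈ S.U0

/-- The condition `max_mark` bounds the red edges at a vertex off the path by two, and `no_mark`
keeps a vertex without red edges from having two blue ones. By `gap` and `gap_chord`, critical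
vertices that are adjacent, or share a neighbour off the path, are consecutive on it, and then
`Flip` applies. The three cases of `kind_tip` are the ways to obtain mirror images in the gadget:
the edge y x₁, a red path with two or four edges, or two separate edges ending at saturated
vertices. -/
structure Valid : Prop where
  degree : ∀ v, (S.G.neighborSet v).encard = 3
  inj : ∀ i ≤ S.M, ∀ j ≤ S.M, S.q i = S.q j → i = j
  path : ∀ j < S.M, S.G.Adj (S.q j) (S.q (j + 1))
  three_le : 3 ≤ S.ℓ
  pos : 3 ≤ S.m
  room : S.m + S.ℓ + 5 ≤ S.M
  Er_symm : ∀ a b, S.Er a b → S.Er b a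
  Er_adj : ∀ a b, S.Er a b → S.G.Adj a b
  Er_off : ∀ a b, S.Er a b → ¬ S.Z a
  max_mark : ∀ x a b c, ¬ S.Z x → S.Mark x a → S.Mark x b → S.Mark x c → a = b ∨ a = c ∨ b = c
  no_mark : ∀ x a b, ¬ S.Z x → (∀ c, ¬ S.Mark x c) → (a ∈ S.U0 ∨ S.Mark2 a) →
    (b ∈ S.U0 ∨ S.Mark2 b) → S.G.Adj x a → S.G.Adj x b → a = b
  near_Z : ∀ x, S.Z x → S.Near 1 x
  near_U0 : ∀ x, x ∈ S.U0 → S.Near 3 x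
  near_mark : ∀ x, S.Mark2 x → S.Near 3 x
  near_Er : ∀ a b, S.Er a b → S.Near 4 a
  gap : ∀ i j x, S.Crit i → S.Crit j → i < j → ¬ S.Z x → S.G.Adj x (S.q i) → S.G.Adj x (S.q j) →
    j = i + 1
  gap_chord : ∀ i j, S.Crit i → S.Crit j → i < j → S.G.Adj (S.q i) (S.q j) → j = i + 1
  kind_tip : (S.U0 = ∅ ∧ (∀ a b, S.Er a b → S.IsTip a b ∨ S.IsTip b a) ∧
        S.G.Adj (S.q (S.m + 1)) (S.q (S.m + 3))) ∨
      (S.U0 = ∅ ∧ ∃ u t w, S.Loop u t w ∧ ∀ a b, S.Er a b → S.IsTip a b ∨ S.IsTip b a ∨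
        (a = u ∧ b = t) ∨ (a = t ∧ b = u) ∨ (a = t ∧ b = w) ∨ (a = w ∧ b = t)) ∨
      ((∀ a b, S.Er a b → S.IsTip a b ∨ S.IsTip b a) ∧ ∃ u w, S.Lane u w)

end ColourScheme

/-- A graph is acyclic if it has a height function for which every vertex has at most one
neighbour that is at least as high. -/
theorem SimpleGraph.isAcyclic_of_height {V : Type*} {R : SimpleGraph V} (h : V → ℕ)
    (hh : ∀ x a b, R.Adj x a → R.Adj x b → h x ≤ h a → h x ≤ h b → a = b) : R.IsAcyclic := by
  classical
  intro v C hC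
  -- A lowest vertex of a cycle has two neighbours on the cycle, both at least as high.
  obtain ⟨x, hx, hmin⟩ := Finset.exists_min_image C.support.toFinset h
    ⟨v, by simp⟩
  rw [List.mem_toFinset] at hx
  have hrot := hC.rotate hx
  have hlen := hrot.three_le_length
  have h1 : s(x, (C.rotate x hx).snd) ∈ C.edges := by
    rw [← (SimpleGraph.Walk.rotate_edges C x hx).mem_iff,
      SimpleGraph.Walk.mk_mem_edges_iff_exists]
    exact ⟨0, by omega, by simp⟩
  obtain ⟨b, hb, h2⟩ := hC.exists_other_edge h1
  have hle : ∀ a, s(x, a) ∈ C.edges → h x ≤ h a := fun a ha =>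
    hmin a (List.mem_toFinset.2 (C.snd_mem_support_of_mem_edges ha))
  exact hb (hh x b _ (C.adj_of_mem_edges h2) (C.adj_of_mem_edges h1) (hle _ h2) (hle _ h1))

/-! ### Elementary properties of valid schemes -/

namespace ColourScheme

variable {V : Type*} {S : ColourScheme V}

theorem PE_symm {a b : V} (h : S.PE a b) : S.PE b a := by
  obtain ⟨j, hj, h⟩ := h
  exact ⟨j, hj, h.symm.imp And.symm And.symm⟩

theorem BR_symm {a b : V} (h : S.BR a b) : S.BR b a := by
  obtain ⟨j, hj, h', h⟩ := h
  exact ⟨j, hj, h', h.symm.imp And.symm And.symm⟩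

theorem PE_of_BR {a b : V} (h : S.BR a b) : S.PE a b := by
  obtain ⟨j, hj, -, h⟩ := h
  exact ⟨j, hj, h⟩

theorem PE_left {a b : V} (h : S.PE a b) : S.Z a := by
  obtain ⟨j, hj, ⟨rfl, -⟩ | ⟨rfl, -⟩⟩ := h
  · exact ⟨j, hj.le, rfl⟩
  · exact ⟨j + 1, hj, rfl⟩

theorem PE_right {a b : V} (h : S.PE a b) : S.Z b := PE_left (PE_symm h)

namespace Valid

variable (h : S.Valid)
include h

theorem degree_le (v : V) : (S.G.neighborSet v).encard ≤ 3 := (h.degree v).le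

theorem Fr_symm {a b : V} (hab : S.Fr a b) : S.Fr b a := by
  obtain ⟨h1, h2, h3⟩ := hab
  refine ⟨h1.symm, fun h' => h2 (PE_symm h'), ?_⟩
  rcases h3 with ⟨h3, h4, h5⟩ | h3
  · exact Or.inl ⟨h3.symm, h5, h4⟩
  · exact Or.inr (h.Er_symm _ _ h3)

theorem Er_off' {a b : V} (hab : S.Er a b) : ¬ S.Z b := h.Er_off _ _ (h.Er_symm _ _ hab)

theorem PE_adj {a b : V} (hab : S.PE a b) : S.G.Adj a b := by
  obtain ⟨j, hj, ⟨rfl, rfl⟩ | ⟨rfl, rfl⟩⟩ := hab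
  · exact h.path j hj
  · exact (h.path j hj).symm

theorem Flip_index {x : V} (hx : S.Flip x) : ∃ j, 1 ≤ j ∧ j < S.M ∧ x = S.q j ∧
    (j + 1 = S.m ∨ j = S.m + S.ℓ + 3) := by
  have := h.pos
  have := h.room
  rcases hx with ⟨⟨j, hj, rfl⟩, -⟩ | ⟨rfl, -⟩
  · exact ⟨j, by omega, by omega, rfl, Or.inl hj⟩
  · exact ⟨_, by omega, by omega, rfl, Or.inr rfl⟩

theorem Flip_Z {x : V} (hx : S.Flip x) : S.Z x := by
  obtain ⟨j, -, hj, rfl, -⟩ := h.Flip_index hx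
  exact ⟨j, hj.le, rfl⟩

theorem PE_succ {j : ℕ} (hj : j < S.M) : S.PE (S.q j) (S.q (j + 1)) :=
  ⟨j, hj, Or.inl ⟨rfl, rfl⟩⟩

theorem PE_iff {j : ℕ} (hj : j ≤ S.M) (a : V) :
    S.PE (S.q j) a ↔ ∃ k ≤ S.M, (k = j + 1 ∨ j = k + 1) ∧ a = S.q k := by
  constructor
  · rintro ⟨k, hk, ⟨h1, rfl⟩ | ⟨h1, rfl⟩⟩
    · have := h.inj _ hj _ hk.le h1
      exact ⟨k + 1, hk, by omega, rfl⟩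
    · have := h.inj _ hj _ hk h1
      exact ⟨k, by omega, by omega, rfl⟩
  · rintro ⟨k, hk, rfl | rfl, rfl⟩
    · exact ⟨j, hk, Or.inl ⟨rfl, rfl⟩⟩
    · exact ⟨k, hj, Or.inr ⟨rfl, rfl⟩⟩

theorem BR_iff {j : ℕ} (hj : j ≤ S.M) (a : V) :
    S.BR (S.q j) a ↔ ∃ k ≤ S.M, ((k = j + 1 ∧ (k = S.m ∨ j = S.m + 1 ∨ j = S.m + S.ℓ + 2)) ∨
      (j = k + 1 ∧ (j = S.m ∨ k = S.m + 1 ∨ k = S.m + S.ℓ + 2))) ∧ a = S.q k := by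
  constructor
  · rintro ⟨k, hk, hb, ⟨h1, rfl⟩ | ⟨h1, rfl⟩⟩
    · have := h.inj _ hj _ hk.le h1
      exact ⟨k + 1, hk, by omega, rfl⟩
    · have := h.inj _ hj _ hk h1
      exact ⟨k, by omega, by omega, rfl⟩
  · rintro ⟨k, hk, ⟨rfl, h1⟩ | ⟨rfl, h1⟩, rfl⟩
    · exact ⟨j, hk, by omega, Or.inl ⟨rfl, rfl⟩⟩
    · exact ⟨k, hj, by omega, Or.inr ⟨rfl, rfl⟩⟩

/-- An inner vertex of the path has at most one edge that leaves the path. -/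
theorem leaving_unique {j : ℕ} (hj : 1 ≤ j) (hjM : j < S.M) {a b : V} (ha : S.G.Adj (S.q j) a)
    (hb : S.G.Adj (S.q j) b) (ha' : ¬ S.PE (S.q j) a) (hb' : ¬ S.PE (S.q j) b) : a = b := by
  by_contra hab
  have h1 : S.PE (S.q j) (S.q (j + 1)) := h.PE_succ hjM
  have h2 : S.PE (S.q j) (S.q (j - 1)) :=
    (h.PE_iff hjM.le _).2 ⟨j - 1, by omega, by omega, rfl⟩
  have hne : S.q (j + 1) ≠ S.q (j - 1) := fun h' => by
    have := h.inj _ (by omega) _ (by omega) h'; omega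
  rcases RedBlueGraph.eq_of_encard_neighborSet_le (h.degree_le (S.q j)) (h.PE_adj h1) (h.PE_adj h2)
    ha hb hne (by rintro h'; exact ha' (h' ▸ h1)) (by rintro h'; exact ha' (h' ▸ h2))
    with rfl | rfl | rfl
  · exact hb' h1
  · exact hb' h2
  · exact hab rfl

/-- Any two given vertices miss some neighbour. -/
theorem exists_third (v a b : V) : ∃ c, S.G.Adj v c ∧ c ≠ a ∧ c ≠ b := by
  by_contra hcon
  push Not at hcon
  have hsub : S.G.neighborSet v ⊆ {a, b} := by
    intro c hc
    by_cases hca : c = a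
    · exact Or.inl hca
    · exact Or.inr (hcon c hc hca)
  have h1 := Set.encard_le_encard hsub
  rw [h.degree] at h1
  have h2 : ({a, b} : Set V).encard ≤ 2 :=
    (Set.encard_insert_le _ _).trans (by rw [Set.encard_singleton]; norm_num)
  exact absurd (h1.trans h2) (by decide)

theorem exists_leaving {j : ℕ} (hj : 1 ≤ j) (hjM : j < S.M) :
    ∃ a, S.G.Adj (S.q j) a ∧ ¬ S.PE (S.q j) a := by
  obtain ⟨c, hc, h1, h2⟩ := h.exists_third (S.q j) (S.q (j + 1)) (S.q (j - 1))
  refine ⟨c, hc, fun h' => ?_⟩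
  obtain ⟨k, hk, rfl | rfl, rfl⟩ := (h.PE_iff hjM.le _).1 h'
  · exact h1 rfl
  · exact h2 rfl

/-- The leaving edge at a flipped vertex goes to a vertex off the path, which has a neighbour on
the path at which the edge is red. -/
theorem Flip_leaving {x t : V} (hx : S.Flip x) (hxt : S.G.Adj x t) (hPE : ¬ S.PE x t) :
    ¬ S.Z t ∧ ((∃ j, j + 1 = S.m ∧ x = S.q j ∧ S.G.Adj t (S.q S.m)) ∨
      (x = S.q (S.m + S.ℓ + 3) ∧ S.G.Adj t (S.q (S.m + S.ℓ + 2)))) := by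
  have hx' := hx
  obtain ⟨j, hj1, hjM, rfl, hj⟩ := h.Flip_index hx'
  have hroom := h.room
  rcases hx with ⟨⟨k, hk, hkx⟩, s, hs, hsx, hsm⟩ | ⟨hjx, s, hs, hsx, hsm⟩
  · have : t = s := h.leaving_unique hj1 hjM hxt hsx.symm hPE (fun h' => hs (PE_right h'))
    subst this
    exact ⟨hs, Or.inl ⟨k, hk, hkx, hsm⟩⟩
  · have : t = s := h.leaving_unique hj1 hjM hxt hsx.symm hPE (fun h' => hs (PE_right h'))
    subst this
    exact ⟨hs, Or.inr ⟨hjx, hsm⟩⟩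

theorem not_Flip_of_not_crit {j : ℕ} (hj : j ≤ S.M) (h1 : j + 1 ≠ S.m)
    (h2 : j ≠ S.m + S.ℓ + 3) : ¬ S.Flip (S.q j) := by
  intro hF
  obtain ⟨k, hk1, hkM, hk, hk'⟩ := h.Flip_index hF
  have := h.inj _ hj _ hkM.le hk
  omega

/-- A leaving edge at a path vertex that is not flipped is red unless it leads to a flipped
vertex, which cannot be. -/
theorem Fr_of_leaving {j : ℕ} (hj : j ≤ S.M) (hF : ¬ S.Flip (S.q j)) {a : V}
    (ha : S.G.Adj (S.q j) a) (hPE : ¬ S.PE (S.q j) a) : S.Fr (S.q j) a := by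
  refine ⟨ha, hPE, Or.inl ⟨Or.inl ⟨j, hj, rfl⟩, hF, fun hFa => ?_⟩⟩
  exact (h.Flip_leaving hFa ha.symm (fun h' => hPE (PE_symm h'))).1 ⟨j, hj, rfl⟩

theorem not_Flip_of_Fr {a b : V} (hab : S.Fr a b) : ¬ S.Flip a := by
  rcases hab.2.2 with h1 | h1
  · exact h1.2.1
  · exact fun hF => h.Er_off _ _ h1 (h.Flip_Z hF)

theorem red_blue_false {a b : V} (hr : S.Red a b) (hb : S.Blue a b) : False := by
  rcases hr with hr | hr
  · rcases hb with hb | hb | hb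
    · exact hb.2 hr
    · exact hb.2.1 (PE_of_BR hr)
    · exact hb.2.1 (PE_left (PE_of_BR hr))
  · rcases hb with hb | hb | hb
    · exact hr.2.1 hb.1
    · exact hb.2.2.elim (h.not_Flip_of_Fr hr) (h.not_Flip_of_Fr (h.Fr_symm hr))
    · rcases hr.2.2 with h1 | h1
      · exact h1.1.elim hb.2.1 hb.2.2.1
      · exact hb.2.2.2.1 h1

/-- All edges at a path vertex are coloured. -/
theorem full_Z {a b : V} (ha : S.Z a) (hab : S.G.Adj a b) : S.Red a b ∨ S.Blue a b := by
  by_cases h1 : S.BR a b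
  · exact Or.inl (Or.inl h1)
  by_cases h2 : S.PE a b
  · exact Or.inr (Or.inl ⟨h2, h1⟩)
  by_cases h3 : S.Flip a ∨ S.Flip b
  · exact Or.inr (Or.inr (Or.inl ⟨hab, h2, h3⟩))
  push Not at h3
  exact Or.inl (Or.inr ⟨hab, h2, Or.inl ⟨Or.inl ha, h3⟩⟩)

theorem red_adj {a b : V} (hab : S.Red a b) : S.G.Adj a b :=
  hab.elim (fun h' => h.PE_adj (PE_of_BR h')) (fun h' => h'.1)

theorem blue_adj {a b : V} (hab : S.Blue a b) : S.G.Adj a b := by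
  rcases hab with h1 | h1 | h1
  · exact h.PE_adj h1.1
  · exact h1.1
  · exact h1.1

theorem red_symm {a b : V} (hab : S.Red a b) : S.Red b a :=
  hab.imp BR_symm h.Fr_symm

theorem blue_symm {a b : V} (hab : S.Blue a b) : S.Blue b a := by
  rcases hab with h1 | h1 | h1
  · exact Or.inl ⟨PE_symm h1.1, fun h' => h1.2 (BR_symm h')⟩
  · exact Or.inr (Or.inl ⟨h1.1.symm, fun h' => h1.2.1 (PE_symm h'), h1.2.2.symm⟩)
  · exact Or.inr (Or.inr ⟨h1.1.symm, h1.2.2.1, h1.2.1, fun h' => h1.2.2.2.1 (h.Er_symm _ _ h'),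
      h1.2.2.2.2.symm⟩)

/-- At a vertex off the path the red edges are the `Fr`-edges. -/
theorem red_off {a b : V} (ha : ¬ S.Z a) : S.Red a b ↔ S.Fr a b :=
  ⟨fun h' => h'.resolve_left (fun h1 => ha (PE_left (PE_of_BR h1))), Or.inr⟩

theorem Fr_Z {a b : V} (ha : ¬ S.Z a) (hb : S.Z b) (hab : S.G.Adj a b) (hF : ¬ S.Flip b) :
    S.Fr a b :=
  ⟨hab, fun h' => ha (PE_left h'), Or.inl ⟨Or.inr hb, fun h' => ha (h.Flip_Z h'), hF⟩⟩

theorem Sat_off {x : V} (hx : S.Sat x) : ¬ S.Z x := by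
  rcases hx with hx | hx
  · rcases h.kind_tip with ⟨h1, -⟩ | ⟨h1, -⟩ | ⟨-, u, w, h1⟩
    · rw [h1] at hx; exact hx.elim
    · rw [h1] at hx; exact hx.elim
    · rw [h1.set] at hx
      rcases hx with rfl | rfl
      · exact h1.not_Z_u
      · exact h1.not_Z_w
  · exact hx.1

/-- All edges at a saturated vertex are coloured. -/
theorem full_Sat {a b : V} (ha : S.Sat a) (hab : S.G.Adj a b) : S.Red a b ∨ S.Blue a b := by
  have hZ := h.Sat_off ha
  by_cases hb : S.Z b
  · rcases h.full_Z hb hab.symm with h1 | h1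
    · exact Or.inl (h.red_symm h1)
    · exact Or.inr (h.blue_symm h1)
  by_cases hEr : S.Er a b
  · exact Or.inl (Or.inr ⟨hab, fun h' => hZ (PE_left h'), Or.inr hEr⟩)
  · exact Or.inr (Or.inr (Or.inr ⟨hab, hZ, hb, hEr, Or.inl ha⟩))

theorem full_Leaf {a b c : V} (hEr : S.Er a b) (hL : S.Leaf a b) (hac : S.G.Adj a c) :
    S.Red a c ∨ S.Blue a c := by
  rcases hL.2 c hac with rfl | hc
  · exact Or.inl (Or.inr ⟨hac, fun h' => h.Er_off _ _ hEr (PE_left h'), Or.inr hEr⟩)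
  · rcases h.full_Sat hc hac.symm with h1 | h1
    · exact Or.inl (h.red_symm h1)
    · exact Or.inr (h.blue_symm h1)

/-- Blue edges at a vertex off the path. -/
theorem blue_off {a b : V} (ha : ¬ S.Z a) (hab : S.Blue a b) :
    (S.Z b ∧ S.Flip b) ∨ (¬ S.Z b ∧ ¬ S.Er a b ∧ (S.Sat a ∨ S.Sat b)) := by
  rcases hab with h1 | h1 | h1
  · exact (ha (PE_left h1.1)).elim
  · rcases h1.2.2 with h2 | h2
    · exact (ha (h.Flip_Z h2)).elim
    · exact Or.inl ⟨h.Flip_Z h2, h2⟩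
  · exact Or.inr h1.2.2

/-- A vertex joined to a flipped vertex has a red edge to the path. -/
theorem Fr_of_flip {a b : V} (ha : ¬ S.Z a) (hb : S.Flip b) (hab : S.G.Adj a b) :
    ∃ j, (j = S.m ∨ j = S.m + S.ℓ + 2) ∧ S.Fr a (S.q j) ∧ S.Red (S.q j) b := by
  have hroom := h.room
  have hpos := h.pos
  obtain ⟨-, ⟨j, hj, rfl, hadj⟩ | ⟨rfl, hadj⟩⟩ := h.Flip_leaving hb hab.symm
    (fun h' => ha (PE_right h'))
  · refine ⟨S.m, Or.inl rfl, h.Fr_Z ha ⟨S.m, by omega, rfl⟩ hadj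
      (h.not_Flip_of_not_crit (by omega) (by omega) (by omega)), Or.inl ?_⟩
    rw [h.BR_iff (by omega)]
    exact ⟨j, by omega, by omega, rfl⟩
  · refine ⟨_, Or.inr rfl, h.Fr_Z ha ⟨_, by omega, rfl⟩ hadj
      (h.not_Flip_of_not_crit (by omega) (by omega) (by omega)), Or.inl ?_⟩
    rw [h.BR_iff (by omega)]
    exact ⟨_, by omega, by omega, rfl⟩

theorem mark_of_Fr {x a : V} (hx : ¬ S.Z x) (ha : S.Fr x a) : S.Mark x a :=
  ⟨ha.1, ha.2.2.imp (fun h1 => h1.1.resolve_left hx) id⟩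

theorem Er_Fr {a b : V} (hab : S.Er a b) : S.Fr a b :=
  ⟨h.Er_adj _ _ hab, fun h' => h.Er_off _ _ hab (PE_left h'), Or.inr hab⟩

theorem mark2_of_S2 {x : V} (hx : S.S2 x) : S.Mark2 x := by
  obtain ⟨hx, a, b, hab, ha, hb⟩ := hx
  exact ⟨hx, a, b, hab, h.mark_of_Fr hx ha, h.mark_of_Fr hx hb⟩

theorem max_Fr (x a b c : V) (hx : ¬ S.Z x) (ha : S.Fr x a) (hb : S.Fr x b) (hc : S.Fr x c) :
    a = b ∨ a = c ∨ b = c :=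
  h.max_mark x a b c hx (h.mark_of_Fr hx ha) (h.mark_of_Fr hx hb) (h.mark_of_Fr hx hc)

/-- A vertex off the path that is adjacent to the path has a red edge: if the path vertex is
flipped, there is a red edge to the other end of its red path edge. So a vertex without red edges
has no marks, and `no_mark` applies. -/
theorem no_Fr (x a b : V) (hx : ¬ S.Z x) (hno : ∀ c, ¬ S.Fr x c) (ha : S.Sat a) (hb : S.Sat b)
    (hxa : S.G.Adj x a) (hxb : S.G.Adj x b) : a = b := by
  refine h.no_mark x a b hx (fun c hc => ?_) (ha.imp id h.mark2_of_S2) (hb.imp id h.mark2_of_S2)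
    hxa hxb
  rcases hc.2 with h1 | h1
  · by_cases hF : S.Flip c
    · obtain ⟨j, -, hj, -⟩ := h.Fr_of_flip hx hF hc.1
      exact hno _ hj
    · exact hno _ (h.Fr_Z hx h1 hc.1 hF)
  · exact hno _ (h.Er_Fr h1)

theorem near_Sat (x : V) (hx : S.Sat x) : S.Near 3 x :=
  hx.elim (h.near_U0 x) fun h' => h.near_mark x (h.mark2_of_S2 h')

/-- A neighbour c of the tip is saturated through red edges to z and z'. If z, say, were flipped, c
would also be adjacent to the other end of the red path edge at z. That end would have to be z', but
z and z' are not adjacent. -/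
theorem leaf_of_isTip {a b : V} (hab : S.Er a b) (hT : S.IsTip a b) : S.Leaf a b := by
  refine ⟨fun c hc => hT.1 c (h.mark_of_Fr (h.Er_off _ _ hab) hc), fun c hc => ?_⟩
  rcases hT.2 c hc with h1 | h1 | ⟨hcZ, z, z', hne, hz, hz', hcz, hcz', hnadj, hall⟩
  · exact Or.inl h1
  · exact Or.inr (Or.inl h1)
  · have hF : ∀ y, (y = z ∨ y = z') → ¬ S.Flip y := by
      intro y hy hFy
      have hcy : S.G.Adj c y := by rcases hy with rfl | rfl <;> assumption
      obtain ⟨j, hj, hFr, hred⟩ := h.Fr_of_flip hcZ hFy hcy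
      have hadj := h.red_adj hred
      have hroom := h.room
      rcases hall _ ⟨j, by omega, rfl⟩ hFr.1 with h1 | h1 <;> rw [h1] at hadj <;>
        rcases hy with rfl | rfl
      · exact hadj.ne rfl
      · exact hnadj hadj
      · exact hnadj hadj.symm
      · exact hadj.ne rfl
    exact Or.inr (Or.inr ⟨hcZ, z, z', hne, h.Fr_Z hcZ hz hcz (hF z (Or.inl rfl)),
      h.Fr_Z hcZ hz' hcz' (hF z' (Or.inr rfl))⟩)

theorem kind : (S.U0 = ∅ ∧ (∀ a b, S.Er a b → S.Leaf a b ∨ S.Leaf b a) ∧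
        S.G.Adj (S.q (S.m + 1)) (S.q (S.m + 3))) ∨
      (S.U0 = ∅ ∧ ∃ u t w, S.Loop u t w ∧ ∀ a b, S.Er a b → S.Leaf a b ∨ S.Leaf b a ∨
        (a = u ∧ b = t) ∨ (a = t ∧ b = u) ∨ (a = t ∧ b = w) ∨ (a = w ∧ b = t)) ∨
      ((∀ a b, S.Er a b → S.Leaf a b ∨ S.Leaf b a) ∧ ∃ u w, S.Lane u w) := by
  have key : ∀ a b, S.Er a b → (S.IsTip a b → S.Leaf a b) ∧ (S.IsTip b a → S.Leaf b a) :=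
    fun a b hab => ⟨h.leaf_of_isTip hab, h.leaf_of_isTip (h.Er_symm _ _ hab)⟩
  rcases h.kind_tip with ⟨h1, h2, h3⟩ | ⟨h1, u, t, w, hL, h2⟩ | ⟨h2, h3⟩
  · exact Or.inl ⟨h1, fun a b hab => (h2 a b hab).imp (key a b hab).1 (key a b hab).2, h3⟩
  · exact Or.inr (Or.inl ⟨h1, u, t, w, hL, fun a b hab =>
      (h2 a b hab).imp (key a b hab).1 (Or.imp (key a b hab).2 id)⟩)
  · exact Or.inr (Or.inr ⟨fun a b hab => (h2 a b hab).imp (key a b hab).1 (key a b hab).2, h3⟩)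

/-- Used for connectedness: an extra edge contains a vertex adjacent to the path or is joined to
such a vertex by an edge at a saturated vertex, which is coloured. -/
theorem reach_Er (a b : V) (hab : S.Er a b) : ∃ s, (∃ z, S.Z z ∧ S.G.Adj s z) ∧
    (s = a ∨ s = b ∨ (S.Sat s ∧ (S.G.Adj s a ∨ S.G.Adj s b))) := by
  have hroom := h.room
  have key : ∀ a b, S.Er a b → S.IsTip a b → ∃ s, (∃ z, S.Z z ∧ S.G.Adj s z) ∧
      (S.Sat s ∧ S.G.Adj s a) := by
    intro a b hab hT
    obtain ⟨c, hc, hcb, -⟩ := h.exists_third a b b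
    have hS := ((h.leaf_of_isTip hab hT).2 c hc).resolve_left hcb
    refine ⟨c, ?_, hS, hc.symm⟩
    rcases hT.2 c hc with h1 | h1 | ⟨-, z, -, -, hz, -, hcz, -⟩
    · exact (hcb h1).elim
    · rcases h.kind_tip with ⟨h2, -⟩ | ⟨h2, -⟩ | ⟨-, u, w, hL⟩
      · rw [h2] at h1; exact h1.elim
      · rw [h2] at h1; exact h1.elim
      · rw [hL.set] at h1
        rcases h1 with rfl | rfl
        · exact ⟨_, ⟨S.m + 1, by omega, rfl⟩, hL.adj_u⟩
        · exact ⟨_, ⟨S.m + 3, by omega, rfl⟩, hL.adj_w⟩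
    · exact ⟨z, hz, hcz⟩
  have key2 : (S.IsTip a b ∨ S.IsTip b a) → ∃ s, (∃ z, S.Z z ∧ S.G.Adj s z) ∧
      (s = a ∨ s = b ∨ (S.Sat s ∧ (S.G.Adj s a ∨ S.G.Adj s b))) := by
    rintro (h1 | h1)
    · obtain ⟨s, h2, h3, h4⟩ := key a b hab h1
      exact ⟨s, h2, Or.inr (Or.inr ⟨h3, Or.inl h4⟩)⟩
    · obtain ⟨s, h2, h3, h4⟩ := key b a (h.Er_symm _ _ hab) h1
      exact ⟨s, h2, Or.inr (Or.inr ⟨h3, Or.inr h4⟩)⟩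
  rcases h.kind_tip with ⟨-, h2, -⟩ | ⟨-, u, t, w, hL, h2⟩ | ⟨h2, -⟩
  · exact key2 (h2 a b hab)
  · have hu : ∃ z, S.Z z ∧ S.G.Adj u z := ⟨_, ⟨S.m + 1, by omega, rfl⟩, hL.2.2.1⟩
    have hw : ∃ z, S.Z z ∧ S.G.Adj w z := ⟨_, ⟨S.m + 3, by omega, rfl⟩, hL.2.2.2.1⟩
    rcases h2 a b hab with h3 | h3 | h3 | h3 | h3 | h3
    · exact key2 (Or.inl h3)
    · exact key2 (Or.inr h3)
    · exact ⟨u, hu, Or.inl h3.1.symm⟩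
    · exact ⟨u, hu, Or.inr (Or.inl h3.2.symm)⟩
    · exact ⟨w, hw, Or.inr (Or.inl h3.2.symm)⟩
    · exact ⟨w, hw, Or.inl h3.1.symm⟩
  · exact key2 (h2 a b hab)

end Valid

theorem Lane.Fr_u {u w : V} (hL : S.Lane u w) (c : V) (hc : S.Fr u c) : c = S.q (S.m + 1) :=
  hL.mark_u c ⟨hc.1, hc.2.2.imp (fun h1 => h1.1.resolve_left hL.not_Z_u) id⟩

theorem Lane.Fr_w {u w : V} (hL : S.Lane u w) (c : V) (hc : S.Fr w c) : c = S.q (S.m + 3) :=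
  hL.mark_w c ⟨hc.1, hc.2.2.imp (fun h1 => h1.1.resolve_left hL.not_Z_w) id⟩

theorem Valid.lane_not_flip (h : S.Valid) {u w : V} (hL : S.Lane u w) (c : V)
    (hc : S.G.Adj u c ∨ S.G.Adj w c) : ¬ S.Flip c := by
  intro hF
  have hroom := h.room
  have h3 := h.three_le
  rcases hc with hc | hc
  · have := hL.mark_u c ⟨hc, Or.inl (h.Flip_Z hF)⟩
    subst this
    exact h.not_Flip_of_not_crit (by omega) (by omega) (by omega) hF
  · have := hL.mark_w c ⟨hc, Or.inl (h.Flip_Z hF)⟩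
    subst this
    exact h.not_Flip_of_not_crit (by omega) (by omega) (by omega) hF

/-- A neighbour of a flipped vertex has a second neighbour on the path, whereas `single` allows
neighbours of the lane only one. -/
theorem Valid.lane_clean (h : S.Valid) {u w : V} (hL : S.Lane u w) (x c : V)
    (hx : S.G.Adj u x ∨ S.G.Adj w x) (hxZ : ¬ S.Z x) (hxc : S.G.Adj x c) :
    ¬ S.S2 c ∧ ¬ S.Flip c := by
  refine ⟨fun h' => hL.not_mark x c hx hxZ hxc (h.mark2_of_S2 h'), fun hF => ?_⟩
  obtain ⟨j, hj, hFr, hred⟩ := h.Fr_of_flip hxZ hF hxc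
  have hroom := h.room
  have := hL.single x c _ hx hxZ (h.Flip_Z hF) ⟨j, by omega, rfl⟩ hxc hFr.1
  exact (h.red_adj hred).ne this.symm

end ColourScheme

/-! ### Both colours at every vertex, and acyclicity of the red graph -/

namespace ColourScheme

variable {V : Type*} {S : ColourScheme V}

namespace Valid

variable (h : S.Valid)
include h

theorem exists_lane {x : V} (hx : x ∈ S.U0) : ∃ u w, S.Lane u w := by
  rcases h.kind with ⟨h1, -⟩ | ⟨h1, -⟩ | ⟨-, h1⟩
  · rw [h1] at hx; exact hx.elim
  · rw [h1] at hx; exact hx.elim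
  · exact h1

theorem not_Flip_succ : ¬ S.Flip (S.q (S.m + 1)) := by
  have := h.room
  exact h.not_Flip_of_not_crit (by omega) (by omega) (by omega)

theorem not_Flip_add_three : ¬ S.Flip (S.q (S.m + 3)) := by
  have := h.room
  have := h.three_le
  exact h.not_Flip_of_not_crit (by omega) (by omega) (by omega)

/-- A vertex of `U0` has exactly one red edge. -/
theorem Fr_U0 {x : V} (hx : x ∈ S.U0) :
    ∃ j, (j = S.m + 1 ∨ j = S.m + 3) ∧ S.Fr x (S.q j) ∧ ∀ c, S.Fr x c → c = S.q j := by
  obtain ⟨u, w, hL⟩ := h.exists_lane hx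
  have := h.room
  rw [hL.set] at hx
  rcases hx with rfl | rfl
  · exact ⟨_, Or.inl rfl, h.Fr_Z hL.not_Z_u ⟨_, by omega, rfl⟩ hL.adj_u h.not_Flip_succ, hL.Fr_u⟩
  · exact ⟨_, Or.inr rfl, h.Fr_Z hL.not_Z_w ⟨_, by omega, rfl⟩ hL.adj_w h.not_Flip_add_three,
      hL.Fr_w⟩

/-- A vertex of `U0` has two blue edges. -/
theorem blue_U0 {x : V} (hx : x ∈ S.U0) : ∃ a b, a ≠ b ∧ S.Blue x a ∧ S.Blue x b := by
  obtain ⟨j, -, hj, huniq⟩ := h.Fr_U0 hx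
  have hZ := h.Sat_off (Or.inl hx)
  have key : ∀ c, S.G.Adj x c → c ≠ S.q j → S.Blue x c := fun c hc hne =>
    (h.full_Sat (Or.inl hx) hc).resolve_left fun hr => hne (huniq c ((h.red_off hZ).1 hr))
  obtain ⟨a, ha, ha1, -⟩ := h.exists_third x (S.q j) (S.q j)
  obtain ⟨b, hb, hb1, hb2⟩ := h.exists_third x (S.q j) a
  exact ⟨a, b, hb2.symm, key a ha ha1, key b hb hb1⟩

theorem exists_blue_Z {x : V} (hx : S.Z x) : ∃ a, S.Blue x a := by
  obtain ⟨j, hj, rfl⟩ := hx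
  have := h.room
  have := h.pos
  have := h.three_le
  by_cases hb : j < S.M ∧ ¬ (j + 1 = S.m ∨ j = S.m + 1 ∨ j = S.m + S.ℓ + 2)
  · refine ⟨S.q (j + 1), Or.inl ⟨h.PE_succ hb.1, fun hBR => ?_⟩⟩
    obtain ⟨k, hk, hk', hkj⟩ := (h.BR_iff hj _).1 hBR
    have := h.inj _ hb.1 _ hk hkj
    omega
  · refine ⟨S.q (j - 1), Or.inl ⟨(h.PE_iff hj _).2 ⟨j - 1, by omega, by omega, rfl⟩, fun hBR => ?_⟩⟩
    obtain ⟨k, hk, hk', hkj⟩ := (h.BR_iff hj _).1 hBR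
    have := h.inj _ (by omega) _ hk hkj
    omega

theorem exists_leaving' {j : ℕ} (hj : j ≤ S.M) : ∃ a, S.G.Adj (S.q j) a ∧ ¬ S.PE (S.q j) a := by
  by_cases h0 : 1 ≤ j ∧ j < S.M
  · exact h.exists_leaving h0.1 h0.2
  have := h.room
  obtain ⟨c, hc, h1, h2⟩ := h.exists_third (S.q j) (S.q (j + 1)) (S.q (j - 1))
  refine ⟨c, hc, fun h' => ?_⟩
  obtain ⟨k, hk, rfl | rfl, rfl⟩ := (h.PE_iff hj _).1 h'
  · exact h1 rfl
  · exact h2 rfl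

theorem exists_red_Z {x : V} (hx : S.Z x) : ∃ a, S.Red x a := by
  by_cases hF : S.Flip x
  · obtain ⟨j, hj1, hjM, rfl, hj⟩ := h.Flip_index hF
    have := h.room
    rcases hj with hj | hj
    · exact ⟨S.q S.m, Or.inl ((h.BR_iff hjM.le _).2 ⟨S.m, by omega, by omega, rfl⟩)⟩
    · exact ⟨S.q (S.m + S.ℓ + 2), Or.inl ((h.BR_iff hjM.le _).2 ⟨_, by omega, by omega, rfl⟩)⟩
  · obtain ⟨j, hj, rfl⟩ := hx
    obtain ⟨a, ha, ha'⟩ := h.exists_leaving' hj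
    exact ⟨a, Or.inr (h.Fr_of_leaving hj hF ha ha')⟩

theorem blue_sees {x a : V} (hx : ¬ S.Z x) (hS : ¬ S.Sat x) (hno : ∀ c, ¬ S.Fr x c)
    (ha : S.Blue x a) : S.Sat a := by
  rcases h.blue_off hx ha with ⟨-, h1⟩ | ⟨-, -, h1⟩
  · obtain ⟨j, -, hj, -⟩ := h.Fr_of_flip hx h1 (h.blue_adj ha)
    exact (hno _ hj).elim
  · exact h1.resolve_left hS

/-- Vertices on the path and saturated vertices always see both colours. Any other vertex with two
red edges would be saturated, and with two blue edges but no red one it would have two saturated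
neighbours, against `no_Fr`. -/
theorem sees_both {x a b : V} (hab : a ≠ b) (ha : S.Red x a ∨ S.Blue x a)
    (hb : S.Red x b ∨ S.Blue x b) : (∃ c, S.Red x c) ∧ ∃ c, S.Blue x c := by
  by_cases hx : S.Z x
  · exact ⟨h.exists_red_Z hx, h.exists_blue_Z hx⟩
  by_cases hS : S.Sat x
  · rcases hS with hS | hS
    · obtain ⟨j, -, hj, -⟩ := h.Fr_U0 hS
      obtain ⟨c, -, -, hc, -⟩ := h.blue_U0 hS
      exact ⟨⟨_, Or.inr hj⟩, ⟨c, hc⟩⟩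
    · obtain ⟨-, c, d, hcd, hc, hd⟩ := hS
      refine ⟨⟨c, Or.inr hc⟩, ?_⟩
      obtain ⟨e, he, hec, hed⟩ := h.exists_third x c d
      refine ⟨e, (h.full_Sat (Or.inr ⟨hx, c, d, hcd, hc, hd⟩) he).resolve_left fun hr => ?_⟩
      rw [h.red_off hx] at hr
      rcases h.max_Fr x c d e hx hc hd hr with h1 | h1 | h1
      · exact hcd h1
      · exact hec h1.symm
      · exact hed h1.symm
  · rcases ha with ha | ha
    · rcases hb with hb | hb
      · rw [h.red_off hx] at ha hb
        exact (hS (Or.inr ⟨hx, a, b, hab, ha, hb⟩)).elim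
      · exact ⟨⟨a, ha⟩, ⟨b, hb⟩⟩
    · refine ⟨?_, ⟨a, ha⟩⟩
      rcases hb with hb | hb
      · exact ⟨b, hb⟩
      · by_contra hcon
        push Not at hcon
        have hno : ∀ c, ¬ S.Fr x c := fun c hc => hcon c (Or.inr hc)
        exact hab (h.no_Fr x a b hx hno (h.blue_sees hx hS hno ha) (h.blue_sees hx hS hno hb)
          (h.blue_adj ha) (h.blue_adj hb))

/-- A path vertex is the end of at most one red edge of the path. -/
theorem BR_unique {j : ℕ} (hj : j ≤ S.M) {a b : V} (ha : S.BR (S.q j) a) (hb : S.BR (S.q j) b) :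
    a = b := by
  obtain ⟨k, hk, hk', rfl⟩ := (h.BR_iff hj _).1 ha
  obtain ⟨l, hl, hl', rfl⟩ := (h.BR_iff hj _).1 hb
  have := h.three_le
  have := h.pos
  have : k = l := by omega
  rw [this]

theorem crit_ne {i j : ℕ} (hi : S.Crit i) (hj : S.Crit j) (hiM : i ≤ S.M) (hjM : j ≤ S.M)
    (hij : S.G.Adj (S.q i) (S.q j)) : S.PE (S.q i) (S.q j) := by
  rcases lt_trichotomy i j with h1 | rfl | h1
  · have := h.gap_chord i j hi hj h1 hij
    subst this
    exact h.PE_succ hjM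
  · exact (hij.ne rfl).elim
  · have := h.gap_chord j i hj hi h1 hij.symm
    subst this
    exact PE_symm (h.PE_succ hiM)

/-- Two critical vertices with a common neighbour off the path include a flipped one. -/
theorem flip_of_common {i j : ℕ} (hi : S.Crit i) (hj : S.Crit j) (hij : i < j) {x : V}
    (hx : ¬ S.Z x) (hxi : S.G.Adj x (S.q i)) (hxj : S.G.Adj x (S.q j)) :
    S.Flip (S.q i) ∨ S.Flip (S.q j) := by
  have := h.gap i j x hi hj hij hx hxi hxj
  have := h.room
  have := h.pos
  have hcases : (i + 1 = S.m ∧ j = S.m) ∨ (i = S.m + S.ℓ + 2 ∧ j = S.m + S.ℓ + 3) := by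
    unfold Crit at hi hj
    omega
  rcases hcases with ⟨h1, rfl⟩ | ⟨rfl, rfl⟩
  · exact Or.inl (Or.inl ⟨⟨i, h1, rfl⟩, x, hx, hxi, hxj⟩)
  · exact Or.inr (Or.inr ⟨rfl, x, hx, hxj, hxi⟩)

-- The heights are 5, 4, 3, 2, 1 along q (m+2), q (m+1), u, t, w, then 7 at critical vertices, 6 at
-- the remaining vertices off the path with two red edges, and 0 elsewhere. Along the gadget the
-- next vertex is always lower, which leaves at most one red neighbour at least as high. Red edges
-- between critical vertices are path edges, at most one at each vertex. A vertex of height 6 with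
-- two neighbours at least as high would have red edges to two critical vertices; one of these would
-- be flipped and could not have such an edge. In the absence of a loop, u, t and w all stand for q
-- (m+1).
open Classical in
theorem red_acyclic_aux (R : SimpleGraph V) (hR : ∀ a b, R.Adj a b → S.Red a b) (u t w : V)
    (hEr : ∀ a b, S.Er a b → S.Leaf a b ∨ S.Leaf b a ∨ (a = u ∧ b = t) ∨ (a = t ∧ b = u) ∨
      (a = t ∧ b = w) ∨ (a = w ∧ b = t))
    (hloop : (S.Z u ∧ S.Z t ∧ S.Z w ∧ u = S.q (S.m + 1) ∧ t = S.q (S.m + 1) ∧ w = S.q (S.m + 1) ∧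
      ∀ a, S.Fr (S.q (S.m + 1)) a → ¬ S.S2 a ∧ ∀ j ≤ S.M, S.Crit j → a ≠ S.q j) ∨ S.Loop u t w) :
    R.IsAcyclic := by
  have hroom := h.room
  have hpos := h.pos
  have h3 := h.three_le
  set C : V → Prop := fun x => ∃ j ≤ S.M, S.Crit j ∧ x = S.q j with hC
  set H : V → ℕ := fun x => if x = S.q (S.m + 2) then 5 else if x = S.q (S.m + 1) then 4 else
    if x = u then 3 else if x = t then 2 else if x = w then 1 else
    if C x then 7 else if S.S2 x then 6 else 0 with hH
  have hHdef : ∀ x, H x = if x = S.q (S.m + 2) then 5 else if x = S.q (S.m + 1) then 4 else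
    if x = u then 3 else if x = t then 2 else if x = w then 1 else
    if C x then 7 else if S.S2 x then 6 else 0 := fun x => rfl
  have hqne : ∀ i ≤ S.M, ∀ j ≤ S.M, i ≠ j → S.q i ≠ S.q j := fun i hi j hj hij h' =>
    hij (h.inj i hi j hj h')
  have hCq : ∀ j ≤ S.M, C (S.q j) ↔ S.Crit j := by
    intro j hj
    constructor
    · rintro ⟨k, hk, hk', hjk⟩
      rwa [h.inj j hj k hk hjk]
    · exact fun h' => ⟨j, hj, h', rfl⟩
  have hZq : ∀ j ≤ S.M, S.Z (S.q j) := fun j hj => ⟨j, hj, rfl⟩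
  have h12 : S.q (S.m + 1) ≠ S.q (S.m + 2) := hqne _ (by omega) _ (by omega) (by omega)
  have hH1 : H (S.q (S.m + 1)) = 4 := by
    rw [hHdef, if_neg h12, if_pos rfl]
  have hH2 : H (S.q (S.m + 2)) = 5 := by
    rw [hHdef, if_pos rfl]
  have hutw : ∀ j ≤ S.M, j ≠ S.m + 1 → S.q j ≠ u ∧ S.q j ≠ t ∧ S.q j ≠ w := by
    intro j hj hj1
    rcases hloop with ⟨-, -, -, rfl, rfl, rfl, -⟩ | ⟨h1, h2, -, -, h4⟩
    · exact ⟨hqne _ hj _ (by omega) hj1, hqne _ hj _ (by omega) hj1, hqne _ hj _ (by omega) hj1⟩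
    · have ht : ¬ S.Z t := by
        rcases h4 with ⟨rfl, -⟩ | ⟨-, h4, -⟩
        · exact h1
        · exact h.Er_off' h4
      exact ⟨fun h' => h1 (h' ▸ hZq j hj), fun h' => ht (h' ▸ hZq j hj),
        fun h' => h2 (h' ▸ hZq j hj)⟩
  have hHcrit : ∀ j ≤ S.M, S.Crit j → H (S.q j) = 7 := by
    intro j hj hc
    have h1 : j ≠ S.m + 1 := by unfold Crit at hc; omega
    have h2 : j ≠ S.m + 2 := by unfold Crit at hc; omega
    rw [hHdef, if_neg (hqne _ hj _ (by omega) h2), if_neg (hqne _ hj _ (by omega) h1),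
      if_neg (hutw j hj h1).1, if_neg (hutw j hj h1).2.1, if_neg (hutw j hj h1).2.2,
      if_pos ((hCq j hj).2 hc)]
  have hHnon : ∀ j ≤ S.M, ¬ S.Crit j → j ≠ S.m + 1 → j ≠ S.m + 2 → H (S.q j) = 0 := by
    intro j hj hc h1 h2
    rw [hHdef, if_neg (hqne _ hj _ (by omega) h2), if_neg (hqne _ hj _ (by omega) h1),
      if_neg (hutw j hj h1).1, if_neg (hutw j hj h1).2.1, if_neg (hutw j hj h1).2.2,
      if_neg (fun h' => hc ((hCq j hj).1 h')), if_neg (fun h' => h'.1 (hZq j hj))]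
  have hH7 : ∀ x, ¬ C x → H x ≤ 6 := by
    intro x hx
    rw [hHdef]
    split_ifs <;> omega
  have hHoff : ∀ x, ¬ S.Z x → ¬ S.S2 x → H x ≤ 3 := by
    intro x hx hx2
    have hx' : ∀ j ≤ S.M, x ≠ S.q j := fun j hj h' => hx (h' ▸ hZq j hj)
    have : ¬ C x := fun ⟨j, hj, _, h'⟩ => hx' j hj h'
    rw [hHdef, if_neg (hx' _ (by omega)), if_neg (hx' _ (by omega))]
    split_ifs <;> omega
  have hcritFr : ∀ j ≤ S.M, S.Crit j → ∀ b, S.Fr (S.q j) b → H b ≤ 6 := by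
    intro j hj hc b hb
    apply hH7
    rintro ⟨k, hk, hk', rfl⟩
    exact hb.2.1 (h.crit_ne hc hk' hj hk hb.1)
  -- one red edge of the path and one leaving red edge
  have hmixed : ∀ j ≤ S.M, ∀ a b, S.BR (S.q j) a → S.Fr (S.q j) b → H (S.q j) ≤ H a →
      H (S.q j) ≤ H b → False := by
    intro j hj a b ha hb hHa hHb
    obtain ⟨k, hk, hk', rfl⟩ := (h.BR_iff hj _).1 ha
    by_cases hj2 : j = S.m + 2
    · have : k = S.m + 1 := by omega
      subst this hj2
      omega
    by_cases hj1 : j = S.m + 1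
    · subst hj1
      rw [hH1] at hHb
      rcases hloop with ⟨hu, ht, hw, rfl, rfl, rfl, h4⟩ | ⟨h1, h2, h4, -⟩
      · obtain ⟨hb2, hb3⟩ := h4 b hb
        have hbC : ¬ C b := fun ⟨i, hi, hi', h'⟩ => hb3 i hi hi' h'
        have hb0 : b ≠ S.q (S.m + 1) := hb.1.ne.symm
        have hb4 : b ≠ S.q (S.m + 2) := fun h' => hb.2.1 (h' ▸ h.PE_succ (by omega))
        have : H b = 0 := by
          rw [hHdef, if_neg hb4, if_neg hb0, if_neg hb0, if_neg hb0, if_neg hb0, if_neg hbC, if_neg hb2]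
        omega
      · have : b = u := h.leaving_unique (j := S.m + 1) (by omega) (by omega) hb.1 h4.symm hb.2.1
          (fun h' => h1 (PE_right h'))
        subst this
        have hb1 : b ≠ S.q (S.m + 1) := fun h' => h1 (h' ▸ hZq _ (by omega))
        have hb2 : b ≠ S.q (S.m + 2) := fun h' => h1 (h' ▸ hZq _ (by omega))
        have : H b = 3 := by
          rw [hHdef, if_neg hb2, if_neg hb1, if_pos rfl]
        omega
    · have hc : S.Crit j := by unfold Crit; omega
      have h1 := hHcrit j hj hc
      have h2 := hcritFr j hj hc b hb
      omega
  refine SimpleGraph.isAcyclic_of_height H fun x a b hxa hxb hHa hHb => ?_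
  have hxa := hR _ _ hxa
  have hxb := hR _ _ hxb
  by_cases hx : S.Z x
  · obtain ⟨j, hj, rfl⟩ := hx
    rcases hxa with hxa | hxa <;> rcases hxb with hxb | hxb
    · exact h.BR_unique hj hxa hxb
    · exact (hmixed j hj a b hxa hxb hHa hHb).elim
    · exact (hmixed j hj b a hxb hxa hHb hHa).elim
    -- Only the two ends of the path have two leaving edges, and these are critical.
    · by_cases hj' : 1 ≤ j ∧ j < S.M
      · exact h.leaving_unique hj'.1 hj'.2 hxa.1 hxb.1 hxa.2.1 hxb.2.1
      · have hc : S.Crit j := by unfold Crit; omega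
        have h1 := hHcrit j hj hc
        have h2 := hcritFr j hj hc b hxb
        omega
  · rw [h.red_off hx] at hxa hxb
    by_contra hab
    have hx2 : S.S2 x := ⟨hx, a, b, hab, hxa, hxb⟩
    have hxq : ∀ j ≤ S.M, x ≠ S.q j := fun j hj h' => hx (h' ▸ hZq j hj)
    have hm1 : x ≠ S.q (S.m + 1) := hxq _ (by omega)
    have hm2 : x ≠ S.q (S.m + 2) := hxq _ (by omega)
    have hq3 : H (S.q (S.m + 3)) = 0 :=
      hHnon _ (by omega) (by unfold Crit; omega) (by omega) (by omega)
    -- the Fr-neighbours of x are among any two given ones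
    have hpair : ∀ c d, c ≠ d → S.Fr x c → S.Fr x d → H x ≤ H c ∧ H x ≤ H d := by
      intro c d hcd hc hd
      have h1 := h.max_Fr x a b c hx hxa hxb hc
      have h2 := h.max_Fr x a b d hx hxa hxb hd
      have h3 := h.max_Fr x c d a hx hc hd hxa
      have : (c = a ∨ c = b) ∧ (d = a ∨ d = b) := by grind
      rcases this with ⟨rfl | rfl, rfl | rfl⟩ <;> exact ⟨by assumption, by assumption⟩
    have hErFr : ∀ c d, S.Er c d → S.Fr c d := fun c d hcd =>
      ⟨h.Er_adj _ _ hcd, fun h' => h.Er_off _ _ hcd (PE_left h'), Or.inr hcd⟩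
    by_cases hxu : x = u
    · rcases hloop with ⟨hu, -⟩ | ⟨h1, h2, h4, h5, h6⟩
      · exact hx (hxu ▸ hu)
      · have hHx : H x = 3 := by
          rw [hHdef, if_neg hm2, if_neg hm1, if_pos hxu]
        subst hxu
        have hf1 := h.Fr_Z hx (hZq _ (by omega)) h4 h.not_Flip_succ
        rcases h6 with ⟨rfl, rfl⟩ | ⟨-, h6, h7⟩
        · have hf2 := h.Fr_Z hx (hZq _ (by omega)) h5 h.not_Flip_add_three
          have := (hpair _ _ (hqne (S.m + 1) (by omega) (S.m + 3) (by omega) (by omega)) hf1 hf2).2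
          omega
        · have ht := h.Er_off' h6
          have hne : S.q (S.m + 1) ≠ t := fun h' => ht (h' ▸ hZq _ (by omega))
          have hne2 : S.q (S.m + 2) ≠ t := fun h' => ht (h' ▸ hZq _ (by omega))
          have := (hpair _ _ hne hf1 (hErFr _ _ h6)).2
          have hHt : H t = 2 := by
            rw [hHdef, if_neg hne2.symm, if_neg hne.symm, if_neg (h.Er_adj _ _ h6).ne.symm, if_pos rfl]
          omega
    by_cases hxt : x = t
    · rcases hloop with ⟨-, hu, -⟩ | ⟨h1, h2, h4, h5, ⟨h6, -⟩ | ⟨h6, h7, h8⟩⟩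
      · exact hx (hxt ▸ hu)
      · exact hxu (hxt.trans h6.symm)
      · have hHx : H x = 2 := by
          rw [hHdef, if_neg hm2, if_neg hm1, if_neg hxu, if_pos hxt]
        subst hxt
        have := (hpair _ _ h6 (hErFr _ _ (h.Er_symm _ _ h7)) (hErFr _ _ h8)).2
        have hHw : H w = 1 := by
          rw [hHdef, if_neg (fun h' : w = S.q (S.m + 2) => h2 (h' ▸ hZq _ (by omega))),
            if_neg (fun h' : w = S.q (S.m + 1) => h2 (h' ▸ hZq _ (by omega))), if_neg h6.symm,
            if_neg (h.Er_adj _ _ h8).ne.symm, if_pos rfl]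
        omega
    by_cases hxw : x = w
    · rcases hloop with ⟨-, -, hu, -⟩ | ⟨h1, h2, h4, h5, ⟨-, h6⟩ | ⟨h6, h7, h8⟩⟩
      · exact hx (hxw ▸ hu)
      · exact hxt (hxw.trans h6.symm)
      · have hHx : H x = 1 := by
          rw [hHdef, if_neg hm2, if_neg hm1, if_neg hxu, if_neg hxt, if_pos hxw]
        subst hxw
        have ht := h.Er_off' h7
        have hf2 := h.Fr_Z hx (hZq _ (by omega)) h5 h.not_Flip_add_three
        have hne : t ≠ S.q (S.m + 3) := fun h' => ht (h' ▸ hZq _ (by omega))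
        have := (hpair _ _ hne (hErFr _ _ (h.Er_symm _ _ h8)) hf2).2
        omega
    have hxC : ¬ C x := fun ⟨j, hj, _, h'⟩ => hxq j hj h'
    have hHx : H x = 6 := by
      rw [hHdef, if_neg hm2, if_neg hm1, if_neg hxu, if_neg hxt, if_neg hxw, if_neg hxC, if_pos hx2]
    -- An extra edge outside the loop has a leaf at one end. A leaf has only one red edge, so it
    -- cannot be x, and as a neighbour of x it is lower than x.
    have hhigh : ∀ c d, c ≠ d → S.Fr x c → S.Fr x d → H x ≤ H c → ∃ j ≤ S.M, S.Crit j ∧ c = S.q j := by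
      intro c d hcd hc hd hHc
      by_contra hcC
      by_cases hcZ : S.Z c
      · obtain ⟨k, hk, rfl⟩ := hcZ
        have hk' : ¬ S.Crit k := fun h' => hcC ⟨k, hk, h', rfl⟩
        by_cases hk1 : k = S.m + 1
        · subst hk1; omega
        by_cases hk2 : k = S.m + 2
        · subst hk2; omega
        have := hHnon k hk hk' hk1 hk2
        omega
      · have hEr1 : S.Er x c := by
          rcases hc.2.2 with h1 | h1
          · exact (h1.1.elim hx hcZ).elim
          · exact h1
        rcases hEr _ _ hEr1 with h1 | h1 | h1
        · exact hcd (h1.1 d hd).symm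
        · have : ¬ S.S2 c := by
            rintro ⟨-, e, f, hef, he, hf⟩
            exact hef ((h1.1 e he).trans (h1.1 f hf).symm)
          have := hHoff c hcZ this
          omega
        · tauto
    obtain ⟨i, hi, hci, rfl⟩ := hhigh a b hab hxa hxb hHa
    obtain ⟨j, hj, hcj, rfl⟩ := hhigh b _ (Ne.symm hab) hxb hxa hHb
    have hFi := h.not_Flip_of_Fr (h.Fr_symm hxa)
    have hFj := h.not_Flip_of_Fr (h.Fr_symm hxb)
    rcases lt_trichotomy i j with h1 | rfl | h1
    · rcases h.flip_of_common hci hcj h1 hx hxa.1 hxb.1 with h2 | h2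
      · exact hFi h2
      · exact hFj h2
    · exact hab rfl
    · rcases h.flip_of_common hcj hci h1 hx hxb.1 hxa.1 with h2 | h2
      · exact hFj h2
      · exact hFi h2

theorem red_acyclic (R : SimpleGraph V) (hR : ∀ a b, R.Adj a b → S.Red a b) : R.IsAcyclic := by
  have hroom := h.room
  have hpos := h.pos
  have h3 := h.three_le
  have hZ : S.Z (S.q (S.m + 1)) := ⟨_, by omega, rfl⟩
  rcases h.kind with ⟨-, hE, hadj⟩ | ⟨-, u, t, w, hL, hE⟩ | ⟨hE, u, w, hL⟩
  · refine h.red_acyclic_aux R hR (S.q (S.m + 1)) (S.q (S.m + 1)) (S.q (S.m + 1))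
      (fun a b hab => (hE a b hab).imp id Or.inl) (Or.inl ⟨hZ, hZ, hZ, rfl, rfl, rfl, ?_⟩)
    intro a ha
    have hPE : ¬ S.PE (S.q (S.m + 1)) (S.q (S.m + 3)) := by
      intro h'
      obtain ⟨k, hk, hk', he⟩ := (h.PE_iff (by omega) _).1 h'
      have := h.inj _ (by omega) _ hk he
      omega
    have : a = S.q (S.m + 3) := h.leaving_unique (j := S.m + 1) (by omega) (by omega) ha.1 hadj
      ha.2.1 hPE
    subst this
    refine ⟨fun h' => h'.1 ⟨_, by omega, rfl⟩, fun j hj hc h' => ?_⟩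
    have := h.inj _ (by omega) _ hj h'
    unfold Crit at hc
    omega
  · exact h.red_acyclic_aux R hR u t w (fun a b hab => hE a b hab) (Or.inr hL)
  · refine h.red_acyclic_aux R hR (S.q (S.m + 1)) (S.q (S.m + 1)) (S.q (S.m + 1))
      (fun a b hab => (hE a b hab).imp id Or.inl) (Or.inl ⟨hZ, hZ, hZ, rfl, rfl, rfl, ?_⟩)
    intro a ha
    have : a = u := h.leaving_unique (j := S.m + 1) (by omega) (by omega) ha.1 hL.adj_u.symm
      ha.2.1 (fun h' => hL.not_Z_u (PE_right h'))
    subst this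
    refine ⟨?_, fun j hj _ h' => hL.not_Z_u ⟨j, hj, h'.symm⟩⟩
    rintro ⟨-, c, d, hcd, hc, hd⟩
    exact hcd ((hL.Fr_u c hc).trans (hL.Fr_u d hd).symm)

end Valid

end ColourScheme

/-! ### Acyclicity of the blue graph, connectedness and distances -/

namespace ColourScheme

variable {V : Type*} {S : ColourScheme V}

namespace Valid

variable (h : S.Valid)
include h

open Classical in
theorem exists_index : ∃ f : V → ℕ, ∀ j ≤ S.M, f (S.q j) = j := by
  refine ⟨fun x => if hx : ∃ j ≤ S.M, S.q j = x then hx.choose else 0, fun j hj => ?_⟩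
  have hx : ∃ k ≤ S.M, S.q k = S.q j := ⟨j, hj, rfl⟩
  dsimp only
  rw [dif_pos hx]
  exact h.inj _ hx.choose_spec.1 _ hj hx.choose_spec.2

/-- Blue edges between path vertices are edges of the path. -/
theorem PE_of_blue {a b : V} (ha : S.Z a) (hb : S.Z b) (hab : S.Blue a b) : S.PE a b := by
  rcases hab with h1 | ⟨h1, h2, h3 | h3⟩ | h1
  · exact h1.1
  · exact ((h.Flip_leaving h3 h1 h2).1 hb).elim
  · exact ((h.Flip_leaving h3 h1.symm (fun h' => h2 (PE_symm h'))).1 ha).elim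
  · exact (h1.2.1 ha).elim

/-- A vertex with two red edges off the path has at most one blue edge. -/
theorem blue_S2 {x a b : V} (hx : S.S2 x) (ha : S.Blue x a) (hb : S.Blue x b) : a = b := by
  obtain ⟨-, c, d, hcd, hc, hd⟩ := hx
  by_contra hab
  have hne : ∀ e f, S.Fr x e → S.Blue x f → e ≠ f := by
    rintro e f he hf rfl
    exact h.red_blue_false (Or.inr he) hf
  rcases RedBlueGraph.eq_of_encard_neighborSet_le (h.degree_le x) hc.1 hd.1 (h.blue_adj ha)
    (h.blue_adj hb) hcd (hne _ _ hc ha) (hne _ _ hd ha) with h1 | h1 | h1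
  · exact hne _ _ hc hb h1.symm
  · exact hne _ _ hd hb h1.symm
  · exact hab h1.symm

theorem flip_unique {x a b : V} (hx : ¬ S.Z x) (ha : S.Flip a) (hb : S.Flip b)
    (hxa : S.G.Adj x a) (hxb : S.G.Adj x b) : a = b := by
  have := h.room
  have := h.pos
  obtain ⟨i, -, hiM, rfl, hi⟩ := h.Flip_index ha
  obtain ⟨j, -, hjM, rfl, hj⟩ := h.Flip_index hb
  have hci : S.Crit i := by unfold Crit; omega
  have hcj : S.Crit j := by unfold Crit; omega
  rcases lt_trichotomy i j with h1 | rfl | h1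
  · have := h.gap i j x hci hcj h1 hx hxa hxb; omega
  · rfl
  · have := h.gap j i x hcj hci h1 hx hxb hxa; omega

-- Heights grow along the path and exceed those off it, so from a path vertex only its successor is
-- at least as high. Vertices with two red edges off the path have at most one blue edge and get 0.
-- The lane vertex u, the common neighbour and w get 1, 2, 3, and all other neighbours of the lane
-- get 0; by `lane_clean` the blue edges of these neighbours lead back to the lane unless they have
-- two red edges. The remaining vertices get 5, so that only flipped vertices are at least as high
-- among their blue neighbours, and two flipped vertices have no common neighbour off the path.
open Classical in
theorem blue_acyclic (B : SimpleGraph V) (hB : ∀ a b, B.Adj a b → S.Blue a b) : B.IsAcyclic := by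
  obtain ⟨f, hf⟩ := h.exists_index
  obtain ⟨u, w, hL⟩ : ∃ u w, S.U0 = ∅ ∨ S.Lane u w := by
    rcases h.kind with ⟨h1, -⟩ | ⟨h1, -⟩ | ⟨-, u, w, h1⟩
    · exact ⟨S.q 0, S.q 0, Or.inl h1⟩
    · exact ⟨S.q 0, S.q 0, Or.inl h1⟩
    · exact ⟨u, w, Or.inr h1⟩
  have hLane : ∀ x, x ∈ S.U0 → S.Lane u w := by
    intro x hx
    rcases hL with h1 | h1
    · rw [h1] at hx; exact hx.elim
    · exact h1
  set H : V → ℕ := fun x => if S.Z x then 10 + f x else if S.S2 x then 0 else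
    if x ∈ S.U0 then (if x = u then 1 else 3) else
    if ∃ a ∈ S.U0, ∃ b ∈ S.U0, a ≠ b ∧ S.G.Adj x a ∧ S.G.Adj x b then 2 else
    if ∃ a ∈ S.U0, S.G.Adj x a then 0 else 5 with hH
  have hHdef : ∀ x, H x = if S.Z x then 10 + f x else if S.S2 x then 0 else
    if x ∈ S.U0 then (if x = u then 1 else 3) else
    if ∃ a ∈ S.U0, ∃ b ∈ S.U0, a ≠ b ∧ S.G.Adj x a ∧ S.G.Adj x b then 2 else
    if ∃ a ∈ S.U0, S.G.Adj x a then 0 else 5 := fun x => rfl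
  have hHZ : ∀ j ≤ S.M, H (S.q j) = 10 + j := by
    intro j hj
    rw [hHdef, if_pos ⟨j, hj, rfl⟩, hf j hj]
  have hHoff : ∀ x, ¬ S.Z x → H x ≤ 5 := by
    intro x hx
    rw [hHdef, if_neg hx]
    split_ifs <;> omega
  have hS2U : ∀ x ∈ S.U0, ¬ S.S2 x := by
    rintro x hx ⟨-, a, b, hab, ha, hb⟩
    obtain ⟨j, -, -, hj⟩ := h.Fr_U0 hx
    exact hab ((hj a ha).trans (hj b hb).symm)
  have hHu : u ∈ S.U0 → H u = 1 := by
    intro hu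
    rw [hHdef, if_neg (h.Sat_off (Or.inl hu)), if_neg (hS2U u hu), if_pos hu, if_pos rfl]
  have hHw : ∀ x ∈ S.U0, x ≠ u → H x = 3 := by
    intro x hx hxu
    rw [hHdef, if_neg (h.Sat_off (Or.inl hx)), if_neg (hS2U x hx), if_pos hx, if_neg hxu]
  refine SimpleGraph.isAcyclic_of_height H fun x a b hxa hxb hHa hHb => ?_
  have hxa := hB _ _ hxa
  have hxb := hB _ _ hxb
  by_cases hx : S.Z x
  · obtain ⟨j, hj, rfl⟩ := hx
    rw [hHZ j hj] at hHa hHb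
    have key : ∀ c, S.Blue (S.q j) c → 10 + j ≤ H c → c = S.q (j + 1) := by
      intro c hc hHc
      have hcZ : S.Z c := by
        by_contra hcZ
        have := hHoff c hcZ
        omega
      have hPE := h.PE_of_blue ⟨j, hj, rfl⟩ hcZ hc
      obtain ⟨k, hk, hk', rfl⟩ := (h.PE_iff hj _).1 hPE
      rw [hHZ k hk] at hHc
      have : k = j + 1 := by omega
      rw [this]
    rw [key a hxa hHa, key b hxb hHb]
  by_cases hx2 : S.S2 x
  · exact h.blue_S2 hx2 hxa hxb
  by_cases hxU : x ∈ S.U0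
  · have hL := hLane x hxU
    have hset := hL.set
    have huU : u ∈ S.U0 := by rw [hset]; exact Or.inl rfl
    have hwU : w ∈ S.U0 := by rw [hset]; exact Or.inr rfl
    have hadj : ∀ c, S.G.Adj x c → S.G.Adj u c ∨ S.G.Adj w c := by
      intro c hc
      rw [hset] at hxU
      rcases hxU with rfl | rfl
      · exact Or.inl hc
      · exact Or.inr hc
    have hcZ : ∀ c, S.Blue x c → ¬ S.Z c := by
      intro c hc
      rcases h.blue_off hx hc with h1 | h1
      · exact (h.lane_not_flip hL c (hadj c (h.blue_adj hc)) h1.2).elim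
      · exact h1.1
    have key : ∀ c, S.Blue x c → 1 ≤ H c → c ∈ S.U0 ∨ (c ∉ S.U0 ∧ H c = 2 ∧
        ∃ a ∈ S.U0, ∃ b ∈ S.U0, a ≠ b ∧ S.G.Adj c a ∧ S.G.Adj c b) := by
      intro c hc hHc
      by_contra hcon
      push Not at hcon
      have h0 : H c = if ∃ a ∈ S.U0, ∃ b ∈ S.U0, a ≠ b ∧ S.G.Adj c a ∧ S.G.Adj c b then 2 else 0 := by
        rw [hHdef, if_neg (hcZ c hc), if_neg hcon.1, if_pos (⟨x, hxU, (h.blue_adj hc).symm⟩ :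
          ∃ a ∈ S.U0, S.G.Adj c a)]
        by_cases hc2 : S.S2 c
        · exfalso
          rw [hHdef, if_neg (hcZ c hc), if_pos hc2] at hHc
          omega
        · rw [if_neg hc2]
      split_ifs at h0 with h1
      · obtain ⟨a, ha, b, hb, hab, h2, h3⟩ := h1
        exact hcon.2 hcon.1 h0 a ha b hb hab h2 h3
      · omega
    by_cases hxu : x = u
    · subst hxu
      rw [hHu hxU] at hHa hHb
      have hcommon : ∀ c, (∃ a ∈ S.U0, ∃ b ∈ S.U0, a ≠ b ∧ S.G.Adj c a ∧ S.G.Adj c b) →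
          S.G.Adj x c ∧ S.G.Adj w c := by
        rintro c ⟨a, ha, b, hb, hab, h1, h2⟩
        rw [hset] at ha hb
        rcases ha with rfl | rfl <;> rcases hb with rfl | rfl
        · exact (hab rfl).elim
        · exact ⟨h1.symm, h2.symm⟩
        · exact ⟨h2.symm, h1.symm⟩
        · exact (hab rfl).elim
      have hmemw : ∀ c, S.Blue x c → c ∈ S.U0 → c = w := by
        intro c hc hcU
        rw [hset] at hcU
        rcases hcU with rfl | rfl
        · exact ((h.blue_adj hc).ne rfl).elim
        · rfl
      rcases key a hxa hHa with h1 | ⟨-, -, h1⟩ <;> rcases key b hxb hHb with h2 | ⟨-, -, h2⟩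
      · rw [hmemw a hxa h1, hmemw b hxb h2]
      · have h3 := hmemw a hxa h1
        subst h3
        have h4 := hcommon b h2
        exact (hL.not_adj (h.blue_adj hxa) b (hcZ b hxb) h4.1 h4.2).elim
      · have h3 := hmemw b hxb h2
        subst h3
        have h4 := hcommon a h1
        exact (hL.not_adj (h.blue_adj hxb) a (hcZ a hxa) h4.1 h4.2).elim
      · have h3 := hcommon a h1
        have h4 := hcommon b h2
        exact hL.common a b (hcZ a hxa) (hcZ b hxb) h3.1 h3.2 h4.1 h4.2
    · have hHx := hHw x hxU hxu
      rcases key a hxa (by omega) with h1 | ⟨-, h1, -⟩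
      · rw [hset] at h1
        rcases h1 with rfl | rfl
        · rw [hHu huU] at hHa; omega
        · rw [hset] at hxU
          rcases hxU with rfl | rfl
          · exact (hxu rfl).elim
          · exact ((h.blue_adj hxa).ne rfl).elim
      · omega
  have hSat : ¬ S.Sat x := fun h' => h'.elim hxU hx2
  have hcol : ∀ c, S.Blue x c → S.Flip c ∨ S.Sat c := by
    intro c hc
    rcases h.blue_off hx hc with h1 | ⟨-, -, h1⟩
    · exact Or.inl h1.2
    · exact Or.inr (h1.resolve_left hSat)
  by_cases hxU1 : ∃ c ∈ S.U0, S.G.Adj x c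
  · obtain ⟨c₀, hc₀, hxc₀⟩ := hxU1
    have hL := hLane c₀ hc₀
    have hset := hL.set
    have hadj : S.G.Adj u x ∨ S.G.Adj w x := by
      rw [hset] at hc₀
      rcases hc₀ with rfl | rfl
      · exact Or.inl hxc₀.symm
      · exact Or.inr hxc₀.symm
    have hU : ∀ c, S.Blue x c → c ∈ S.U0 := by
      intro c hc
      have h1 := h.lane_clean hL x c hadj hx (h.blue_adj hc)
      rcases hcol c hc with h2 | h2 | h2
      · exact (h1.2 h2).elim
      · exact h2
      · exact (h1.1 h2).elim
    have haU := hU a hxa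
    have hbU := hU b hxb
    by_contra hab
    have h2 : H x = 2 := by
      rw [hHdef, if_neg hx, if_neg hx2, if_neg hxU,
        if_pos ⟨a, haU, b, hbU, hab, h.blue_adj hxa, h.blue_adj hxb⟩]
    by_cases hau : a = u
    · subst hau; rw [hHu haU] at hHa; omega
    · have hbu : b = u := by
        rw [hset] at haU hbU
        rcases hbU with rfl | rfl
        · rfl
        · rcases haU with rfl | rfl
          · exact (hau rfl).elim
          · exact (hab rfl).elim
      subst hbu; rw [hHu hbU] at hHb; omega
  · have hHx : H x = 5 := by
      rw [hHdef, if_neg hx, if_neg hx2, if_neg hxU, if_neg, if_neg hxU1]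
      rintro ⟨c, hc, -, -, -, h1, -⟩
      exact hxU1 ⟨c, hc, h1⟩
    have hF : ∀ c, S.Blue x c → H x ≤ H c → S.Flip c := by
      intro c hc hHc
      rcases hcol c hc with h1 | h1 | h1
      · exact h1
      · exact (hxU1 ⟨c, h1, h.blue_adj hc⟩).elim
      · rw [hHdef c, if_neg h1.1, if_pos h1] at hHc
        omega
    exact h.flip_unique hx (hF a hxa hHa) (hF b hxb hHb) (h.blue_adj hxa) (h.blue_adj hxb)

/-- The partial colouring given by a scheme. -/
def colouring : RedBlueGraph V where
  red := ⟨S.Red, ⟨fun _ _ hab => h.red_symm hab⟩, ⟨fun _ ha => (h.red_adj ha).ne rfl⟩⟩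
  blue := ⟨S.Blue, ⟨fun _ _ hab => h.blue_symm hab⟩, ⟨fun _ ha => (h.blue_adj ha).ne rfl⟩⟩
  disj := by
    rw [SimpleGraph.disjoint_left]
    exact fun a b h1 h2 => h.red_blue_false h1 h2

theorem colouring_adj {a b : V} : h.colouring.graph.Adj a b ↔ S.Red a b ∨ S.Blue a b := Iff.rfl

theorem reach_Z {x : V} (hx : S.Z x) : h.colouring.graph.Reachable (S.q 0) x := by
  obtain ⟨j, hj, rfl⟩ := hx
  induction j with
  | zero => exact SimpleGraph.Reachable.refl _
  | succ n ih =>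
    refine (ih (by omega)).trans (SimpleGraph.Adj.reachable ?_)
    rw [h.colouring_adj]
    exact h.full_Z ⟨n, by omega, rfl⟩ (h.path n hj)

theorem reach_adj_Z {x z : V} (hz : S.Z z) (hxz : S.G.Adj x z) :
    h.colouring.graph.Reachable (S.q 0) x :=
  (h.reach_Z hz).trans (SimpleGraph.Adj.reachable (h.colouring_adj.2 (h.full_Z hz hxz.symm)))

theorem reach_of_Er {a b : V} (hab : S.Er a b) : h.colouring.graph.Reachable (S.q 0) a := by
  obtain ⟨s, ⟨z, hz, hsz⟩, h1⟩ := h.reach_Er a b hab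
  have hs0 := h.reach_adj_Z hz hsz
  have hedge : h.colouring.graph.Adj b a := by
    rw [h.colouring_adj]
    have hE := h.Er_symm _ _ hab
    exact Or.inl (Or.inr ⟨h.Er_adj _ _ hE, fun h' => h.Er_off _ _ hE (PE_left h'), Or.inr hE⟩)
  rcases h1 with rfl | rfl | ⟨hS, h1 | h1⟩
  · exact hs0
  · exact hs0.trans hedge.reachable
  · exact hs0.trans (SimpleGraph.Adj.reachable (h.colouring_adj.2 (h.full_Sat hS h1)))
  · exact (hs0.trans (SimpleGraph.Adj.reachable (h.colouring_adj.2 (h.full_Sat hS h1)))).trans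
      hedge.reachable

theorem reach_Sat {x : V} (hx : S.Sat x) : h.colouring.graph.Reachable (S.q 0) x := by
  rcases hx with hx | hx
  · obtain ⟨j, hj, hF, -⟩ := h.Fr_U0 hx
    have := h.room
    exact h.reach_adj_Z ⟨j, by omega, rfl⟩ hF.1
  · obtain ⟨hx, a, -, -, ha, -⟩ := hx
    rcases ha.2.2 with h1 | h1
    · exact h.reach_adj_Z (h1.1.resolve_left hx) ha.1
    · exact h.reach_of_Er h1

/-- The possible origins of a coloured edge. -/
theorem edge_cases {x y : V} (hxy : S.Red x y ∨ S.Blue x y) :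
    S.Z x ∨ S.Z y ∨ S.Er x y ∨ S.Sat x ∨ S.Sat y := by
  rcases hxy with (h1 | h1) | (h1 | h1 | h1)
  · exact Or.inl (PE_left (PE_of_BR h1))
  · rcases h1.2.2 with h2 | h2
    · tauto
    · tauto
  · exact Or.inl (PE_left h1.1)
  · rcases h1.2.2 with h2 | h2
    · exact Or.inl (h.Flip_Z h2)
    · exact Or.inr (Or.inl (h.Flip_Z h2))
  · tauto

theorem reach_support {x : V} (hx : x ∈ h.colouring.graph.support) :
    h.colouring.graph.Reachable (S.q 0) x := by
  obtain ⟨y, hxy⟩ := hx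
  rcases h.edge_cases (h.colouring_adj.1 hxy) with h1 | h1 | h1 | h1 | h1
  · exact h.reach_Z h1
  · exact (h.reach_Z h1).trans hxy.symm.reachable
  · exact h.reach_of_Er h1
  · exact h.reach_Sat h1
  · exact (h.reach_Sat h1).trans hxy.symm.reachable

theorem near_adj {d : ℕ} {x y : V} (hx : S.Near d x) (hxy : S.G.Adj y x) : S.Near (d + 1) y := by
  obtain ⟨w, hw, hd⟩ := hx
  refine ⟨w, hw, ?_⟩
  calc S.G.edist y w ≤ S.G.edist y x + S.G.edist x w := SimpleGraph.edist_triangle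
    _ ≤ 1 + d := add_le_add (SimpleGraph.edist_eq_one_iff_adj.2 hxy).le hd
    _ = ((d + 1 : ℕ) : ℕ∞) := by rw [add_comm]; push_cast; rfl

theorem near_mono {d e : ℕ} (hde : d ≤ e) {x : V} (hx : S.Near d x) : S.Near e x := by
  obtain ⟨w, hw, hd⟩ := hx
  exact ⟨w, hw, hd.trans (by exact_mod_cast hde)⟩

theorem near_support {x : V} (hx : x ∈ h.colouring.graph.support) : S.Near 4 x := by
  obtain ⟨y, hxy⟩ := hx
  have hG : S.G.Adj x y := (h.colouring_adj.1 hxy).elim h.red_adj h.blue_adj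
  rcases h.edge_cases (h.colouring_adj.1 hxy) with h1 | h1 | h1 | h1 | h1
  · exact h.near_mono (by norm_num) (h.near_Z x h1)
  · exact h.near_mono (by norm_num) (h.near_adj (h.near_Z y h1) hG)
  · exact h.near_Er _ _ h1
  · exact h.near_mono (by norm_num) (h.near_Sat x h1)
  · exact h.near_adj (h.near_Sat y h1) hG

/-- `z` is a vertex which blocks two-coloured cycles: all its edges are coloured, and only one of
them is red. -/
theorem red_end_Z {j : ℕ} (hj1 : 1 ≤ j) (hjM : j < S.M)
    (hj : S.Flip (S.q j) ∨ ¬ (S.Crit j ∨ j = S.m + 1 ∨ j = S.m + 2)) {a b : V}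
    (ha : S.Red (S.q j) a) (hb : S.Red (S.q j) b) : a = b := by
  by_cases hF : S.Flip (S.q j)
  · have key : ∀ c, S.Red (S.q j) c → S.BR (S.q j) c := fun c hc =>
      hc.resolve_right fun h' => h.not_Flip_of_Fr h' hF
    exact h.BR_unique hjM.le (key a ha) (key b hb)
  · have hj := hj.resolve_left hF
    have hno : ∀ c, ¬ S.BR (S.q j) c := by
      intro c hc
      obtain ⟨k, hk, hk', rfl⟩ := (h.BR_iff hjM.le _).1 hc
      apply hj
      unfold Crit
      omega
    have ha := ha.resolve_left (hno a)
    have hb := hb.resolve_left (hno b)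
    exact h.leaving_unique hj1 hjM ha.1 hb.1 ha.2.1 hb.2.1

end Valid

end ColourScheme

/-! ### Anchors and the colouring of a valid scheme -/

namespace ColourScheme

variable {V : Type u} {S : ColourScheme V}

namespace Valid

variable (h : S.Valid)
include h

/-- The blue edge xb leads to a flipped vertex, to a vertex with two red edges, or into `U0`. In the
first case the flipped vertex is a red end reached from x, in the second b is a blue end. In the
third the red edge xa is followed: an extra edge leads to a leaf, q (m+1) and q (m+2) lead to u, and
every other non-critical path vertex is itself a red end. Only a critical a remains. -/
theorem anchored_or {x y a b : V} (hxy : S.G.Adj x y) (hunc : ¬ h.colouring.graph.Adj x y)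
    (ha : S.Red x a) (hb : S.Blue x b) :
    ((∃ z, h.colouring.red.Reachable x z ∧ (∀ c, S.G.Adj z c → h.colouring.graph.Adj z c) ∧
        ∀ c d, h.colouring.red.Adj z c → h.colouring.red.Adj z d → c = d) ∨
      (∃ z, h.colouring.blue.Reachable x z ∧ (∀ c, S.G.Adj z c → h.colouring.graph.Adj z c) ∧
        ∀ c d, h.colouring.blue.Adj z c → h.colouring.blue.Adj z d → c = d)) ∨
    (¬ S.Z x ∧ x ∉ S.U0 ∧ b ∈ S.U0 ∧ ∃ j ≤ S.M, S.Crit j ∧ a = S.q j) := by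
  have hroom := h.room
  have hx : ¬ S.Z x := fun h' => hunc (h.full_Z h' hxy)
  have hS : ¬ S.Sat x := fun h' => hunc (h.full_Sat h' hxy)
  have hredadj : ∀ c d, S.Red c d → h.colouring.red.Reachable c d := fun c d hcd =>
    SimpleGraph.Adj.reachable (G := h.colouring.red) hcd
  rcases h.blue_off hx hb with ⟨-, h1⟩ | ⟨-, -, h1⟩
  · obtain ⟨j, -, hj, hj'⟩ := h.Fr_of_flip hx h1 (h.blue_adj hb)
    obtain ⟨k, hk1, hkM, rfl, -⟩ := h.Flip_index h1
    refine Or.inl (Or.inl ⟨S.q k, (hredadj _ _ (Or.inr hj)).trans (hredadj _ _ hj'),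
      fun c hc => h.full_Z ⟨k, hkM.le, rfl⟩ hc, fun c d hc hd => ?_⟩)
    exact h.red_end_Z hk1 hkM (Or.inl h1) hc hd
  rcases h1.resolve_left hS with hbU | hb2
  swap
  · exact Or.inl (Or.inr ⟨b, SimpleGraph.Adj.reachable (G := h.colouring.blue) hb,
      fun c hc => h.full_Sat (Or.inr hb2) hc, fun c d hc hd => h.blue_S2 hb2 hc hd⟩)
  obtain ⟨u, w, hL⟩ := h.exists_lane hbU
  have huU : u ∈ S.U0 := by rw [hL.set]; exact Or.inl rfl
  have hFa := (h.red_off hx).1 ha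
  have hu : ∀ z, h.colouring.red.Reachable z (S.q (S.m + 1)) →
      ∃ z', h.colouring.red.Reachable z z' ∧ (∀ c, S.G.Adj z' c → h.colouring.graph.Adj z' c) ∧
        ∀ c d, h.colouring.red.Adj z' c → h.colouring.red.Adj z' d → c = d := by
    intro z hz
    have h1 := h.Fr_Z hL.not_Z_u ⟨S.m + 1, by omega, rfl⟩ hL.adj_u h.not_Flip_succ
    refine ⟨u, hz.trans (hredadj _ _ (Or.inr (h.Fr_symm h1))),
      fun c hc => h.full_Sat (Or.inl huU) hc, fun c d hc hd => ?_⟩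
    rw [hL.Fr_u c ((h.red_off hL.not_Z_u).1 hc), hL.Fr_u d ((h.red_off hL.not_Z_u).1 hd)]
  by_cases haZ : S.Z a
  · obtain ⟨j, hj, rfl⟩ := haZ
    by_cases hc : S.Crit j
    · exact Or.inr ⟨hx, fun h' => hS (Or.inl h'), hbU, j, hj, hc, rfl⟩
    by_cases hj1 : j = S.m + 1
    · subst hj1
      exact Or.inl (Or.inl (hu x (hredadj _ _ ha)))
    by_cases hj2 : j = S.m + 2
    · subst hj2
      refine Or.inl (Or.inl (hu x ((hredadj _ _ ha).trans (hredadj _ _ (Or.inl ?_)))))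
      rw [h.BR_iff (by omega)]
      exact ⟨S.m + 1, by omega, by omega, rfl⟩
    · have hj0 : 1 ≤ j ∧ j < S.M := by unfold Crit at hc; omega
      refine Or.inl (Or.inl ⟨S.q j, hredadj _ _ ha, fun c hc => h.full_Z ⟨j, hj, rfl⟩ hc,
        fun c d hc' hd' => ?_⟩)
      exact h.red_end_Z hj0.1 hj0.2 (Or.inr (by tauto)) hc' hd'
  · have hEr : S.Er x a := by
      rcases hFa.2.2 with h2 | h2
      · exact (h2.1.elim hx haZ).elim
      · exact h2
    have hleaf : S.Leaf x a ∨ S.Leaf a x := by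
      rcases h.kind with ⟨h2, -⟩ | ⟨h2, -⟩ | ⟨h2, -⟩
      · rw [h2] at hbU; exact hbU.elim
      · rw [h2] at hbU; exact hbU.elim
      · exact h2 _ _ hEr
    rcases hleaf with h2 | h2
    · exact (hunc (h.full_Leaf hEr h2 hxy)).elim
    · refine Or.inl (Or.inl ⟨a, hredadj _ _ ha,
        fun c hc => h.full_Leaf (h.Er_symm _ _ hEr) h2 hc, fun c d hc hd => ?_⟩)
      rw [h2.1 c ((h.red_off haZ).1 hc), h2.1 d ((h.red_off haZ).1 hd)]

/-- The roles are v = q m, y = q (m+1), x₀ = q (m+2), x₁ = q (m+3). The three red path edges cut out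
the blue parts, and leaving edges supply the other red edges. Larger colour classes are allowed
because the completion adds edges. -/
theorem frame {R B : SimpleGraph V} (hR : h.colouring.red ≤ R) (hB : h.colouring.blue ≤ B) :
    IsGadgetFrame R B S.ℓ (fun i => S.q (S.m + 2 + i)) (S.q (S.m + 1)) (S.q S.m) := by
  have hroom := h.room
  have hpos := h.pos
  have h3 := h.three_le
  have hR' : ∀ a b, S.Red a b → R.Adj a b := fun a b hab => hR hab
  have hB' : ∀ a b, S.Blue a b → B.Adj a b := fun a b hab => hB hab
  have hZ : ∀ j ≤ S.M, S.Z (S.q j) := fun j hj => ⟨j, hj, rfl⟩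
  have hpath : ∀ j, j < S.M → j + 1 ≠ S.m → j ≠ S.m + 1 → j ≠ S.m + S.ℓ + 2 →
      S.Blue (S.q j) (S.q (j + 1)) := by
    intro j hj h1 h2 h4
    refine Or.inl ⟨h.PE_succ hj, fun h' => ?_⟩
    obtain ⟨k, hk, hk', he⟩ := (h.BR_iff hj.le _).1 h'
    have := h.inj _ hj _ hk he
    omega
  have hlv : ∀ j, 1 ≤ j → j < S.M → ¬ S.Flip (S.q j) → ∃ a, S.Red (S.q j) a ∧
      ¬ S.PE (S.q j) a := by
    intro j hj hjM hF
    obtain ⟨a, ha, ha'⟩ := h.exists_leaving hj hjM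
    exact ⟨a, Or.inr (h.Fr_of_leaving hjM.le hF ha ha'), ha'⟩
  have hnf : ∀ j, S.m ≤ j → j ≤ S.m + S.ℓ + 2 → ¬ S.Flip (S.q j) := fun j h1 h2 =>
    h.not_Flip_of_not_crit (by omega) (by omega) (by omega)
  have h12 : S.BR (S.q (S.m + 2)) (S.q (S.m + 1)) :=
    (h.BR_iff (by omega) _).2 ⟨S.m + 1, by omega, by omega, rfl⟩
  constructor
  · intro i hi j hj hij
    have := h.inj _ (by omega) _ (by omega) hij
    omega
  · intro i hi
    exact hB' _ _ (hpath (S.m + 2 + i) (by omega) (by omega) (by omega) (by omega))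
  · exact hR' _ _ (Or.inl h12)
  · obtain ⟨a, ha, ha'⟩ := hlv (S.m + 2) (by omega) (by omega) (hnf _ (by omega) (by omega))
    exact ⟨a, fun h' => ha' (h' ▸ PE_of_BR h12), hR' _ _ ha⟩
  · exact hB' _ _ (h.blue_symm (hpath S.m (by omega) (by omega) (by omega) (by omega)))
  · obtain ⟨a, ha, ha'⟩ := hlv S.m (by omega) (by omega) (hnf _ (by omega) (by omega))
    have hbr : S.BR (S.q S.m) (S.q (S.m - 1)) :=
      (h.BR_iff (by omega) _).2 ⟨S.m - 1, by omega, by omega, rfl⟩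
    exact ⟨a, _, fun h' => ha' (h' ▸ PE_of_BR hbr), hR' _ _ ha, hR' _ _ (Or.inl hbr)⟩
  · obtain ⟨a, ha, ha'⟩ := hlv (S.m + 2 + S.ℓ) (by omega) (by omega) (hnf _ (by omega) (by omega))
    have hbr : S.BR (S.q (S.m + 2 + S.ℓ)) (S.q (S.m + S.ℓ + 3)) :=
      (h.BR_iff (by omega) _).2 ⟨S.m + S.ℓ + 3, by omega, by omega, rfl⟩
    exact ⟨a, _, fun h' => ha' (h' ▸ PE_of_BR hbr), hR' _ _ ha, hR' _ _ (Or.inl hbr)⟩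
  · have hErR : ∀ a b, S.Er a b → R.Adj a b := fun a b hab => hR' _ _ (Or.inr
      ⟨h.Er_adj _ _ hab, fun h' => h.Er_off _ _ hab (PE_left h'), Or.inr hab⟩)
    have hoff : ∀ u, ¬ S.Z u → S.G.Adj u (S.q (S.m + 1)) → R.Adj (S.q (S.m + 1)) u :=
      fun u hu hadj => hR' _ _ (Or.inr (h.Fr_symm (h.Fr_Z hu (hZ _ (by omega)) hadj
        h.not_Flip_succ)))
    have hoff3 : ∀ u, ¬ S.Z u → S.G.Adj u (S.q (S.m + 3)) → R.Adj (S.q (S.m + 3)) u :=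
      fun u hu hadj => hR' _ _ (Or.inr (h.Fr_symm (h.Fr_Z hu (hZ _ (by omega)) hadj
        h.not_Flip_add_three)))
    have hne : ∀ u j, j ≤ S.M → ¬ S.Z u → u ≠ S.q j := fun u j hj hu h' => hu (h' ▸ hZ j hj)
    rcases h.kind with ⟨-, -, hadj⟩ | ⟨-, u, t, w, hL, -⟩ | ⟨-, u, w, hL⟩
    · have hPE : ¬ S.PE (S.q (S.m + 1)) (S.q (S.m + 3)) := by
        intro h'
        obtain ⟨k, hk, hk', he⟩ := (h.PE_iff (by omega) _).1 h'
        have := h.inj _ (by omega) _ hk he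
        omega
      have hred := hR' _ _ (Or.inr (h.Fr_of_leaving (by omega) h.not_Flip_succ hadj hPE))
      refine ⟨S.q (S.m + 3), S.q (S.m + 1), hred, fun h' => ?_, hred.symm, Or.inl rfl⟩
      have := h.inj _ (by omega) _ (by omega) h'
      omega
    · obtain ⟨hu, hw, h1, h2, h4⟩ := hL
      refine ⟨u, w, hoff u hu h1, hne _ _ (by omega) hu, hoff3 w hw h2, ?_⟩
      rcases h4 with ⟨rfl, rfl⟩ | ⟨h4, h5, h6⟩
      · exact Or.inr (Or.inl rfl)
      · have ht := h.Er_off' h5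
        exact Or.inr (Or.inr ⟨h4, Or.inl ⟨t, hne _ _ (by omega) ht, hne _ _ (by omega) ht,
          hErR _ _ h5, hErR _ _ h6⟩⟩)
    · have huU : u ∈ S.U0 := by rw [hL.set]; exact Or.inl rfl
      have hwU : w ∈ S.U0 := by rw [hL.set]; exact Or.inr rfl
      refine ⟨u, w, hoff u hL.not_Z_u hL.adj_u, hne _ _ (by omega) hL.not_Z_u,
        hoff3 w hL.not_Z_w hL.adj_w, Or.inr (Or.inr ⟨hL.ne, Or.inr ⟨?_, ?_⟩⟩)⟩
      · obtain ⟨a, b, hab, ha, hb⟩ := h.blue_U0 huU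
        exact ⟨a, b, hab, hB' _ _ ha, hB' _ _ hb⟩
      · obtain ⟨a, b, hab, ha, hb⟩ := h.blue_U0 hwU
        exact ⟨a, b, hab, hB' _ _ ha, hB' _ _ hb⟩

theorem exists_colouring [Finite V] : ∃ φ : RedBlueGraph V, φ.IsPartialColouring S.G ∧
    (∀ x y, φ.graph.Adj x y → S.Near 4 x) ∧
    (∀ x ∈ φ.graph.support, ∀ y ∈ φ.graph.support, φ.graph.Reachable x y) ∧
    φ.ContainsBlueGadget S.ℓ ∧ φ.SeesBothColours ∧ φ.CyclesHaveGap S.G := by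
  obtain ⟨ψ, h1, h2, h3, h4, h5, h6, h7⟩ := RedBlueGraph.exists_completion h.degree_le h.colouring
    (fun a b hab => hab.elim h.red_adj h.blue_adj)
    (h.red_acyclic _ fun a b hab => hab) (h.blue_acyclic _ fun a b hab => hab)
    (fun v a b hab ha hb => h.sees_both hab ha hb)
    (fun x hx y hy => (h.reach_support hx).symm.trans (h.reach_support hy)) (by
      rintro x y hxy hunc ⟨a, ha⟩ ⟨b, hb⟩ ⟨a', ha'⟩ ⟨b', hb'⟩
      have hunc' : ¬ h.colouring.graph.Adj y x := fun h' => hunc h'.symm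
      rcases h.anchored_or hxy hunc ha hb with (⟨z, hz⟩ | ⟨z, hz⟩) | ⟨hx, hxU, hbU, i, hi, hci, rfl⟩
      · exact Or.inl ⟨z, Or.inl hz.1, hz.2⟩
      · exact Or.inr ⟨z, Or.inl hz.1, hz.2⟩
      rcases h.anchored_or hxy.symm hunc' ha' hb' with (⟨z, hz⟩ | ⟨z, hz⟩) |
        ⟨hy, hyU, hbU', j, hj, hcj, rfl⟩
      · exact Or.inl ⟨z, Or.inr hz.1, hz.2⟩
      · exact Or.inr ⟨z, Or.inr hz.1, hz.2⟩
      exfalso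
      obtain ⟨u, w, hL⟩ := h.exists_lane hbU
      have hadj : ∀ x b, b ∈ S.U0 → S.G.Adj x b → S.G.Adj u x ∨ S.G.Adj w x := by
        intro x b hbU hxb
        rw [hL.set] at hbU
        rcases hbU with rfl | rfl
        · exact Or.inl hxb.symm
        · exact Or.inr hxb.symm
      -- If neither end is anchored, x and y are adjacent neighbours of the lane, each adjacent to a
      -- critical vertex.
      rcases hL.no_square x y i j (hadj x b hbU (h.blue_adj hb)) (hadj y b' hbU' (h.blue_adj hb'))
        hx hy hxy hci hcj (h.red_adj ha) (h.red_adj ha') with h' | h'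
      · exact hxU h'
      · exact hyU h')
  refine ⟨ψ, h3, ?_, h5, ?_, h6, h7⟩
  · intro x y hxy
    exact h.near_support (h4 ⟨y, hxy⟩)
  -- The whole coloured graph serves as the gadget, being subcubic and containing a frame.
  · refine ⟨V, inferInstance, ψ, Function.Embedding.refl V,
      ψ.isBlueGadget_of_frame h.three_le (fun v => ?_) (h.frame h1 h2), ?_, ?_⟩
    · exact (Set.encard_le_encard fun a ha => h3 ha).trans (h.degree_le v)
    · exact (SimpleGraph.map_id (G := ψ.red)).le
    · exact (SimpleGraph.map_id (G := ψ.blue)).le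

end Valid

end ColourScheme

/-! ### Geodesics in cubic graphs -/

/-- The vertices `p 0, …, p N` form a geodesic in the cubic graph `G`. -/
structure IsGeodesic {V : Type*} (G : SimpleGraph V) (p : ℕ → V) (N : ℕ) : Prop where
  degree : ∀ v, (G.neighborSet v).encard = 3
  adj : ∀ i < N, G.Adj (p i) (p (i + 1))
  dist : ∀ i ≤ N, ∀ j ≤ N, ∀ w : G.Walk (p i) (p j), j ≤ i + w.length

/-- There is a walk of length `d` from `p i` to `x`. -/
def WalkFrom {V : Type*} (G : SimpleGraph V) (p : ℕ → V) (N d i : ℕ) (x : V) : Prop :=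
  i ≤ N ∧ ∃ w : G.Walk (p i) x, w.length = d

/-- `x` is not one of the vertices `p 0, …, p N`. -/
def OffPath {V : Type*} (p : ℕ → V) (N : ℕ) (x : V) : Prop := ∀ i ≤ N, x ≠ p i

section geodesic

variable {V : Type*} {G : SimpleGraph V} {p : ℕ → V} {N : ℕ}

theorem WalkFrom.zero {i : ℕ} (hi : i ≤ N) : WalkFrom G p N 0 i (p i) :=
  ⟨hi, SimpleGraph.Walk.nil, rfl⟩

theorem WalkFrom.one {i : ℕ} (hi : i ≤ N) {x : V} (hx : G.Adj x (p i)) : WalkFrom G p N 1 i x :=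
  ⟨hi, hx.symm.toWalk, rfl⟩

theorem WalkFrom.step {d i : ℕ} {x y : V} (h : WalkFrom G p N d i x) (hxy : G.Adj x y) :
    WalkFrom G p N (d + 1) i y := by
  obtain ⟨hi, w, rfl⟩ := h
  exact ⟨hi, w.concat hxy, SimpleGraph.Walk.length_concat _ _⟩

/-- This is the form in which shortness is used: two places from which x is reached in d and e steps
are at most d + e apart. -/
theorem WalkFrom.bound (hg : IsGeodesic G p N) {d i e j : ℕ} {x : V} (h : WalkFrom G p N d i x)
    (h' : WalkFrom G p N e j x) : i ≤ j + d + e ∧ j ≤ i + d + e := by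
  obtain ⟨hi, w, rfl⟩ := h
  obtain ⟨hj, w', rfl⟩ := h'
  have h1 := hg.dist i hi j hj (w.append w'.reverse)
  have h2 := hg.dist j hj i hi (w'.append w.reverse)
  rw [SimpleGraph.Walk.length_append, SimpleGraph.Walk.length_reverse] at h1 h2
  omega

namespace IsGeodesic

variable (hg : IsGeodesic G p N)
include hg

theorem degree_le (v : V) : (G.neighborSet v).encard ≤ 3 := (hg.degree v).le

theorem inj {i j : ℕ} (hi : i ≤ N) (hj : j ≤ N) (hij : p i = p j) : i = j := by
  have h1 : WalkFrom G p N 0 i (p i) := .zero hi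
  have h2 : WalkFrom G p N 0 j (p i) := hij ▸ .zero hj
  have := h1.bound hg h2
  omega

theorem adj_index {i j : ℕ} (hi : i ≤ N) (hj : j ≤ N) (hij : G.Adj (p i) (p j)) :
    i = j + 1 ∨ j = i + 1 := by
  have h1 : WalkFrom G p N 1 j (p i) := .one hj hij
  have h2 : WalkFrom G p N 0 i (p i) := .zero hi
  have := h1.bound hg h2
  have h3 : i ≠ j := by rintro rfl; exact hij.ne rfl
  omega

theorem two_index {i j : ℕ} (hi : i ≤ N) (hj : j ≤ N) {x : V} (hxi : G.Adj x (p i))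
    (hxj : G.Adj x (p j)) : i ≤ j + 2 ∧ j ≤ i + 2 := by
  have h1 : WalkFrom G p N 1 i x := .one hi hxi
  have h2 : WalkFrom G p N 1 j x := .one hj hxj
  have := h1.bound hg h2
  omega

theorem four {x a b c d : V} (ha : G.Adj x a) (hb : G.Adj x b) (hc : G.Adj x c) (hd : G.Adj x d)
    (hab : a ≠ b) (hac : a ≠ c) (hbc : b ≠ c) : d = a ∨ d = b ∨ d = c :=
  RedBlueGraph.eq_of_encard_neighborSet_le (hg.degree_le x) ha hb hc hd hab hac hbc

theorem ne {i j : ℕ} (hi : i ≤ N) (hj : j ≤ N) (hij : i ≠ j) : p i ≠ p j :=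
  fun h => hij (hg.inj hi hj h)

/-- An inner vertex of the geodesic has only one neighbour off the geodesic. -/
theorem off_unique {l : ℕ} (hl : 1 ≤ l) (hlN : l < N) {x y : V} (hx : OffPath p N x)
    (hy : OffPath p N y) (hxl : G.Adj x (p l)) (hyl : G.Adj y (p l)) : x = y := by
  have h1 := hg.adj (l - 1) (by omega)
  rw [Nat.sub_add_cancel hl] at h1
  have h2 := hg.adj l hlN
  rcases hg.four h1.symm h2 hxl.symm hyl.symm (hg.ne (by omega) (by omega) (by omega))
    (hx _ (by omega)).symm (hx _ (by omega)).symm with h | h | h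
  · exact (hy _ (by omega) h).elim
  · exact (hy _ (by omega) h).elim
  · exact h.symm

theorem exists_off {l : ℕ} (hl : l ≤ N) : ∃ x, OffPath p N x ∧ G.Adj x (p l) := by
  by_contra hcon
  push Not at hcon
  have hsub : G.neighborSet (p l) ⊆ {p (l - 1), p (l + 1)} := by
    intro c hc
    have hc : G.Adj (p l) c := hc
    by_cases hO : OffPath p N c
    · exact (hcon c hO hc.symm).elim
    · unfold OffPath at hO
      push Not at hO
      obtain ⟨i, hi, rfl⟩ := hO
      rcases hg.adj_index hl hi hc with h | h
      · left
        rw [h, Nat.add_sub_cancel]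
      · right
        rw [h]; rfl
  have h1 := Set.encard_le_encard hsub
  rw [hg.degree] at h1
  have h2 : ({p (l - 1), p (l + 1)} : Set V).encard ≤ 2 :=
    (Set.encard_insert_le _ _).trans (by rw [Set.encard_singleton]; norm_num)
  exact absurd (h1.trans h2) (by decide)

theorem exists_third (v a b : V) : ∃ c, G.Adj v c ∧ c ≠ a ∧ c ≠ b := by
  by_contra hcon
  push Not at hcon
  have hsub : G.neighborSet v ⊆ {a, b} := by
    intro c hc
    by_cases hca : c = a
    · exact Or.inl hca
    · exact Or.inr (hcon c hc hca)
  have h1 := Set.encard_le_encard hsub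
  rw [hg.degree] at h1
  have h2 : ({a, b} : Set V).encard ≤ 2 :=
    (Set.encard_insert_le _ _).trans (by rw [Set.encard_singleton]; norm_num)
  exact absurd (h1.trans h2) (by decide)

end IsGeodesic

/-! ### Apices and the rule for their insertion -/

/-- `x` is the apex of a triangle over the edge `p k p (k+1)`. -/
def IsApex (G : SimpleGraph V) (p : ℕ → V) (N k : ℕ) (x : V) : Prop :=
  k + 1 ≤ N ∧ OffPath p N x ∧ G.Adj x (p k) ∧ G.Adj x (p (k + 1))

theorem IsApex.unique (hg : IsGeodesic G p N) (hN : 2 ≤ N) {k : ℕ} {x y : V}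
    (hx : IsApex G p N k x) (hy : IsApex G p N k y) : x = y := by
  obtain ⟨hk, h1, h2, h3⟩ := hx
  obtain ⟨-, h4, h5, h6⟩ := hy
  by_cases h : 1 ≤ k
  · exact hg.off_unique h (by omega) h1 h4 h2 h5
  · exact hg.off_unique (by omega) (by omega) h1 h4 h3 h6

/-- No vertex is adjacent to `p j` and `p (j+2)` where `j` is close to `k`. -/
def Quiet (G : SimpleGraph V) (p : ℕ → V) (N k : ℕ) : Prop :=
  ∀ y j, OffPath p N y → j + 2 ≤ N → G.Adj y (p j) → G.Adj y (p (j + 2)) → j + 12 < k ∨ k + 12 < j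

/-- The vertices of the geodesic and the inserted vertices. -/
def OnPath (p : ℕ → V) (N : ℕ) (K : ℕ → Prop) (s : ℕ → V) (x : V) : Prop :=
  (∃ i ≤ N, x = p i) ∨ ∃ k, K k ∧ x = s k

/-- The vertices `s k`, for `k` in `K`, can be inserted between `p k` and `p (k + 1)`. In the
special case `sp` the vertex `s k₀` is inserted although there may be a vertex adjacent to `s k₀`
and to the geodesic. -/
structure IsInsertion (G : SimpleGraph V) (p : ℕ → V) (N : ℕ) (K : ℕ → Prop) (s : ℕ → V)
    (sp : Prop) (k₀ : ℕ) : Prop where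
  apex : ∀ k, K k → IsApex G p N k (s k)
  inj : ∀ k k', K k → K k' → s k = s k' → k = k'
  three : ∀ x a b c, ¬ OnPath p N K s x → a ≤ N → b ≤ N → c ≤ N → G.Adj x (p a) → G.Adj x (p b) →
    G.Adj x (p c) → a = b ∨ a = c ∨ b = c
  third : ∀ x k y, ¬ OnPath p N K s x → IsApex G p N k x → G.Adj x y → ¬ OnPath p N K s y →
    ∃ z, OnPath p N K s z ∧ G.Adj y z
  tip : ∀ x k z, ¬ OnPath p N K s x → K k → G.Adj x (s k) → OnPath p N K s z → G.Adj x z →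
    z = s k ∨ (sp ∧ k = k₀ ∧ ∃ j ≤ N, z = p j)
  tip_unique : ∀ x k i j, ¬ OnPath p N K s x → K k → G.Adj x (s k) → i ≤ N → j ≤ N →
    G.Adj x (p i) → G.Adj x (p j) → i = j
  quiet : sp → Quiet G p N k₀

/-- The rule for the insertion of apices: the forced ones, those with three neighbours on the
geodesic, and the first apex at each vertex without neighbours on the geodesic and among forced
apices. -/
def InsertRule (G : SimpleGraph V) (p : ℕ → V) (N : ℕ) (F : ℕ → Prop) (s : ℕ → V) (k : ℕ) : Prop :=
  IsApex G p N k (s k) ∧ (F k ∨ (k + 2 ≤ N ∧ G.Adj (s k) (p (k + 2))) ∨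
    ∃ t, OffPath p N t ∧ G.Adj t (s k) ∧ (∀ i ≤ N, ¬ G.Adj t (p i)) ∧
      (∀ f, F f → ¬ G.Adj t (s f)) ∧ ∀ k' < k, IsApex G p N k' (s k') → ¬ G.Adj t (s k'))

/-- An apex left outside has two edges to the path and gets saturated, so its third neighbour y
receives a blue edge. If y has no neighbour on the geodesic or among the forced apices, the first
apex at y is inserted, so that y meets the path; this gives `third`. An apex inserted for this
reason has y as its only neighbour off the geodesic, which gives `tip`. Apices adjacent to s k₀ are
forced, since otherwise they would have three neighbours on the path once s k₀ is inserted. -/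
theorem isInsertion_insertRule (hg : IsGeodesic G p N) (hN : 2 ≤ N) {s : ℕ → V}
    (hs : ∀ k x, IsApex G p N k x → s k = x) {F : ℕ → Prop} {sp : Prop} {k₀ : ℕ}
    (hF : ∀ k, F k ↔ sp ∧ IsApex G p N k (s k) ∧ (k = k₀ ∨ G.Adj (s k) (s k₀)))
    (hk₀ : sp → IsApex G p N k₀ (s k₀)) (hq : sp → Quiet G p N k₀) :
    IsInsertion G p N (InsertRule G p N F s) s sp k₀ := by
  have hFK : ∀ k, F k → InsertRule G p N F s k := fun k hk => ⟨((hF k).1 hk).2.1, Or.inl hk⟩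
  have hOn : ∀ k, InsertRule G p N F s k → OnPath p N (InsertRule G p N F s) s (s k) :=
    fun k hk => Or.inr ⟨k, hk, rfl⟩
  have hoff : ∀ x, ¬ OnPath p N (InsertRule G p N F s) s x → OffPath p N x :=
    fun x hx i hi h => hx (Or.inl ⟨i, hi, h⟩)
  have hpp : ∀ k, k + 1 ≤ N → p k ≠ p (k + 1) := fun k hk =>
    hg.ne (by omega) hk (by omega)
  -- an apex has at most one neighbour besides the two defining ones
  have hthird : ∀ k x y, IsApex G p N k (s k) → G.Adj (s k) x → G.Adj (s k) y → x ≠ p k →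
      x ≠ p (k + 1) → y ≠ p k → y ≠ p (k + 1) → x = y := by
    intro k x y hk hx hy h1 h2 h3 h4
    rcases hg.four hk.2.2.1 hk.2.2.2 hx hy (hpp k hk.1) h1.symm h2.symm with h | h | h
    · exact (h3 h).elim
    · exact (h4 h).elim
    · exact h.symm
  have hthird' : ∀ k x y, IsApex G p N k (s k) → G.Adj (s k) x → G.Adj (s k) y → OffPath p N x →
      OffPath p N y → x = y := fun k x y hk hx hy h1 h2 =>
    hthird k x y hk hx hy (h1 _ (by have := hk.1; omega)) (h1 _ hk.1) (h2 _ (by have := hk.1; omega))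
      (h2 _ hk.1)
  have hdia : ∀ k x, IsApex G p N k (s k) → k + 2 ≤ N → G.Adj (s k) (p (k + 2)) →
      G.Adj (s k) x → ¬ OffPath p N x := by
    intro k x hk hk2 h2 hx hO
    exact hO (k + 2) hk2 (hthird k x _ hk hx h2 (hO _ (by omega)) (hO _ (by omega))
      (hg.ne (by omega) (by omega) (by omega)) (hg.ne (by omega) (by omega) (by omega)))
  -- a forced apex with a neighbour off the new path is the special one
  have hforced : ∀ k x, F k → ¬ OnPath p N (InsertRule G p N F s) s x → G.Adj x (s k) →
      sp ∧ k = k₀ := by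
    intro k x hk hx hxk
    obtain ⟨hsp, hap, h1 | h1⟩ := (hF k).1 hk
    · exact ⟨hsp, h1⟩
    · have hF0 : F k₀ := (hF k₀).2 ⟨hsp, hk₀ hsp, Or.inl rfl⟩
      have := hthird' k x (s k₀) hap hxk.symm h1 (hoff x hx) (hk₀ hsp).2.1
      exact (hx (this ▸ hOn _ (hFK _ hF0))).elim
  -- the kinds of inserted apices with a neighbour off the new path
  have hkind : ∀ k x, InsertRule G p N F s k → ¬ OnPath p N (InsertRule G p N F s) s x →
      G.Adj x (s k) → (sp ∧ k = k₀) ∨ ((∀ i ≤ N, ¬ G.Adj x (p i)) ∧ (∀ f, F f → ¬ G.Adj x (s f)) ∧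
        ∀ k' < k, IsApex G p N k' (s k') → ¬ G.Adj x (s k')) := by
    intro k x hk hx hxk
    obtain ⟨hap, h1 | ⟨h1, h2⟩ | ⟨t, ht, htk, h1, h2, h3⟩⟩ := hk
    · exact Or.inl (hforced k x h1 hx hxk)
    · exact (hdia k x hap h1 h2 hxk.symm (hoff x hx)).elim
    · have := hthird' k x t hap hxk.symm htk.symm (hoff x hx) ht
      subst this
      exact Or.inr ⟨h1, h2, h3⟩
  refine ⟨fun k hk => hk.1, ?_, ?_, ?_, ?_, ?_, hq⟩
  · have key : ∀ k k', InsertRule G p N F s k → InsertRule G p N F s k' → s k = s k' → ¬ k < k' := by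
      intro k k' hk hk' hss hlt
      have hap := hk.1
      have hap' := hk'.1
      have h1 := hg.two_index (by have := hap.1; omega) hap'.1 hap.2.2.1 (hss ▸ hap'.2.2.2)
      have hk'' : k' = k + 1 := by omega
      subst hk''
      have hk1 := hap.1
      have hk2 := hap'.1
      have hadj2 : G.Adj (s (k + 1)) (p k) := hss ▸ hap.2.2.1
      have hno : ∀ x, G.Adj (s (k + 1)) x → x = p k ∨ x = p (k + 1) ∨ x = p (k + 2) := fun x hx =>
        hg.four hadj2 hap'.2.2.1 hap'.2.2.2 hx (hpp k hap.1)
          (hg.ne (by omega) hap'.1 (by omega)) (hpp _ hap'.1)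
      obtain ⟨-, h2 | ⟨h2, h3⟩ | ⟨t, ht, htk, -⟩⟩ := hk'
      · obtain ⟨hsp, -, h3⟩ := (hF _).1 h2
        have hapk := hk₀ hsp
        have hq' := hq hsp (s (k + 1)) k hap'.2.1 hap'.1 hadj2 hap'.2.2.2
        rcases h3 with h3 | h3
        · omega
        · have w1 : WalkFrom G p N 2 k (s k₀) :=
            (WalkFrom.one (by omega) hadj2).step h3
          have w2 : WalkFrom G p N 1 k₀ (s k₀) := .one (by have := hapk.1; omega) hapk.2.2.1
          have := w1.bound hg w2
          omega
      · have := hg.two_index (by omega) h2 hadj2 h3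
        omega
      · rcases hno t htk.symm with h | h | h
        · exact ht _ (by omega) h
        · exact ht _ (by omega) h
        · exact ht _ hap'.1 h
    intro k k' hk hk' hss
    rcases lt_trichotomy k k' with h | h | h
    · exact (key k k' hk hk' hss h).elim
    · exact h
    · exact (key k' k hk' hk hss.symm h).elim
  · have key : ∀ x a b c, ¬ OnPath p N (InsertRule G p N F s) s x → a < b → b < c → c ≤ N →
        G.Adj x (p a) → G.Adj x (p b) → G.Adj x (p c) → False := by
      intro x a b c hx hab hbc hc h1 h2 h3
      have h4 := hg.two_index (by omega) hc h1 h3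
      have hb : b = a + 1 := by omega
      have hc' : c = a + 2 := by omega
      subst hb hc'
      have hap : IsApex G p N a x := ⟨by omega, hoff x hx, h1, h2⟩
      have hsx := hs a x hap
      exact hx (hsx ▸ hOn a ⟨hsx ▸ hap, Or.inr (Or.inl ⟨hc, hsx ▸ h3⟩)⟩)
    intro x a b c hx ha hb hc h1 h2 h3
    by_contra hcon
    push Not at hcon
    obtain ⟨h4, h5, h6⟩ := hcon
    have : (a < b ∧ b < c) ∨ (a < c ∧ c < b) ∨ (b < a ∧ a < c) ∨ (b < c ∧ c < a) ∨
      (c < a ∧ a < b) ∨ (c < b ∧ b < a) := by omega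
    rcases this with ⟨h, h'⟩ | ⟨h, h'⟩ | ⟨h, h'⟩ | ⟨h, h'⟩ | ⟨h, h'⟩ | ⟨h, h'⟩
    · exact key x a b c hx h h' hc h1 h2 h3
    · exact key x a c b hx h h' hb h1 h3 h2
    · exact key x b a c hx h h' hc h2 h1 h3
    · exact key x b c a hx h h' ha h2 h3 h1
    · exact key x c a b hx h h' hb h3 h1 h2
    · exact key x c b a hx h h' ha h3 h2 h1
  · intro x k y hx hap hxy hy
    have hsx := hs k x hap
    subst hsx
    by_contra hcon
    push Not at hcon
    have hfirst : ∃ k', IsApex G p N k' (s k') ∧ G.Adj y (s k') := ⟨k, hap, hxy.symm⟩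
    classical
    -- The first apex at y satisfies the last clause of the rule, so y would meet the path after
    -- all.
    have hspec := Nat.find_spec hfirst
    have hmin := fun m hm => Nat.find_min hfirst (m := m) hm
    set k' := Nat.find hfirst
    refine hcon (s k') (hOn k' ⟨hspec.1, Or.inr (Or.inr ⟨y, hoff y hy, hspec.2, ?_, ?_, ?_⟩)⟩) hspec.2
    · exact fun i hi h => hcon (p i) (Or.inl ⟨i, hi, rfl⟩) h
    · exact fun f hf h => hcon (s f) (hOn f (hFK f hf)) h
    · exact fun m hm h h' => hmin m hm ⟨h, h'⟩
  · intro x k z hx hk hxk hz hxz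
    rcases hkind k x hk hx hxk with ⟨hsp, rfl⟩ | ⟨h1, h2, h3⟩
    · rcases hz with hz | ⟨k', hk', rfl⟩
      · exact Or.inr ⟨hsp, rfl, hz⟩
      · rcases hkind k' x hk' hx hxz with ⟨-, rfl⟩ | ⟨h1, h2, h3⟩
        · exact Or.inl rfl
        · exact (h2 k ((hF k).2 ⟨hsp, hk.1, Or.inl rfl⟩) hxk).elim
    · rcases hz with ⟨i, hi, rfl⟩ | ⟨k', hk', rfl⟩
      · exact (h1 i hi hxz).elim
      · rcases hkind k' x hk' hx hxz with ⟨hsp, rfl⟩ | ⟨h1', h2', h3'⟩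
        · exact (h2 k' ((hF k').2 ⟨hsp, hk'.1, Or.inl rfl⟩) hxz).elim
        · rcases lt_trichotomy k k' with h | rfl | h
          · exact (h3' k h hk.1 hxk).elim
          · exact Or.inl rfl
          · exact (h3 k' h hk'.1 hxz).elim
  · intro x k i j hx hk hxk hi hj hxi hxj
    rcases hkind k x hk hx hxk with ⟨hsp, rfl⟩ | ⟨h1, -⟩
    -- Two geodesic neighbours of x are consecutive, which makes x a forced apex, or two places
    -- apart, which `Quiet` excludes near k₀.
    · have key : ∀ i j, i < j → j ≤ N → G.Adj x (p i) → G.Adj x (p j) → False := by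
        intro i j hij hj hxi hxj
        have h1 := hg.two_index (by omega) hj hxi hxj
        have hap := hk.1
        have h2 : j = i + 1 ∨ j = i + 2 := by omega
        rcases h2 with rfl | rfl
        · have hap' : IsApex G p N i x := ⟨hj, hoff x hx, hxi, hxj⟩
          have hsx := hs i x hap'
          exact hx (hsx ▸ hOn i (hFK i ((hF i).2 ⟨hsp, hsx ▸ hap', Or.inr (hsx ▸ hxk)⟩)))
        · have hq' := hq hsp x i (hoff x hx) hj hxi hxj
          have w1 : WalkFrom G p N 2 i (s k) := (WalkFrom.one (by omega) hxi).step hxk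
          have w2 : WalkFrom G p N 1 k (s k) := .one (by have := hap.1; omega) hap.2.2.1
          have := w1.bound hg w2
          omega
      rcases lt_trichotomy i j with h | h | h
      · exact (key i j h hj hxi hxj).elim
      · exact h
      · exact (key j i h hi hxj hxi).elim
    · exact (h1 i hi hxi).elim

end geodesic

/-! ### The path with inserted vertices -/

section insertion

open Classical in
/-- The position of `p k` on the path obtained by inserting `s k` after `p k` for all `k` in
`K`. -/
noncomputable def insPos (K : ℕ → Prop) : ℕ → ℕ
  | 0 => 0
  | k + 1 => insPos K k + if K k then 2 else 1

theorem insPos_succ_of {K : ℕ → Prop} {k : ℕ} (h : K k) : insPos K (k + 1) = insPos K k + 2 := by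
  simp [insPos, h]

theorem insPos_succ_of_not {K : ℕ → Prop} {k : ℕ} (h : ¬ K k) :
    insPos K (k + 1) = insPos K k + 1 := by
  simp [insPos, h]

theorem insPos_bounds (K : ℕ → Prop) (i d : ℕ) :
    insPos K i + d ≤ insPos K (i + d) ∧ insPos K (i + d) ≤ insPos K i + 2 * d := by
  induction d with
  | zero => simp
  | succ d ih =>
    by_cases h : K (i + d)
    · have := insPos_succ_of h
      rw [show i + (d + 1) = i + d + 1 from rfl]; omega
    · have := insPos_succ_of_not h
      rw [show i + (d + 1) = i + d + 1 from rfl]; omega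

theorem insPos_bounds' (K : ℕ → Prop) {i j : ℕ} (h : i ≤ j) :
    insPos K i + (j - i) ≤ insPos K j ∧ insPos K j ≤ insPos K i + 2 * (j - i) := by
  have := insPos_bounds K i (j - i)
  rwa [Nat.add_sub_cancel' h] at this

theorem insPos_lt_iff {K : ℕ → Prop} {i j : ℕ} : insPos K i < insPos K j ↔ i < j := by
  constructor
  · intro h
    by_contra hcon
    have := insPos_bounds' K (not_lt.1 hcon)
    omega
  · intro h
    have := insPos_bounds' K h.le
    omega

theorem insPos_inj {K : ℕ → Prop} {i j : ℕ} (h : insPos K i = insPos K j) : i = j := by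
  rcases lt_trichotomy i j with h1 | h1 | h1
  · have := insPos_lt_iff (K := K).2 h1
    omega
  · exact h1
  · have := insPos_lt_iff (K := K).2 h1
    omega

theorem insPos_add_one_ne {K : ℕ → Prop} {i k : ℕ} (h : K k) : insPos K i ≠ insPos K k + 1 := by
  intro h1
  have h2 := insPos_succ_of h
  have h3 := insPos_lt_iff (K := K) (i := k) (j := i).1 (by omega)
  have h4 := insPos_lt_iff (K := K) (i := i) (j := k + 1).1 (by omega)
  omega

open Classical in
/-- The path obtained from `p 0, p 1, …` by inserting `s k` after `p k` for all `k` in `K`. -/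
noncomputable def insPath {V : Type*} (p : ℕ → V) (K : ℕ → Prop) (s : ℕ → V) (n : ℕ) : V :=
  if h : ∃ k, insPos K k = n then p h.choose else
    if h : ∃ k, K k ∧ insPos K k + 1 = n then s h.choose else p 0

theorem insPath_insPos {V : Type*} (p : ℕ → V) (K : ℕ → Prop) (s : ℕ → V) (k : ℕ) :
    insPath p K s (insPos K k) = p k := by
  have h : ∃ k', insPos K k' = insPos K k := ⟨k, rfl⟩
  rw [insPath, dif_pos h, insPos_inj h.choose_spec]

theorem insPath_insPos_add_one {V : Type*} (p : ℕ → V) {K : ℕ → Prop} (s : ℕ → V) {k : ℕ}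
    (hk : K k) : insPath p K s (insPos K k + 1) = s k := by
  have h : ∃ k', K k' ∧ insPos K k' + 1 = insPos K k + 1 := ⟨k, hk, rfl⟩
  have h' : ¬ ∃ k', insPos K k' = insPos K k + 1 := fun ⟨k', h1⟩ => insPos_add_one_ne hk h1
  rw [insPath, dif_neg h', dif_pos h, insPos_inj (Nat.add_right_cancel h.choose_spec.2)]

theorem insPos_cases (K : ℕ → Prop) (N : ℕ) {n : ℕ} (hn : n ≤ insPos K N) :
    (∃ k ≤ N, n = insPos K k) ∨ ∃ k < N, K k ∧ n = insPos K k + 1 := by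
  induction N with
  | zero => exact Or.inl ⟨0, le_rfl, by simpa [insPos] using hn⟩
  | succ N ih =>
    by_cases h : n ≤ insPos K N
    · rcases ih h with ⟨k, hk, rfl⟩ | ⟨k, hk, h1, rfl⟩
      · exact Or.inl ⟨k, by omega, rfl⟩
      · exact Or.inr ⟨k, by omega, h1, rfl⟩
    · by_cases hN : K N
      · rw [insPos_succ_of hN] at hn
        by_cases h1 : n = insPos K N + 1
        · exact Or.inr ⟨N, by omega, hN, h1⟩
        · exact Or.inl ⟨N + 1, le_rfl, by rw [insPos_succ_of hN]; omega⟩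
      · rw [insPos_succ_of_not hN] at hn
        exact Or.inl ⟨N + 1, le_rfl, by rw [insPos_succ_of_not hN]; omega⟩

variable {V : Type*} {G : SimpleGraph V} {p : ℕ → V} {N : ℕ} {K : ℕ → Prop} {s : ℕ → V}
  {sp : Prop} {k₀ : ℕ}

theorem OnPath.base {i : ℕ} (hi : i ≤ N) : OnPath p N K s (p i) := Or.inl ⟨i, hi, rfl⟩

theorem OnPath.ins {k : ℕ} (hk : K k) : OnPath p N K s (s k) := Or.inr ⟨k, hk, rfl⟩

theorem OffPath.of_not_onPath {x : V} (hx : ¬ OnPath p N K s x) : OffPath p N x :=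
  fun i hi h => hx (Or.inl ⟨i, hi, h⟩)

namespace IsInsertion

variable (hg : IsGeodesic G p N) (hI : IsInsertion G p N K s sp k₀)
include hI

theorem pos_lt {k : ℕ} (hk : K k) : insPos K k + 1 < insPos K N := by
  have h1 := insPos_succ_of hk
  have h2 := insPos_bounds' K (hI.apex k hk).1
  omega

/-- The vertices of the path, with their positions. -/
theorem path_cases {n : ℕ} (hn : n ≤ insPos K N) :
    (∃ k ≤ N, n = insPos K k ∧ insPath p K s n = p k) ∨
      ∃ k, K k ∧ n = insPos K k + 1 ∧ insPath p K s n = s k := by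
  rcases insPos_cases K N hn with ⟨k, hk, rfl⟩ | ⟨k, -, h1, rfl⟩
  · exact Or.inl ⟨k, hk, rfl, insPath_insPos _ _ _ _⟩
  · exact Or.inr ⟨k, h1, rfl, insPath_insPos_add_one _ _ h1⟩

theorem exists_iff {x : V} : (∃ j ≤ insPos K N, insPath p K s j = x) ↔ OnPath p N K s x := by
  constructor
  · rintro ⟨j, hj, rfl⟩
    rcases hI.path_cases hj with ⟨k, hk, -, h⟩ | ⟨k, hk, -, h⟩
    · exact Or.inl ⟨k, hk, h⟩
    · exact Or.inr ⟨k, hk, h⟩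
  · rintro (⟨i, hi, rfl⟩ | ⟨k, hk, rfl⟩)
    · refine ⟨insPos K i, ?_, insPath_insPos _ _ _ _⟩
      have := insPos_bounds' K hi
      omega
    · exact ⟨insPos K k + 1, (hI.pos_lt hk).le, insPath_insPos_add_one _ _ hk⟩

include hg

theorem path_inj {i j : ℕ} (hi : i ≤ insPos K N) (hj : j ≤ insPos K N)
    (hij : insPath p K s i = insPath p K s j) : i = j := by
  rcases hI.path_cases hi with ⟨a, ha, rfl, h⟩ | ⟨a, ha, rfl, h⟩ <;>
    rcases hI.path_cases hj with ⟨b, hb, rfl, h'⟩ | ⟨b, hb, rfl, h'⟩ <;> rw [h, h'] at hij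
  · rw [hg.inj ha hb hij]
  · exact ((hI.apex b hb).2.1 a ha hij.symm).elim
  · exact ((hI.apex a ha).2.1 b hb hij).elim
  · rw [hI.inj a b ha hb hij]

theorem path_adj {j : ℕ} (hj : j < insPos K N) :
    G.Adj (insPath p K s j) (insPath p K s (j + 1)) := by
  rcases hI.path_cases hj.le with ⟨a, ha, rfl, h⟩ | ⟨a, ha, rfl, h⟩
  · rw [h]
    by_cases hK : K a
    · rw [insPath_insPos_add_one _ _ hK]
      exact (hI.apex a hK).2.2.1.symm
    · rw [← insPos_succ_of_not hK, insPath_insPos]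
      exact hg.adj a (insPos_lt_iff.1 hj)
  · rw [h, add_assoc, show 1 + 1 = 2 from rfl, ← insPos_succ_of ha, insPath_insPos]
    exact (hI.apex a ha).2.2.2

/-- Geodesic neighbours of x are at most two places apart, and insertions at most double this. An
inserted vertex shares x with another path vertex only in the special case, by `tip`. -/
theorem path_gap {i j : ℕ} {x : V} (hij : i < j) (hj : j ≤ insPos K N)
    (hx : ¬ OnPath p N K s x) (hxi : G.Adj x (insPath p K s i)) (hxj : G.Adj x (insPath p K s j)) :
    j ≤ i + 4 ∨ (sp ∧ (i = insPos K k₀ + 1 ∨ j = insPos K k₀ + 1)) := by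
  rcases hI.path_cases (hij.le.trans hj) with ⟨a, ha, rfl, h⟩ | ⟨a, ha, rfl, h⟩ <;>
    rcases hI.path_cases hj with ⟨b, hb, rfl, h'⟩ | ⟨b, hb, rfl, h'⟩ <;>
    rw [h] at hxi <;> rw [h'] at hxj
  · have h1 := hg.two_index ha hb hxi hxj
    have h2 := insPos_bounds' K (insPos_lt_iff.1 hij).le
    left; omega
  · rcases hI.tip x b (p a) hx hb hxj (.base ha) hxi with h1 | ⟨hsp, rfl, -⟩
    · exact ((hI.apex b hb).2.1 a ha h1.symm).elim
    · exact Or.inr ⟨hsp, Or.inr rfl⟩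
  · rcases hI.tip x a (p b) hx ha hxi (.base hb) hxj with h1 | ⟨hsp, rfl, -⟩
    · exact ((hI.apex a ha).2.1 b hb h1.symm).elim
    · exact Or.inr ⟨hsp, Or.inl rfl⟩
  · rcases hI.tip x a (s b) hx ha hxi (.ins hb) hxj with h1 | ⟨-, -, c, hc, h1⟩
    · rw [hI.inj b a hb ha h1] at hij
      omega
    · exact ((hI.apex b hb).2.1 c hc h1).elim

theorem path_chord {i j : ℕ} (hij : i < j) (hj : j ≤ insPos K N)
    (h : G.Adj (insPath p K s i) (insPath p K s j)) : j ≤ i + 4 := by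
  rcases hI.path_cases (hij.le.trans hj) with ⟨a, ha, rfl, h1⟩ | ⟨a, ha, rfl, h1⟩ <;>
    rcases hI.path_cases hj with ⟨b, hb, rfl, h2⟩ | ⟨b, hb, rfl, h2⟩ <;>
    rw [h1, h2] at h
  · have h3 := hg.adj_index ha hb h
    have h4 := insPos_lt_iff.1 hij
    have h5 := insPos_bounds' K h4.le
    omega
  · have hb' := hI.apex b hb
    have hab : a ≤ b := by
      by_contra hcon
      have := insPos_bounds' K (i := b) (j := a) (by omega)
      omega
    have h3 := hg.two_index ha hb'.1 h.symm hb'.2.2.2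
    have h5 := insPos_bounds' K hab
    omega
  · have ha' := hI.apex a ha
    have hab : a < b := insPos_lt_iff (K := K).1 (by omega)
    have h3 := hg.two_index (by have := ha'.1; omega) hb ha'.2.2.1 h
    have h5 := insPos_bounds' K hab.le
    omega
  · have ha' := hI.apex a ha
    have hb' := hI.apex b hb
    have hab : a < b := insPos_lt_iff (K := K).1 (by omega)
    have w1 : WalkFrom G p N 2 a (s b) :=
      (WalkFrom.one (by have := ha'.1; omega) ha'.2.2.1).step h
    have w2 : WalkFrom G p N 1 (b + 1) (s b) := .one hb'.1 hb'.2.2.2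
    have h3 := w1.bound hg w2
    have h5 := insPos_bounds' K hab.le
    omega

end IsInsertion

end insertion

/-! ### Vertices with two neighbours on the path, and branches -/

section marks

variable {V : Type*} {G : SimpleGraph V} {p : ℕ → V} {N : ℕ} {K : ℕ → Prop} {s : ℕ → V}
  {sp : Prop} {k₀ : ℕ}

/-- Vertices off the path with two neighbours on the path. -/
def TwoOn (G : SimpleGraph V) (p : ℕ → V) (N : ℕ) (K : ℕ → Prop) (s : ℕ → V) (x : V) : Prop :=
  ¬ OnPath p N K s x ∧
    ∃ z z', z ≠ z' ∧ OnPath p N K s z ∧ OnPath p N K s z' ∧ G.Adj x z ∧ G.Adj x z'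

/-- Vertices without neighbours on the path, but with two neighbours satisfying `TwoOn`. -/
def Branch (G : SimpleGraph V) (p : ℕ → V) (N : ℕ) (K : ℕ → Prop) (s : ℕ → V) (t : V) : Prop :=
  ¬ OnPath p N K s t ∧ (∀ z, OnPath p N K s z → ¬ G.Adj t z) ∧
    ∃ c c', c ≠ c' ∧ TwoOn G p N K s c ∧ TwoOn G p N K s c' ∧ G.Adj t c ∧ G.Adj t c'

/-- The third edge at each vertex satisfying `Branch`. -/
def BranchEdge (G : SimpleGraph V) (p : ℕ → V) (N : ℕ) (K : ℕ → Prop) (s : ℕ → V) (a b : V) :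
    Prop :=
  G.Adj a b ∧ ((Branch G p N K s a ∧ ¬ TwoOn G p N K s b) ∨
    (Branch G p N K s b ∧ ¬ TwoOn G p N K s a))

/-- The surroundings of a vertex `t` satisfying `Branch`. -/
structure BranchAt (G : SimpleGraph V) (p : ℕ → V) (N : ℕ) (K : ℕ → Prop) (s : ℕ → V) (i : ℕ)
    (t c c' : V) : Prop where
  le : i + 3 ≤ N
  not_on : ¬ OnPath p N K s c
  not_on' : ¬ OnPath p N K s c'
  ne : c ≠ c'
  adj : G.Adj t c
  adj' : G.Adj t c'
  adj_zero : G.Adj c (p i)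
  adj_two : G.Adj c (p (i + 2))
  adj_one : G.Adj c' (p (i + 1))
  adj_three : G.Adj c' (p (i + 3))

theorem BranchEdge.symm {a b : V} (h : BranchEdge G p N K s a b) : BranchEdge G p N K s b a :=
  ⟨h.1.symm, h.2.symm⟩

theorem BranchEdge.not_on {a b : V} (h : BranchEdge G p N K s a b) : ¬ OnPath p N K s a := by
  rcases h.2 with h1 | h1
  · exact h1.1.1
  · exact fun h2 => h1.1.2.1 a h2 h.1.symm

namespace BranchAt

variable (hg : IsGeodesic G p N) {i : ℕ} {t c c' : V}

theorem walk (h : BranchAt G p N K s i t c c') {l : ℕ} (hl : i ≤ l) (hl' : l ≤ i + 3) :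
    WalkFrom G p N 2 l t := by
  have := h.le
  have h1 : l = i ∨ l = i + 1 ∨ l = i + 2 ∨ l = i + 3 := by omega
  rcases h1 with rfl | rfl | rfl | rfl
  · exact (WalkFrom.one (by omega) h.adj_zero).step h.adj.symm
  · exact (WalkFrom.one (by omega) h.adj_one).step h.adj'.symm
  · exact (WalkFrom.one (by omega) h.adj_two).step h.adj.symm
  · exact (WalkFrom.one (by omega) h.adj_three).step h.adj'.symm

include hg

/-- An inner geodesic vertex has one neighbour off the geodesic; for p i, …, p (i+3) these are c and
c'. -/
theorem absorb (h : BranchAt G p N K s i t c c') {y : V} (hy : OffPath p N y) {l : ℕ}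
    (hl : i ≤ l) (hl' : l ≤ i + 3) (hl1 : 1 ≤ l) (hlN : l < N) (hyl : G.Adj y (p l)) :
    y = c ∨ y = c' := by
  have h2 := OffPath.of_not_onPath h.not_on
  have h3 := OffPath.of_not_onPath h.not_on'
  have h1 : l = i ∨ l = i + 1 ∨ l = i + 2 ∨ l = i + 3 := by omega
  rcases h1 with rfl | rfl | rfl | rfl
  · exact Or.inl (hg.off_unique hl1 hlN hy h2 hyl h.adj_zero)
  · exact Or.inr (hg.off_unique hl1 hlN hy h3 hyl h.adj_one)
  · exact Or.inl (hg.off_unique hl1 hlN hy h2 hyl h.adj_two)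
  · exact Or.inr (hg.off_unique hl1 hlN hy h3 hyl h.adj_three)

theorem nbr (h : BranchAt G p N K s i t c c') (ht : ¬ OnPath p N K s t) {y x : V}
    (hy : y = c ∨ y = c') (hyx : G.Adj y x) (hx : ¬ OnPath p N K s x) : x = t := by
  have hle := h.le
  rcases hy with rfl | rfl
  · rcases hg.four h.adj_zero h.adj_two h.adj.symm hyx (hg.ne (by omega) (by omega) (by omega))
      (fun h1 => ht (h1 ▸ .base (by omega))) (fun h1 => ht (h1 ▸ .base (by omega))) with h1 | h1 | h1
    · exact (hx (h1 ▸ .base (by omega))).elim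
    · exact (hx (h1 ▸ .base (by omega))).elim
    · exact h1
  · rcases hg.four h.adj_one h.adj_three h.adj'.symm hyx (hg.ne (by omega) (by omega) (by omega))
      (fun h1 => ht (h1 ▸ .base (by omega))) (fun h1 => ht (h1 ▸ .base (by omega))) with h1 | h1 | h1
    · exact (hx (h1 ▸ .base (by omega))).elim
    · exact (hx (h1 ▸ .base (by omega))).elim
    · exact h1

/-- Overlapping index ranges make the two branches share one of their attached vertices, whose only
neighbour off the path is the branch vertex. -/
theorem index_unique (h : BranchAt G p N K s i t c c') (ht : ¬ OnPath p N K s t) {j : ℕ}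
    {t' d d' : V} (ht' : ¬ OnPath p N K s t') (h' : BranchAt G p N K s j t' d d')
    (hij : i ≤ j + 3) (hji : j ≤ i + 3) : t = t' := by
  have key : ∀ {i j : ℕ} {t c c' t' d d' : V}, BranchAt G p N K s i t c c' → ¬ OnPath p N K s t →
      BranchAt G p N K s j t' d d' → ¬ OnPath p N K s t' → i ≤ j → j ≤ i + 3 → t = t' := by
    intro i j t c c' t' d d' h ht h' ht' hij hji
    have hle' := h'.le
    by_cases h1 : i = j
    · subst h1
      exact (h.nbr hg ht (h.absorb hg (OffPath.of_not_onPath h'.not_on') (l := i + 1) (by omega)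
        (by omega) (by omega) (by omega) h'.adj_one) h'.adj'.symm ht').symm
    · exact (h.nbr hg ht (h.absorb hg (OffPath.of_not_onPath h'.not_on) (l := j) (by omega)
        (by omega) (by omega) (by omega) h'.adj_zero) h'.adj.symm ht').symm
  rcases le_total i j with h1 | h1
  · exact key h ht h' ht' h1 hji
  · exact (key h' ht' h ht h1 hij).symm

end BranchAt

namespace IsInsertion

variable (hg : IsGeodesic G p N) (hI : IsInsertion G p N K s sp k₀)
include hg hI

theorem special_of_ins {x : V} {k : ℕ} {z : V} (hx : ¬ OnPath p N K s x) (hk : K k)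
    (hxk : G.Adj x (s k)) (hz : OnPath p N K s z) (hxz : G.Adj x z) (hne : z ≠ s k) :
    sp ∧ k = k₀ ∧ ∃ j ≤ N, z = p j :=
  (hI.tip x k z hx hk hxk hz hxz).resolve_left hne

theorem twoOn_cases {x : V} (h : TwoOn G p N K s x) :
    (∃ i, IsApex G p N i x) ∨ (∃ i, i + 2 ≤ N ∧ G.Adj x (p i) ∧ G.Adj x (p (i + 2))) ∨
      (sp ∧ K k₀ ∧ G.Adj x (s k₀) ∧ ∃ j ≤ N, G.Adj x (p j)) := by
  obtain ⟨hx, z, z', hne, hz, hz', h1, h2⟩ := h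
  have key : ∀ z k, K k → OnPath p N K s z → G.Adj x z → G.Adj x (s k) → z ≠ s k →
      (sp ∧ K k₀ ∧ G.Adj x (s k₀) ∧ ∃ j ≤ N, G.Adj x (p j)) := by
    intro z k hk hz hxz hxk hne
    obtain ⟨hsp, rfl, j, hj, rfl⟩ := hI.special_of_ins hg hx hk hxk hz hxz hne
    exact ⟨hsp, hk, hxk, j, hj, hxz⟩
  rcases hz with ⟨i, hi, rfl⟩ | ⟨k, hk, rfl⟩
  · rcases hz' with ⟨j, hj, rfl⟩ | ⟨k', hk', rfl⟩
    · have := hg.two_index hi hj h1 h2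
      have hij : i ≠ j := fun h => hne (by rw [h])
      have : j = i + 1 ∨ j = i + 2 ∨ i = j + 1 ∨ i = j + 2 := by omega
      rcases this with rfl | rfl | rfl | rfl
      · exact Or.inl ⟨i, hj, .of_not_onPath hx, h1, h2⟩
      · exact Or.inr (Or.inl ⟨i, hj, h1, h2⟩)
      · exact Or.inl ⟨j, hi, .of_not_onPath hx, h2, h1⟩
      · exact Or.inr (Or.inl ⟨j, hi, h2, h1⟩)
    · exact Or.inr (Or.inr (key _ k' hk' (.base hi) h1 h2 hne))
  · exact Or.inr (Or.inr (key _ k hk hz' h2 h1 hne.symm))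

/-- A vertex off the path has at most two neighbours on the path. -/
theorem on_three {x a b c : V} (hx : ¬ OnPath p N K s x) (ha : OnPath p N K s a)
    (hb : OnPath p N K s b) (hc : OnPath p N K s c) (hxa : G.Adj x a) (hxb : G.Adj x b)
    (hxc : G.Adj x c) : a = b ∨ a = c ∨ b = c := by
  have key : ∀ k b c, K k → G.Adj x (s k) → OnPath p N K s b → OnPath p N K s c → G.Adj x b →
      G.Adj x c → s k = b ∨ s k = c ∨ b = c := by
    intro k b c hk hxk hb hc hxb hxc
    by_cases h1 : b = s k
    · exact Or.inl h1.symm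
    by_cases h2 : c = s k
    · exact Or.inr (Or.inl h2.symm)
    obtain ⟨-, -, i, hi, rfl⟩ := hI.special_of_ins hg hx hk hxk hb hxb h1
    obtain ⟨-, -, j, hj, rfl⟩ := hI.special_of_ins hg hx hk hxk hc hxc h2
    rw [hI.tip_unique x k i j hx hk hxk hi hj hxb hxc]
    exact Or.inr (Or.inr rfl)
  rcases ha with ⟨i, hi, rfl⟩ | ⟨k, hk, rfl⟩
  · rcases hb with ⟨j, hj, rfl⟩ | ⟨k, hk, rfl⟩
    · rcases hc with ⟨l, hl, rfl⟩ | ⟨k, hk, rfl⟩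
      · rcases hI.three x i j l hx hi hj hl hxa hxb hxc with h | h | h <;> simp [h]
      · have := key k _ _ hk hxc (.base hi) (.base hj) hxa hxb
        tauto
    · have := key k _ _ hk hxb (.base hi) hc hxa hxc
      tauto
  · exact key k b c hk hxa hb hc hxb hxc

/-- Neighbours satisfying `TwoOn` of a vertex without neighbours on the path are not apices. -/
theorem twoOn_cases_of_adj {x t : V} (h : TwoOn G p N K s x) (ht : ¬ OnPath p N K s t)
    (ht' : ∀ z, OnPath p N K s z → ¬ G.Adj t z) (htx : G.Adj t x) :
    (∃ i, i + 2 ≤ N ∧ G.Adj x (p i) ∧ G.Adj x (p (i + 2))) ∨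
      (sp ∧ K k₀ ∧ G.Adj x (s k₀) ∧ ∃ j ≤ N, G.Adj x (p j)) := by
  rcases hI.twoOn_cases hg h with ⟨i, h1⟩ | h1
  · obtain ⟨z, hz, hz'⟩ := hI.third x i t h.1 h1 htx.symm ht
    exact (ht' z hz hz').elim
  · exact h1

/-- Apices are excluded, as their third neighbour meets the path. If x were adjacent to the special
vertex s k₀, a second `TwoOn` neighbour of t would violate `Quiet` or be a fourth neighbour of s k₀.
-/
theorem branch_pp {t x : V} (ht : Branch G p N K s t) (hx : TwoOn G p N K s x)
    (htx : G.Adj t x) : ∃ i, i + 2 ≤ N ∧ G.Adj x (p i) ∧ G.Adj x (p (i + 2)) := by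
  obtain ⟨h1, h2, c, c', hne, hc, hc', htc, htc'⟩ := ht
  have hex : ∃ y, y ≠ x ∧ TwoOn G p N K s y ∧ G.Adj t y := by
    by_cases h : c = x
    · exact ⟨c', fun h' => hne (h.trans h'.symm), hc', htc'⟩
    · exact ⟨c, h, hc, htc⟩
  obtain ⟨y, hyx, hy, hty⟩ := hex
  rcases hI.twoOn_cases_of_adj hg hx h1 h2 htx with h3 | ⟨hsp, hk, hxk, -⟩
  · exact h3
  · have hap := hI.apex _ hk
    have hle := hap.1
    have w1 : WalkFrom G p N 4 k₀ y := (((WalkFrom.one (by omega) hap.2.2.1).step hxk.symm).step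
      htx.symm).step hty
    rcases hI.twoOn_cases_of_adj hg hy h1 h2 hty with ⟨j, hj, h4, h5⟩ | ⟨-, -, hyk, -⟩
    · have hq := hI.quiet hsp y j (.of_not_onPath hy.1) hj h4 h5
      have := w1.bound hg (WalkFrom.one (by omega) h4)
      omega
    · rcases hg.four hap.2.2.1 hap.2.2.2 hxk.symm hyk.symm
        (hg.ne (by omega) hle (by omega)) (fun h => hx.1 (h ▸ .base (by omega)))
        (fun h => hx.1 (h ▸ .base hle)) with h | h | h
      · exact (hy.1 (h ▸ .base (by omega))).elim
      · exact (hy.1 (h ▸ .base hle)).elim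
      · exact (hyx h).elim

/-- The walk c t c' keeps i and j within two of each other. With a difference of 0 or 2, some inner
geodesic vertex would have two neighbours off the geodesic. -/
theorem branch_step (hN : 3 ≤ N) {t c c' : V} (ht : Branch G p N K s t) (hc : TwoOn G p N K s c)
    (hc' : TwoOn G p N K s c') (hne : c ≠ c') (htc : G.Adj t c) (htc' : G.Adj t c') {i j : ℕ}
    (hi : i + 2 ≤ N) (hj : j + 2 ≤ N) (h1 : G.Adj c (p i)) (h2 : G.Adj c (p (i + 2)))
    (h3 : G.Adj c' (p j)) (h4 : G.Adj c' (p (j + 2))) : j = i + 1 ∨ i = j + 1 := by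
  have key : ∀ {c c' : V} {i j : ℕ}, TwoOn G p N K s c → TwoOn G p N K s c' → c ≠ c' →
      G.Adj t c → G.Adj t c' → i + 2 ≤ N → j + 2 ≤ N → G.Adj c (p i) → G.Adj c (p (i + 2)) →
      G.Adj c' (p j) → G.Adj c' (p (j + 2)) → i ≤ j → j = i + 1 := by
    intro c c' i j hc hc' hne htc htc' hi hj h1 h2 h3 h4 hij
    have hO := OffPath.of_not_onPath hc.1
    have hO' := OffPath.of_not_onPath hc'.1
    have w1 : WalkFrom G p N 3 i c' := ((WalkFrom.one (by omega) h1).step htc.symm).step htc'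
    have w2 : WalkFrom G p N 1 (j + 2) c' := .one hj h4
    have := w1.bound hg w2
    by_contra hcon
    have : j = i ∨ j = i + 2 := by omega
    rcases this with rfl | rfl
    · by_cases h5 : 1 ≤ j
      · exact hne (hg.off_unique h5 (by omega) hO hO' h1 h3)
      -- For j = 0 the vertex p j is an end and may have two outer neighbours; p 2 is inner because
      -- 3 ≤ N.
      · exact hne (hg.off_unique (l := j + 2) (by omega) (by omega) hO hO' h2 h4)
    · exact hne (hg.off_unique (l := i + 2) (by omega) (by omega) hO hO' h2 h3)
  rcases le_total i j with h | h
  · exact Or.inl (key hc hc' hne htc htc' hi hj h1 h2 h3 h4 h)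
  · exact Or.inr (key hc' hc hne.symm htc' htc hj hi h3 h4 h1 h2 h)

theorem exists_branchAt (hN : 3 ≤ N) {t : V} (ht : Branch G p N K s t) :
    ∃ i c c', BranchAt G p N K s i t c c' ∧ TwoOn G p N K s c ∧ TwoOn G p N K s c' := by
  obtain ⟨c, c', hne, hc, hc', htc, htc'⟩ := ht.2.2
  obtain ⟨i, hi, h1, h2⟩ := hI.branch_pp hg ht hc htc
  obtain ⟨j, hj, h3, h4⟩ := hI.branch_pp hg ht hc' htc'
  rcases hI.branch_step hg hN ht hc hc' hne htc htc' hi hj h1 h2 h3 h4 with rfl | rfl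
  · exact ⟨i, c, c', ⟨hj, hc.1, hc'.1, hne, htc, htc', h1, h2, h3, h4⟩, hc, hc'⟩
  · exact ⟨j, c', c, ⟨hi, hc'.1, hc.1, hne.symm, htc', htc, h3, h4, h1, h2⟩, hc', hc⟩

theorem branch_twoOn (hN : 3 ≤ N) {t x c c' : V} {i : ℕ} (ht : Branch G p N K s t)
    (h : BranchAt G p N K s i t c c') (hx : TwoOn G p N K s x) (htx : G.Adj t x) :
    x = c ∨ x = c' := by
  obtain ⟨j, hj, h1, h2⟩ := hI.branch_pp hg ht hx htx
  have hle := h.le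
  have hc : TwoOn G p N K s c := ⟨h.not_on, _, _, hg.ne (by omega) (by omega) (by omega),
    .base (by omega), .base (by omega), h.adj_zero, h.adj_two⟩
  have hc' : TwoOn G p N K s c' := ⟨h.not_on', _, _, hg.ne (by omega) (by omega) (by omega),
    .base (by omega), .base (by omega), h.adj_one, h.adj_three⟩
  by_contra hcon
  push Not at hcon
  have h3 := hI.branch_step hg hN ht hc hx hcon.1.symm h.adj htx (by omega) hj h.adj_zero h.adj_two
    h1 h2
  have h4 := hI.branch_step hg hN ht hc' hx hcon.2.symm h.adj' htx (by omega) hj h.adj_one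
    h.adj_three h1 h2
  omega

/-- The vertex at the third edge. -/
theorem branch_unique (hN : 3 ≤ N) {t x y : V} (ht : Branch G p N K s t)
    (hx : ¬ TwoOn G p N K s x) (hy : ¬ TwoOn G p N K s y) (htx : G.Adj t x) (hty : G.Adj t y) :
    x = y := by
  obtain ⟨i, c, c', h, hc, hc'⟩ := hI.exists_branchAt hg hN ht
  rcases hg.four h.adj h.adj' htx hty h.ne (fun h => hx (h ▸ hc)) (fun h => hx (h ▸ hc'))
    with h1 | h1 | h1
  · exact (hy (h1 ▸ hc)).elim
  · exact (hy (h1 ▸ hc')).elim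
  · exact h1.symm

/-- A common neighbour brings the indices of the two branches within three of each other, so
`index_unique` applies. -/
theorem branch_nbr_unique (hN : 3 ≤ N) {t t' x : V} (ht : Branch G p N K s t)
    (ht' : Branch G p N K s t') (htx : G.Adj t x) (htx' : G.Adj t' x) : t = t' := by
  obtain ⟨i, c, c', h, -⟩ := hI.exists_branchAt hg hN ht
  obtain ⟨j, d, d', h', -⟩ := hI.exists_branchAt hg hN ht'
  have h1 := ((h.walk (l := i + 3) (by omega) le_rfl).step htx).bound hg
    ((h'.walk (l := j) le_rfl (by omega)).step htx')
  have h2 := ((h.walk (l := i) le_rfl (by omega)).step htx).bound hg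
    ((h'.walk (l := j + 3) (by omega) le_rfl).step htx')
  exact h.index_unique hg ht.1 ht'.1 h' (by omega) (by omega)

theorem branch_not_adj (hN : 3 ≤ N) {t t' : V} (ht : Branch G p N K s t)
    (ht' : Branch G p N K s t') : ¬ G.Adj t t' := by
  intro htt
  obtain ⟨i, c, c', h, -⟩ := hI.exists_branchAt hg hN ht
  obtain ⟨j, d, d', h', -⟩ := hI.exists_branchAt hg hN ht'
  have h1 := ((h.walk (l := i + 3) (by omega) le_rfl).step htt).bound hg
    (h'.walk (l := j) le_rfl (by omega))
  have h2 := ((h.walk (l := i) le_rfl (by omega)).step htt).bound hg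
    (h'.walk (l := j + 3) (by omega) le_rfl)
  exact htt.ne (h.index_unique hg ht.1 ht'.1 h' (by omega) (by omega))

theorem branchEdge_unique (hN : 3 ≤ N) {x a b : V} (ha : BranchEdge G p N K s x a)
    (hb : BranchEdge G p N K s x b) : a = b := by
  obtain ⟨hxa, ⟨h1, h2⟩ | ⟨h1, h2⟩⟩ := ha <;> obtain ⟨hxb, ⟨h3, h4⟩ | ⟨h3, h4⟩⟩ := hb
  · exact hI.branch_unique hg hN h1 h2 h4 hxa hxb
  · exact (hI.branch_not_adj hg hN h1 h3 hxb).elim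
  · exact (hI.branch_not_adj hg hN h1 h3 hxa.symm).elim
  · exact hI.branch_nbr_unique hg hN h1 h3 hxa.symm hxb.symm

theorem branchEdge_not_twoOn {a b : V} (h : BranchEdge G p N K s a b) : ¬ TwoOn G p N K s a := by
  intro h2
  rcases h.2 with ⟨h1, -⟩ | ⟨-, h1⟩
  · obtain ⟨-, z, -, -, hz, -, haz, -⟩ := h2
    exact h1.2.1 z hz haz
  · exact h1 h2

end IsInsertion

end marks

/-! ### Ends of branch edges -/

section marks

variable {V : Type*} {G : SimpleGraph V} {p : ℕ → V} {N : ℕ} {K : ℕ → Prop} {s : ℕ → V}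
  {sp : Prop} {k₀ : ℕ}

/-- Vertices off the path with one neighbour on the path and one neighbour satisfying `Branch`. -/
def BranchEnd (G : SimpleGraph V) (p : ℕ → V) (N : ℕ) (K : ℕ → Prop) (s : ℕ → V) (a : V) : Prop :=
  ¬ OnPath p N K s a ∧ ¬ TwoOn G p N K s a ∧ (∃ z, OnPath p N K s z ∧ G.Adj a z) ∧
    ∃ t, Branch G p N K s t ∧ G.Adj t a

/-- `a` is attached to the path to the right of a vertex satisfying `Branch`. -/
def EndsRight (G : SimpleGraph V) (p : ℕ → V) (N : ℕ) (K : ℕ → Prop) (s : ℕ → V) (i : ℕ) (a : V) :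
    Prop :=
  (i + 4 ≤ N ∧ G.Adj a (p (i + 4))) ∨
    (i + 5 ≤ N ∧ ∃ y, OnPath p N K s y ∧ OffPath p N y ∧ G.Adj y a ∧ G.Adj y (p (i + 4)) ∧
      G.Adj y (p (i + 5))) ∨
    (i + 3 = N ∧ G.Adj a (p (i + 3)))

/-- `a` is attached to the path to the left of a vertex satisfying `Branch`. -/
def EndsLeft (G : SimpleGraph V) (p : ℕ → V) (N : ℕ) (K : ℕ → Prop) (s : ℕ → V) (i : ℕ) (a : V) :
    Prop :=
  (1 ≤ i ∧ G.Adj a (p (i - 1))) ∨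
    (2 ≤ i ∧ ∃ y, OnPath p N K s y ∧ OffPath p N y ∧ G.Adj y a ∧ G.Adj y (p (i - 1)) ∧
      G.Adj y (p (i - 2))) ∨
    (i = 0 ∧ G.Adj a (p i))

namespace IsInsertion

variable (hg : IsGeodesic G p N) (hI : IsInsertion G p N K s sp k₀)
include hg hI

/-- The inner vertices among p i, …, p (i+3) have no outer neighbour besides c and c', and distances
confine the attachment of a. What remains is the next geodesic vertex on either side, an inserted
apex over the next edge, or an end of the geodesic. -/
theorem endsLeft_or_endsRight {a t c c' z : V} {i : ℕ} (h : BranchAt G p N K s i t c c')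
    (ha : ¬ OnPath p N K s a) (hac : a ≠ c) (hac' : a ≠ c') (hta : G.Adj t a)
    (hz : OnPath p N K s z) (haz : G.Adj a z) :
    EndsLeft G p N K s i a ∨ EndsRight G p N K s i a := by
  have hO := OffPath.of_not_onPath ha
  have hle := h.le
  have w1 := (h.walk (l := i) le_rfl (by omega)).step hta
  have w2 := (h.walk (l := i + 3) (by omega) le_rfl).step hta
  rcases hz with ⟨l, hl, rfl⟩ | ⟨k, hk, rfl⟩
  · have w3 := WalkFrom.one hl haz
    have h1 := w1.bound hg w3
    have h2 := w2.bound hg w3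
    have h3 : ¬ (i ≤ l ∧ l ≤ i + 3 ∧ 1 ≤ l ∧ l < N) := fun ⟨h4, h5, h6, h7⟩ => by
      rcases h.absorb hg hO h4 h5 h6 h7 haz with h8 | h8
      · exact hac h8
      · exact hac' h8
    have h4 : l = i + 4 ∨ (1 ≤ i ∧ l = i - 1) ∨ (l = i ∧ i = 0) ∨ (l = i + 3 ∧ i + 3 = N) := by
      omega
    rcases h4 with rfl | ⟨h4, rfl⟩ | ⟨rfl, h4⟩ | ⟨rfl, h4⟩
    · exact Or.inr (Or.inl ⟨hl, haz⟩)
    · exact Or.inl (Or.inl ⟨h4, haz⟩)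
    · exact Or.inl (Or.inr (Or.inr ⟨h4, haz⟩))
    · exact Or.inr (Or.inr (Or.inr ⟨h4, haz⟩))
  · have hap := hI.apex k hk
    have hk1 := hap.1
    have w3 := (WalkFrom.one (N := N) (by omega) hap.2.2.1).step haz.symm
    have w4 := (WalkFrom.one (N := N) hk1 hap.2.2.2).step haz.symm
    have h1 := w1.bound hg w4
    have h2 := w2.bound hg w3
    have hOn : OnPath p N K s (s k) := .ins hk
    have h3 : ∀ l, G.Adj (s k) (p l) → ¬ (i ≤ l ∧ l ≤ i + 3 ∧ 1 ≤ l ∧ l < N) :=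
      fun l hkl ⟨h4, h5, h6, h7⟩ => by
        rcases h.absorb hg hap.2.1 h4 h5 h6 h7 hkl with h8 | h8
        · exact h.not_on (h8 ▸ hOn)
        · exact h.not_on' (h8 ▸ hOn)
    have h4 := h3 _ hap.2.2.1
    have h5 := h3 _ hap.2.2.2
    have h6 : k = i + 4 ∨ (2 ≤ i ∧ k = i - 2) := by omega
    rcases h6 with rfl | ⟨h6, rfl⟩
    · exact Or.inr (Or.inr (Or.inl ⟨hk1, _, hOn, hap.2.1, haz.symm, hap.2.2.1, hap.2.2.2⟩))
    · have h7 := hap.2.2.2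
      rw [show i - 2 + 1 = i - 1 by omega] at h7
      exact Or.inl (Or.inr (Or.inl ⟨h6, _, hOn, hap.2.1, haz.symm, h7, hap.2.2.1⟩))

/-- Here b is joined to some p j and p (j+2). Distances put one of these where a, or the inserted
apex next to a, is attached, and there an inner geodesic vertex has room for only one outer
neighbour. If b is adjacent to s k₀, the branch contradicts `Quiet`. -/
theorem not_branchEnd_twoOn (hN : 3 ≤ N) {x a b : V} (hx : ¬ OnPath p N K s x)
    (hx' : ∀ z, OnPath p N K s z → ¬ G.Adj x z) (hxT : ¬ Branch G p N K s x)
    (ha : BranchEnd G p N K s a) (hb : TwoOn G p N K s b) (hxa : G.Adj x a) (hxb : G.Adj x b) :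
    False := by
  obtain ⟨haO, ha2, ⟨z, hz, haz⟩, t, ht, hta⟩ := ha
  obtain ⟨i, c, c', h, hc, hc'⟩ := hI.exists_branchAt hg hN ht
  have hle := h.le
  have w1 := ((h.walk (l := i) le_rfl (by omega)).step hta).step hxa.symm |>.step hxb
  have w2 := ((h.walk (l := i + 3) (by omega) le_rfl).step hta).step hxa.symm |>.step hxb
  have hbO := OffPath.of_not_onPath hb.1
  have haO' := OffPath.of_not_onPath haO
  have hab : a ≠ b := fun h => ha2 (h ▸ hb)
  rcases hI.twoOn_cases_of_adj hg hb hx hx' hxb with ⟨j, hj, h1, h2⟩ | ⟨hsp, hk, hbk, -⟩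
  · have hcore : ∀ l, G.Adj b (p l) → ¬ (i ≤ l ∧ l ≤ i + 3 ∧ 1 ≤ l ∧ l < N) :=
      fun l hbl ⟨h4, h5, h6, h7⟩ =>
        hxT (h.nbr hg ht.1 (h.absorb hg hbO h4 h5 h6 h7 hbl) hxb.symm hx ▸ ht)
    have h3 := hcore _ h1
    have h4 := hcore _ h2
    have h5 := w1.bound hg (WalkFrom.one hj h2)
    have h6 := w2.bound hg (WalkFrom.one (N := N) (by omega) h1)
    rcases hI.endsLeft_or_endsRight hg h haO (fun h => ha2 (h ▸ hc)) (fun h => ha2 (h ▸ hc')) hta hz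
      haz with (⟨h7, h8⟩ | ⟨h7, y, hy, hyO, hya, hy1, hy2⟩ | ⟨h7, h8⟩) |
      (⟨h7, h8⟩ | ⟨h7, y, hy, hyO, hya, hy1, hy2⟩ | ⟨h7, h8⟩)
    · have w3 := ((WalkFrom.one (N := N) (by omega) h8).step hxa.symm).step hxb
      have h9 := w3.bound hg (WalkFrom.one (N := N) (by omega) h1)
      have h10 := w3.bound hg (WalkFrom.one hj h2)
      have h11 : j + 2 = i - 1 := by omega
      rw [h11] at h2
      exact hab (hg.off_unique (by omega) (by omega) haO' hbO h8 h2)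
    · have w3 := (((WalkFrom.one (N := N) (by omega) hy2).step hya).step hxa.symm).step hxb
      have h9 := w3.bound hg (WalkFrom.one (N := N) (by omega) h1)
      have h10 := w3.bound hg (WalkFrom.one hj h2)
      have h11 : j + 2 = i - 1 := by omega
      rw [h11] at h2
      exact hb.1 (hg.off_unique (by omega) (by omega) hyO hbO hy1 h2 ▸ hy)
    · have w3 := ((WalkFrom.one (N := N) (by omega) h8).step hxa.symm).step hxb
      have h10 := w3.bound hg (WalkFrom.one hj h2)
      omega
    · have w3 := ((WalkFrom.one (N := N) (by omega) h8).step hxa.symm).step hxb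
      have h9 := w3.bound hg (WalkFrom.one (N := N) (by omega) h1)
      have h10 := w3.bound hg (WalkFrom.one hj h2)
      have h11 : j = i + 4 := by omega
      rw [h11] at h1
      exact hab (hg.off_unique (by omega) (by omega) haO' hbO h8 h1)
    · have w3 := (((WalkFrom.one (N := N) (by omega) hy2).step hya).step hxa.symm).step hxb
      have h9 := w3.bound hg (WalkFrom.one (N := N) (by omega) h1)
      have h10 := w3.bound hg (WalkFrom.one hj h2)
      have h11 : j = i + 4 := by omega
      rw [h11] at h1
      exact hb.1 (hg.off_unique (by omega) (by omega) hyO hbO hy1 h1 ▸ hy)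
    · have w3 := ((WalkFrom.one (N := N) (by omega) h8).step hxa.symm).step hxb
      have h9 := w3.bound hg (WalkFrom.one (N := N) (by omega) h1)
      omega
  · have hap := hI.apex _ hk
    have hk1 := hap.1
    have hq := hI.quiet hsp c i (.of_not_onPath hc.1) (by omega) h.adj_zero h.adj_two
    have w3 := (WalkFrom.one (N := N) (by omega) hap.2.2.1).step hbk.symm
    have := w1.bound hg w3
    omega

/-- Different branches at i < j satisfy i + 4 ≤ j, and the walk through x gives j ≤ i + 5. Hence a
is attached to the right of the first branch and b to the left of the second. This is possible only
for j = i + 5 with both attached at p (i+4), which has one outer neighbour. -/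
theorem branchEnd_unique (hN : 3 ≤ N) {x a b : V}
    (ha : BranchEnd G p N K s a) (hb : BranchEnd G p N K s b) (hxa : G.Adj x a)
    (hxb : G.Adj x b) : a = b := by
  obtain ⟨haO, ha2, ⟨z, hz, haz⟩, t, ht, hta⟩ := ha
  obtain ⟨hbO, hb2, ⟨z', hz', hbz'⟩, t', ht', htb⟩ := hb
  obtain ⟨i, c, c', h, hc, hc'⟩ := hI.exists_branchAt hg hN ht
  obtain ⟨j, d, d', h', hd, hd'⟩ := hI.exists_branchAt hg hN ht'
  by_cases htt : t = t'
  · subst htt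
    exact hI.branch_unique hg hN ht ha2 hb2 hta htb
  have key : ∀ {i j : ℕ} {t c c' t' d d' a b z z' : V}, Branch G p N K s t → Branch G p N K s t' →
      BranchAt G p N K s i t c c' → BranchAt G p N K s j t' d d' → ¬ OnPath p N K s a →
      ¬ OnPath p N K s b → G.Adj x a → G.Adj x b → G.Adj t a → G.Adj t' b → a ≠ c → a ≠ c' →
      b ≠ d → b ≠ d' → a ≠ d → a ≠ d' → b ≠ c → b ≠ c' → OnPath p N K s z → OnPath p N K s z' →
      G.Adj a z → G.Adj b z' → t ≠ t' → i ≤ j → a = b := by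
    intro i j t c c' t' d d' a b z z' ht ht' h h' haO hbO hxa hxb hta htb hac hac' hbd hbd' had had'
      hbc hbc' hz hz' haz hbz htt hij
    have hle := h.le
    have hle' := h'.le
    have h0 : ¬ j ≤ i + 3 := fun h1 => htt (h.index_unique hg ht.1 ht'.1 h' (by omega) h1)
    have w1 := ((h.walk (l := i) le_rfl (by omega)).step hta).step hxa.symm
    have w2 := ((h'.walk (l := j + 3) (by omega) le_rfl).step htb).step hxb.symm
    have h1 := w1.bound hg w2
    have haO' := OffPath.of_not_onPath haO
    have hbO' := OffPath.of_not_onPath hbO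
    have h2 : EndsRight G p N K s i a := by
      refine (hI.endsLeft_or_endsRight hg h haO hac hac' hta hz haz).resolve_left ?_
      rintro (⟨h7, h8⟩ | ⟨h7, y, hy, hyO, hya, hy1, hy2⟩ | ⟨h7, h8⟩)
      · have := ((WalkFrom.one (N := N) (by omega) h8).step hxa.symm).bound hg w2
        omega
      · have := (((WalkFrom.one (N := N) (by omega) hy2).step hya).step hxa.symm).bound hg w2
        omega
      · have := ((WalkFrom.one (N := N) (by omega) h8).step hxa.symm).bound hg w2
        omega
    have h3 : EndsLeft G p N K s j b := by
      refine (hI.endsLeft_or_endsRight hg h' hbO hbd hbd' htb hz' hbz).resolve_right ?_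
      rintro (⟨h7, h8⟩ | ⟨h7, y, hy, hyO, hya, hy1, hy2⟩ | ⟨h7, h8⟩)
      · have := ((WalkFrom.one (N := N) (by omega) h8).step hxb.symm).bound hg w1
        omega
      · have := (((WalkFrom.one (N := N) (by omega) hy2).step hya).step hxb.symm).bound hg w1
        omega
      · have := ((WalkFrom.one (N := N) (by omega) h8).step hxb.symm).bound hg w1
        omega
    have habs : ∀ y l, OffPath p N y → (y = a ∨ OnPath p N K s y) → G.Adj y (p l) → ¬ (j ≤ l ∧
        l ≤ j + 3 ∧ 1 ≤ l ∧ l < N) := fun y l hy hy' hyl ⟨h4, h5, h6, h7⟩ => by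
      rcases h'.absorb hg hy h4 h5 h6 h7 hyl with rfl | rfl <;> rcases hy' with rfl | hy'
      · exact had rfl
      · exact h'.not_on hy'
      · exact had' rfl
      · exact h'.not_on' hy'
    rcases h2 with ⟨h7, h8⟩ | ⟨h7, y, hy, hyO, hya, hy1, hy2⟩ | ⟨h7, h8⟩
    · have h9 := habs a _ haO' (Or.inl rfl) h8
      have hj : j = i + 5 := by omega
      subst hj
      rcases h3 with ⟨h10, h11⟩ | ⟨h10, y, hy, hyO, hya, hy1, hy2⟩ | ⟨h10, h11⟩
      · exact hg.off_unique (l := i + 4) (by omega) (by omega) haO' hbO' h8 h11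
      · exact (haO (hg.off_unique (l := i + 4) (by omega) (by omega) haO' hyO h8 hy1 ▸ hy)).elim
      · omega
    · have h9 := habs y _ hyO (Or.inr hy) hy1
      have h10 := habs y _ hyO (Or.inr hy) hy2
      omega
    · omega
  rcases le_total i j with h1 | h1
  · exact key ht ht' h h' haO hbO hxa hxb hta htb (fun h => ha2 (h ▸ hc)) (fun h => ha2 (h ▸ hc'))
      (fun h => hb2 (h ▸ hd)) (fun h => hb2 (h ▸ hd')) (fun h => ha2 (h ▸ hd))
      (fun h => ha2 (h ▸ hd')) (fun h => hb2 (h ▸ hc)) (fun h => hb2 (h ▸ hc')) hz hz' haz hbz' htt h1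
  · exact (key ht' ht h' h hbO haO hxb hxa htb hta (fun h => hb2 (h ▸ hd)) (fun h => hb2 (h ▸ hd'))
      (fun h => ha2 (h ▸ hc)) (fun h => ha2 (h ▸ hc')) (fun h => hb2 (h ▸ hc))
      (fun h => hb2 (h ▸ hc')) (fun h => ha2 (h ▸ hd)) (fun h => ha2 (h ▸ hd')) hz' hz hbz' haz
      (Ne.symm htt) h1).symm

theorem branchEdge_of_branch (hN : 3 ≤ N) {t : V} (ht : Branch G p N K s t) :
    ∃ r, BranchEdge G p N K s t r := by
  obtain ⟨i, c, c', h, -⟩ := hI.exists_branchAt hg hN ht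
  obtain ⟨r, htr, h1, h2⟩ := hg.exists_third t c c'
  refine ⟨r, htr, Or.inl ⟨ht, fun h3 => ?_⟩⟩
  rcases hI.branch_twoOn hg hN ht h h3 htr with h4 | h4
  · exact h1 h4
  · exact h2 h4

/-- A vertex without neighbours on the path and without `BranchEdge` has at most one neighbour
that satisfies `TwoOn` or `BranchEnd`. -/
theorem marked_unique (hN : 3 ≤ N) {x a b : V} (hx : ¬ OnPath p N K s x)
    (hx' : ∀ z, OnPath p N K s z → ¬ G.Adj x z) (hxE : ∀ r, ¬ BranchEdge G p N K s x r)
    (ha : TwoOn G p N K s a ∨ BranchEnd G p N K s a)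
    (hb : TwoOn G p N K s b ∨ BranchEnd G p N K s b) (hxa : G.Adj x a) (hxb : G.Adj x b) :
    a = b := by
  have hxT : ¬ Branch G p N K s x := fun h =>
    let ⟨r, hr⟩ := hI.branchEdge_of_branch hg hN h
    hxE r hr
  rcases ha with ha | ha <;> rcases hb with hb | hb
  · by_contra hne
    exact hxT ⟨hx, hx', a, b, hne, ha, hb, hxa, hxb⟩
  · exact (hI.not_branchEnd_twoOn hg hN hx hx' hxT hb ha hxb hxa).elim
  · exact (hI.not_branchEnd_twoOn hg hN hx hx' hxT ha hb hxa hxb).elim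
  · exact hI.branchEnd_unique hg hN ha hb hxa hxb

end IsInsertion

end marks

/-! ### Validity of the scheme of a path with insertions -/

section scheme

variable {V : Type*} {G : SimpleGraph V} {p : ℕ → V} {N : ℕ} {K : ℕ → Prop} {s : ℕ → V}
  {sp : Prop} {k₀ : ℕ}

/-- No vertex off the geodesic has two neighbours on the geodesic close to `p j`. -/
def ClearAt (G : SimpleGraph V) (p : ℕ → V) (N j : ℕ) : Prop :=
  ∀ y i i', OffPath p N y → i < i' → i' ≤ N → G.Adj y (p i) → G.Adj y (p i') →
    i + 20 < j ∨ j + 20 < i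

/-- The colour scheme of the path obtained from a geodesic by an insertion. -/
noncomputable def insScheme (G : SimpleGraph V) (p : ℕ → V) (N : ℕ) (K : ℕ → Prop) (s : ℕ → V)
    (m ℓ : ℕ) (Ee : V → V → Prop) (U0 : Set V) : ColourScheme V where
  G := G
  P := {x | ∃ i ≤ N, x = p i}
  q := insPath p K s
  M := insPos K N
  m := m
  ℓ := ℓ
  Er a b := BranchEdge G p N K s a b ∨ Ee a b
  U0 := U0

/-- Edges outside of the path that are coloured red for the sake of the gadget. -/
def ExtraMark (G : SimpleGraph V) (p : ℕ → V) (N : ℕ) (K : ℕ → Prop) (s : ℕ → V)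
    (Ee : V → V → Prop) (a b : V) : Prop :=
  G.Adj a b ∧ (OnPath p N K s b ∨ Ee a b)

/-- The conditions for additional red edges `Ee` and additional saturated vertices `U0`. -/
structure IsExtra (G : SimpleGraph V) (p : ℕ → V) (N : ℕ) (K : ℕ → Prop) (s : ℕ → V)
    (Ee : V → V → Prop) (U0 : Set V) : Prop where
  symm : ∀ a b, Ee a b → Ee b a
  adj : ∀ a b, Ee a b → G.Adj a b
  off : ∀ a b, Ee a b → ¬ OnPath p N K s a
  clear : ∀ a, (a ∈ U0 ∨ ∃ z, Ee a z) → ∃ d ≤ 3, ∃ j, WalkFrom G p N d j a ∧ ClearAt G p N j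
  max : ∀ x z a b c, Ee x z → ExtraMark G p N K s Ee x a → ExtraMark G p N K s Ee x b →
    ExtraMark G p N K s Ee x c → a = b ∨ a = c ∨ b = c
  no_mark : ∀ x a b, ¬ OnPath p N K s x → (∀ z, ¬ ExtraMark G p N K s Ee x z) →
    (a ∈ U0 ∨ ∃ z z', Ee a z ∧ z ≠ z' ∧ ExtraMark G p N K s Ee a z') →
    (b ∈ U0 ∨ ∃ z z', Ee b z ∧ z ≠ z' ∧ ExtraMark G p N K s Ee b z') →
    G.Adj x a → G.Adj x b → a = b

theorem WalkFrom.near {d D i : ℕ} {x : V} (h : WalkFrom G p N d i x) (hd : d ≤ D) {m ℓ : ℕ}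
    {Ee : V → V → Prop} {U0 : Set V} : (insScheme G p N K s m ℓ Ee U0).Near D x := by
  obtain ⟨hi, w, rfl⟩ := h
  refine ⟨p i, ⟨i, hi, rfl⟩, ?_⟩
  have h1 := SimpleGraph.Walk.edist_le w.reverse
  rw [SimpleGraph.Walk.length_reverse] at h1
  exact h1.trans (by exact_mod_cast hd)

theorem mark_insScheme {m ℓ : ℕ} {Ee : V → V → Prop} {U0 : Set V}
    (hI : IsInsertion G p N K s sp k₀) {a b : V} :
    (insScheme G p N K s m ℓ Ee U0).Mark a b ↔
      BranchEdge G p N K s a b ∨ ExtraMark G p N K s Ee a b := by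
  have h1 : (insScheme G p N K s m ℓ Ee U0).Z b ↔ OnPath p N K s b := hI.exists_iff
  unfold ColourScheme.Mark ExtraMark
  rw [h1]
  constructor
  · rintro ⟨h2, h3 | h3 | h3⟩
    · exact Or.inr ⟨h2, Or.inl h3⟩
    · exact Or.inl h3
    · exact Or.inr ⟨h2, Or.inr h3⟩
  · rintro (h2 | ⟨h2, h3 | h3⟩)
    · exact ⟨h2.1, Or.inr (Or.inl h2)⟩
    · exact ⟨h2, Or.inl h3⟩
    · exact ⟨h2, Or.inr (Or.inr h3)⟩

namespace IsInsertion

variable (hg : IsGeodesic G p N) (hI : IsInsertion G p N K s sp k₀)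
include hg hI

/-- The structure treated by insertions and branches lies close to a vertex with two geodesic
neighbours. It is therefore absent near the clear places that carry extra edges, and the two kinds
of marks do not interfere. -/
theorem core_index (hN : 3 ≤ N) {a : V} (ha : TwoOn G p N K s a ∨ Branch G p N K s a ∨
    ∃ t, Branch G p N K s t ∧ G.Adj t a) :
    ∃ d ≤ 3, ∃ i, WalkFrom G p N d i a ∧ ∃ y i', OffPath p N y ∧ i < i' ∧ i' ≤ N ∧
      G.Adj y (p i) ∧ G.Adj y (p i') := by
  have key : ∀ t, Branch G p N K s t → ∃ i, WalkFrom G p N 2 i t ∧ ∃ y i', OffPath p N y ∧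
      i < i' ∧ i' ≤ N ∧ G.Adj y (p i) ∧ G.Adj y (p i') := by
    intro t ht
    obtain ⟨i, c, c', h, -⟩ := hI.exists_branchAt hg hN ht
    have := h.le
    exact ⟨i, h.walk le_rfl (by omega), c, i + 2, .of_not_onPath h.not_on, by omega, by omega,
      h.adj_zero, h.adj_two⟩
  rcases ha with ha | ha | ⟨t, ht, hta⟩
  · rcases hI.twoOn_cases hg ha with ⟨i, hi, h1, h2, h3⟩ | ⟨i, hi, h2, h3⟩ | ⟨hsp, hk, h2, -⟩
    · exact ⟨1, by omega, i, .one (by omega) h2, a, i + 1, h1, by omega, hi, h2, h3⟩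
    · exact ⟨1, by omega, i, .one (by omega) h2, a, i + 2, .of_not_onPath ha.1, by omega, hi, h2,
        h3⟩
    · obtain ⟨h3, h4, h5, h6⟩ := hI.apex _ hk
      exact ⟨2, by omega, k₀, (WalkFrom.one (by omega) h5).step h2.symm, _, k₀ + 1, h4, by omega,
        h3, h5, h6⟩
  · obtain ⟨i, h1, h2⟩ := key a ha
    exact ⟨2, by omega, i, h1, h2⟩
  · obtain ⟨i, h1, h2⟩ := key t ht
    exact ⟨3, le_rfl, i, h1.step hta, h2⟩

theorem not_core_of_clearAt (hN : 3 ≤ N) {a : V} {d j : ℕ} (hj : ClearAt G p N j)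
    (hw : WalkFrom G p N d j a) (hd : d ≤ 16) : ¬ (TwoOn G p N K s a ∨ Branch G p N K s a ∨
    ∃ t, Branch G p N K s t ∧ G.Adj t a) := by
  intro h
  obtain ⟨e, he, i, h1, y, i', hy, hii, hi', h2, h3⟩ := hI.core_index hg hN h
  have h4 := hj y i i' hy hii hi' h2 h3
  have := h1.bound hg hw
  omega

theorem not_branchEdge_of_clearAt (hN : 3 ≤ N) {a b : V} {d j : ℕ} (hj : ClearAt G p N j)
    (hw : WalkFrom G p N d j a) (hd : d ≤ 16) : ¬ BranchEdge G p N K s a b := by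
  rintro ⟨hab, ⟨h, -⟩ | ⟨h, -⟩⟩
  · exact hI.not_core_of_clearAt hg hN hj hw hd (Or.inr (Or.inl h))
  · exact hI.not_core_of_clearAt hg hN hj hw hd (Or.inr (Or.inr ⟨b, h, hab.symm⟩))

theorem insScheme_mark2 (hN : 3 ≤ N) {m ℓ : ℕ} {Ee : V → V → Prop} {U0 : Set V}
    (hE : IsExtra G p N K s Ee U0) {x : V} (hx : (insScheme G p N K s m ℓ Ee U0).Mark2 x) :
    (TwoOn G p N K s x ∨ BranchEnd G p N K s x) ∨
      ∃ z z', Ee x z ∧ z ≠ z' ∧ ExtraMark G p N K s Ee x z' := by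
  obtain ⟨hxZ, a, b, hab, ha, hb⟩ := hx
  have hxO : ¬ OnPath p N K s x := fun h => hxZ (hI.exists_iff.2 h)
  rw [mark_insScheme hI] at ha hb
  by_cases hex : ∃ z, Ee x z
  · obtain ⟨d, hd, j, hw, hj⟩ := hE.clear x (Or.inr hex)
    have hno : ∀ b, ¬ BranchEdge G p N K s x b := fun b =>
      hI.not_branchEdge_of_clearAt hg hN hj hw (by omega)
    obtain ⟨z, hz⟩ := hex
    by_cases h : z = a
    · exact Or.inr ⟨z, b, hz, fun h' => hab (h.symm.trans h'), hb.resolve_left (hno b)⟩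
    · exact Or.inr ⟨z, a, hz, h, ha.resolve_left (hno a)⟩
  · push Not at hex
    have key : ∀ a b, BranchEdge G p N K s x a → OnPath p N K s b → G.Adj x b →
        BranchEnd G p N K s x := by
      intro a b ha hb hxb
      rcases ha.2 with ⟨h1, -⟩ | ⟨h1, -⟩
      · exact (h1.2.1 b hb hxb).elim
      · exact ⟨hxO, hI.branchEdge_not_twoOn hg ha, ⟨b, hb, hxb⟩, a, h1, ha.1.symm⟩
    left
    rcases ha with ha | ⟨ha, h1 | h1⟩ <;> rcases hb with hb | ⟨hb, h2 | h2⟩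
    · exact (hab (hI.branchEdge_unique hg hN ha hb)).elim
    · exact Or.inr (key _ _ ha h2 hb)
    · exact (hex _ h2).elim
    · exact Or.inr (key _ _ hb h1 ha)
    · exact Or.inl ⟨hxO, a, b, hab, h1, h2, ha, hb⟩
    · exact (hex _ h2).elim
    · exact (hex _ h1).elim
    · exact (hex _ h1).elim
    · exact (hex _ h1).elim

/-- The tip is the branch vertex t: the third edge is its only mark, and its two other neighbours
have exactly two neighbours on the path, which are not adjacent. -/
theorem insScheme_isTip (hN : 3 ≤ N) {m ℓ : ℕ} {Ee : V → V → Prop} {U0 : Set V}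
    (hE : IsExtra G p N K s Ee U0) {a b : V} (h : BranchEdge G p N K s a b) :
    (insScheme G p N K s m ℓ Ee U0).IsTip a b ∨ (insScheme G p N K s m ℓ Ee U0).IsTip b a := by
  have hZ : ∀ x, (insScheme G p N K s m ℓ Ee U0).Z x ↔ OnPath p N K s x := fun x => hI.exists_iff
  have key : ∀ t r, G.Adj t r → Branch G p N K s t → ¬ TwoOn G p N K s r →
      (insScheme G p N K s m ℓ Ee U0).IsTip t r := by
    intro t r htr ht hr
    have htE : ∀ z, ¬ Ee t z := fun z hz => by
      obtain ⟨d, hd, j, hw, hj⟩ := hE.clear t (Or.inr ⟨z, hz⟩)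
      exact hI.not_core_of_clearAt hg hN hj hw (by omega) (Or.inr (Or.inl ht))
    refine ⟨fun c hc => ?_, fun c hc => ?_⟩
    · rw [mark_insScheme hI] at hc
      rcases hc with hc | ⟨hc, h1 | h1⟩
      · exact hI.branchEdge_unique hg hN hc ⟨htr, Or.inl ⟨ht, hr⟩⟩
      · exact (ht.2.1 c h1 hc).elim
      · exact (htE _ h1).elim
    · obtain ⟨i, d, d', hB, hd, hd'⟩ := hI.exists_branchAt hg hN ht
      have hle := hB.le
      have htp : ∀ i ≤ N, t ≠ p i := OffPath.of_not_onPath ht.1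
      have main : ∀ (d : V) (i : ℕ), G.Adj d t → ¬ OnPath p N K s d → i + 2 ≤ N → G.Adj d (p i) →
          G.Adj d (p (i + 2)) → ¬ (insScheme G p N K s m ℓ Ee U0).Z d ∧ ∃ z z', z ≠ z' ∧
          (insScheme G p N K s m ℓ Ee U0).Z z ∧ (insScheme G p N K s m ℓ Ee U0).Z z' ∧
          (insScheme G p N K s m ℓ Ee U0).G.Adj d z ∧ (insScheme G p N K s m ℓ Ee U0).G.Adj d z' ∧
          ¬ (insScheme G p N K s m ℓ Ee U0).G.Adj z z' ∧
          ∀ y, (insScheme G p N K s m ℓ Ee U0).Z y → (insScheme G p N K s m ℓ Ee U0).G.Adj d y →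
            y = z ∨ y = z' := by
        intro d i hdt hd hi h1 h2
        refine ⟨fun h => hd ((hZ _).1 h), p i, p (i + 2), hg.ne (by omega) hi (by omega),
          (hZ _).2 (.base (by omega)), (hZ _).2 (.base hi), h1, h2, fun h => ?_, fun y hy hdy => ?_⟩
        · have := hg.adj_index (by omega) hi h
          omega
        · rcases hg.four h1 h2 hdt hdy (hg.ne (by omega) hi (by omega)) (htp _ (by omega)).symm
            (htp _ hi).symm with h | h | h
          · exact Or.inl h
          · exact Or.inr h
          · exact (ht.1 (h ▸ (hZ _).1 hy)).elim
      rcases hg.four hB.adj hB.adj' htr hc hB.ne (fun h => hr (h ▸ hd)) (fun h => hr (h ▸ hd'))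
        with rfl | rfl | rfl
      · exact Or.inr (Or.inr (main _ _ hB.adj.symm hB.not_on (by omega) hB.adj_zero hB.adj_two))
      · exact Or.inr (Or.inr (main _ (i + 1) hB.adj'.symm hB.not_on' (by omega) hB.adj_one
          hB.adj_three))
      · exact Or.inl rfl
  rcases h.2 with ⟨h1, h2⟩ | ⟨h1, h2⟩
  · exact Or.inl (key a b h.1 h1 h2)
  · exact Or.inr (key b a h.1.symm h1 h2)

/-- Critical vertices that are adjacent or share an outer neighbour are at most four positions
apart, by `path_chord` and `path_gap`. The bounds 6 ≤ m, 3 ≤ ℓ and m + ℓ + 8 ≤ `insPos K N` make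
critical indices that are not consecutive differ by at least five. The exception in `path_gap` is
harmless, since the special vertex has position m + 2, which is not critical. -/
theorem insScheme_valid (hN : 3 ≤ N) {m ℓ : ℕ} {Ee : V → V → Prop} {U0 : Set V}
    (hE : IsExtra G p N K s Ee U0) (hℓ : 3 ≤ ℓ) (hm : 6 ≤ m) (hM : m + ℓ + 8 ≤ insPos K N)
    (hsp : sp → insPos K k₀ = m + 1)
    (hkind : (U0 = ∅ ∧
        (∀ a b, Ee a b → (insScheme G p N K s m ℓ Ee U0).IsTip a b ∨
          (insScheme G p N K s m ℓ Ee U0).IsTip b a) ∧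
        G.Adj (insPath p K s (m + 1)) (insPath p K s (m + 3))) ∨
      (U0 = ∅ ∧ ∃ u t w, (insScheme G p N K s m ℓ Ee U0).Loop u t w ∧
        ∀ a b, Ee a b → (insScheme G p N K s m ℓ Ee U0).IsTip a b ∨
          (insScheme G p N K s m ℓ Ee U0).IsTip b a ∨
        (a = u ∧ b = t) ∨ (a = t ∧ b = u) ∨ (a = t ∧ b = w) ∨ (a = w ∧ b = t)) ∨
      ((∀ a b, Ee a b → (insScheme G p N K s m ℓ Ee U0).IsTip a b ∨
          (insScheme G p N K s m ℓ Ee U0).IsTip b a) ∧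
        ∃ u w, (insScheme G p N K s m ℓ Ee U0).Lane u w)) :
    (insScheme G p N K s m ℓ Ee U0).Valid := by
  have hZ : ∀ x, (insScheme G p N K s m ℓ Ee U0).Z x ↔ OnPath p N K s x := fun x => hI.exists_iff
  have htip := fun a b (h : BranchEdge G p N K s a b) =>
    hI.insScheme_isTip hg hN (m := m) (ℓ := ℓ) hE h
  have hext : ∀ a b, a ∈ U0 ∨ (∃ z, Ee a z) → ∀ x, G.Adj x a → G.Adj x b →
      ¬ (TwoOn G p N K s b ∨ BranchEnd G p N K s b) := by
    intro a b ha x hxa hxb hb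
    obtain ⟨d, hd, j, hw, hj⟩ := hE.clear a ha
    refine hI.not_core_of_clearAt hg hN hj ((hw.step hxa.symm).step hxb) (by omega) ?_
    rcases hb with hb | hb
    · exact Or.inl hb
    · exact Or.inr (Or.inr hb.2.2.2)
  refine
    { degree := hg.degree
      inj := fun i hi j hj h => hI.path_inj hg hi hj h
      path := fun j hj => hI.path_adj hg hj
      three_le := hℓ
      pos := show 3 ≤ m by omega
      room := show m + ℓ + 5 ≤ insPos K N by omega
      Er_symm := fun a b h => h.imp BranchEdge.symm (hE.symm a b)
      Er_adj := fun a b h => h.elim (fun h => h.1) (hE.adj a b)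
      Er_off := fun a b h => ?_
      max_mark := ?_
      no_mark := ?_
      near_Z := ?_
      near_U0 := ?_
      near_mark := ?_
      near_Er := ?_
      gap := ?_
      gap_chord := ?_
      kind_tip := ?_ }
  · rw [hZ]
    exact h.elim (fun h => h.not_on) (hE.off a b)
  · intro x a b c hx ha hb hc
    rw [hZ] at hx
    rw [mark_insScheme hI] at ha hb hc
    by_cases hex : ∃ z, Ee x z
    · obtain ⟨d, hd, j, hw, hj⟩ := hE.clear x (Or.inr hex)
      have hno : ∀ b, ¬ BranchEdge G p N K s x b := fun b =>
        hI.not_branchEdge_of_clearAt hg hN hj hw (by omega)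
      obtain ⟨z, hz⟩ := hex
      exact hE.max x z a b c hz (ha.resolve_left (hno _)) (hb.resolve_left (hno _))
        (hc.resolve_left (hno _))
    · push Not at hex
      have hr : ∀ a, BranchEdge G p N K s x a ∨ ExtraMark G p N K s Ee x a →
          BranchEdge G p N K s x a ∨ (G.Adj x a ∧ OnPath p N K s a) := fun a ha =>
        ha.imp id fun h => ⟨h.1, h.2.resolve_right (hex a)⟩
      have key : ∀ a b c, BranchEdge G p N K s x a → (G.Adj x b ∧ OnPath p N K s b) →
          (G.Adj x c ∧ OnPath p N K s c) → b = c := by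
        intro a b c ha hb hc
        by_contra hne
        exact hI.branchEdge_not_twoOn hg ha ⟨hx, b, c, hne, hb.2, hc.2, hb.1, hc.1⟩
      rcases hr a ha with ha | ha <;> rcases hr b hb with hb | hb <;> rcases hr c hc with hc | hc
      · exact Or.inl (hI.branchEdge_unique hg hN ha hb)
      · exact Or.inl (hI.branchEdge_unique hg hN ha hb)
      · exact Or.inr (Or.inl (hI.branchEdge_unique hg hN ha hc))
      · exact Or.inr (Or.inr (key _ _ _ ha hb hc))
      · exact Or.inr (Or.inr (hI.branchEdge_unique hg hN hb hc))
      · exact Or.inr (Or.inl (key _ _ _ hb ha hc))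
      · exact Or.inl (key _ _ _ hc ha hb)
      · exact hI.on_three hg hx ha.2 hb.2 hc.2 ha.1 hb.1 hc.1
  · intro x a b hx hno ha hb hxa hxb
    rw [hZ] at hx
    have hno' : ∀ c, ¬ (BranchEdge G p N K s x c ∨ ExtraMark G p N K s Ee x c) := fun c hc =>
      hno c ((mark_insScheme hI).2 hc)
    have hred : ∀ a, (a ∈ U0 ∨ (insScheme G p N K s m ℓ Ee U0).Mark2 a) →
        (TwoOn G p N K s a ∨ BranchEnd G p N K s a) ∨
        (a ∈ U0 ∨ ∃ z z', Ee a z ∧ z ≠ z' ∧ ExtraMark G p N K s Ee a z') := by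
      rintro a (h | h)
      · exact Or.inr (Or.inl h)
      · exact (hI.insScheme_mark2 hg hN hE h).imp id Or.inr
    have hw : ∀ a, (a ∈ U0 ∨ ∃ z z', Ee a z ∧ z ≠ z' ∧ ExtraMark G p N K s Ee a z') →
        a ∈ U0 ∨ ∃ z, Ee a z := fun a h => h.imp id fun ⟨z, _, h, _⟩ => ⟨z, h⟩
    rcases hred a ha with ha | ha <;> rcases hred b hb with hb | hb
    · exact hI.marked_unique hg hN hx (fun z hz h => hno' z (Or.inr ⟨h, Or.inl hz⟩))
        (fun r h => hno' r (Or.inl h)) ha hb hxa hxb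
    · exact (hext b a (hw b hb) x hxb hxa ha).elim
    · exact (hext a b (hw a ha) x hxa hxb hb).elim
    · exact hE.no_mark x a b hx (fun z h => hno' z (Or.inr h)) ha hb hxa hxb
  · intro x hx
    rw [hZ] at hx
    rcases hx with ⟨i, hi, rfl⟩ | ⟨k, hk, rfl⟩
    · exact (WalkFrom.zero (G := G) hi).near (by omega)
    · obtain ⟨h1, -, h2, -⟩ := hI.apex k hk
      exact (WalkFrom.one (N := N) (by omega) h2).near le_rfl
  · intro x hx
    obtain ⟨d, hd, j, hw, hj⟩ := hE.clear x (Or.inl hx)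
    exact hw.near hd
  · intro x hx
    have hcore : ∀ x, (TwoOn G p N K s x ∨ Branch G p N K s x ∨
        ∃ t, Branch G p N K s t ∧ G.Adj t x) → (insScheme G p N K s m ℓ Ee U0).Near 3 x :=
      fun x hx => by
        obtain ⟨d, hd, i, hw, -⟩ := hI.core_index hg hN hx
        exact hw.near hd
    rcases hI.insScheme_mark2 hg hN hE hx with (h | h) | ⟨z, -, h, -⟩
    · exact hcore x (Or.inl h)
    · exact hcore x (Or.inr (Or.inr h.2.2.2))
    · obtain ⟨d, hd, j, hw, hj⟩ := hE.clear x (Or.inr ⟨z, h⟩)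
      exact hw.near hd
  · rintro a b (h | h)
    · have hc : TwoOn G p N K s a ∨ Branch G p N K s a ∨
          ∃ t, Branch G p N K s t ∧ G.Adj t a := by
        rcases h.2 with h1 | h1
        · exact Or.inr (Or.inl h1.1)
        · exact Or.inr (Or.inr ⟨b, h1.1, h.1.symm⟩)
      obtain ⟨d, hd, i, hw, -⟩ := hI.core_index hg hN hc
      exact hw.near (by omega)
    · obtain ⟨d, hd, j, hw, hj⟩ := hE.clear a (Or.inr ⟨b, h⟩)
      exact hw.near (by omega)
  · intro i j x hi hj hij hx hxi hxj
    rw [hZ] at hx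
    change i = 0 ∨ i + 1 = m ∨ i = m ∨ i = m + ℓ + 2 ∨ i = m + ℓ + 3 ∨ i = insPos K N at hi
    change j = 0 ∨ j + 1 = m ∨ j = m ∨ j = m + ℓ + 2 ∨ j = m + ℓ + 3 ∨ j = insPos K N at hj
    rcases hI.path_gap hg hij (by omega) hx hxi hxj with h | ⟨h1, h⟩
    · omega
    · have := hsp h1
      omega
  · intro i j hi hj hij h1
    change i = 0 ∨ i + 1 = m ∨ i = m ∨ i = m + ℓ + 2 ∨ i = m + ℓ + 3 ∨ i = insPos K N at hi
    change j = 0 ∨ j + 1 = m ∨ j = m ∨ j = m + ℓ + 2 ∨ j = m + ℓ + 3 ∨ j = insPos K N at hj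
    have := hI.path_chord hg hij (by omega) h1
    omega
  · rcases hkind with ⟨h1, h2, h3⟩ | ⟨h1, u, t, w, h2, h3⟩ | ⟨h2, h3⟩
    · exact Or.inl ⟨h1, fun a b h => h.elim (htip a b) (h2 a b), h3⟩
    · refine Or.inr (Or.inl ⟨h1, u, t, w, h2, fun a b h => h.elim (fun h => ?_) (h3 a b)⟩)
      exact (htip a b h).imp id Or.inl
    · exact Or.inr (Or.inr ⟨fun a b h => h.elim (htip a b) (h2 a b), h3⟩)

end IsInsertion

end scheme

/-! ### A stretch of the geodesic with private outer neighbours -/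

section legs

variable {V : Type*} {G : SimpleGraph V} {p : ℕ → V} {N : ℕ} {f : ℕ → V}

/-- `f l` is a neighbour of `p l` off the geodesic, and the vertices `p 50, …, p 110` do not share
such neighbours with other vertices of the geodesic. -/
structure IsLegs (G : SimpleGraph V) (p : ℕ → V) (N : ℕ) (f : ℕ → V) : Prop where
  long : 200 ≤ N
  off : ∀ l ≤ N, OffPath p N (f l)
  adj : ∀ l ≤ N, G.Adj (f l) (p l)
  clear : ∀ y i i', OffPath p N y → i < i' → i' ≤ N → G.Adj y (p i) → G.Adj y (p i') →
    i < 50 ∨ 110 < i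

/-- There are no short cycles through `f (i - 1)` and `f (i + 1)` that obstruct a gadget at
`p i`. -/
structure IsGoodLegs (G : SimpleGraph V) (p : ℕ → V) (N : ℕ) (f : ℕ → V) (i : ℕ) : Prop where
  common : ∀ a b, OffPath p N a → OffPath p N b → G.Adj (f (i - 1)) a → G.Adj (f (i + 1)) a →
    G.Adj (f (i - 1)) b → G.Adj (f (i + 1)) b → a = b
  triangle : G.Adj (f (i - 1)) (f (i + 1)) → ∀ c, OffPath p N c → G.Adj (f (i - 1)) c →
    ¬ G.Adj (f (i + 1)) c
  left : ¬ (G.Adj (f (i - 3)) (f (i - 1)) ∧ G.Adj (f (i - 3)) (f (i - 2)) ∧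
    (G.Adj (f (i - 2)) (f (i - 1)) ∨ G.Adj (f (i - 2)) (f (i + 1))))
  right : ¬ (G.Adj (f (i + 1)) (f (i + 3)) ∧ G.Adj (f (i + 1)) (f (i + 4)) ∧
    G.Adj (f (i + 3)) (f (i + 4)))

namespace IsLegs

variable (hg : IsGeodesic G p N) (hf : IsLegs G p N f)
include hf

theorem clearAt {j : ℕ} (hj : 70 ≤ j) (hj' : j ≤ 90) : ClearAt G p N j := by
  intro y i i' hy hii hi' h1 h2
  have := hf.clear y i i' hy hii hi' h1 h2
  omega

include hg

theorem index_unique {y : V} (hy : OffPath p N y) {a b : ℕ} (ha : 55 ≤ a) (ha' : a ≤ 105)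
    (hb : b ≤ N) (hya : G.Adj y (p a)) (hyb : G.Adj y (p b)) : a = b := by
  have hN := hf.long
  have h1 := hg.two_index (by omega) hb hya hyb
  rcases lt_trichotomy a b with h | h | h
  · have := hf.clear y a b hy h hb hya hyb
    omega
  · exact h
  · have := hf.clear y b a hy h (by omega) hyb hya
    omega

theorem adj_index {a b : ℕ} (ha : a ≤ N) (hb : b ≤ N) (h : G.Adj (f a) (f b)) :
    a ≤ b + 3 ∧ b ≤ a + 3 := by
  have h1 := ((WalkFrom.one ha (hf.adj a ha)).step h).bound hg (WalkFrom.one hb (hf.adj b hb))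
  omega

theorem ne {a b : ℕ} (ha : 55 ≤ a) (ha' : a ≤ 105) (hb : b ≤ N) (hab : a ≠ b) : f a ≠ f b := by
  have hN := hf.long
  intro h
  exact hab (hf.index_unique hg (hf.off a (by omega)) ha ha' hb (hf.adj a (by omega))
    (h ▸ hf.adj b hb))

theorem full {l : ℕ} (hl : l ≤ N) {a b x : V} (hab : a ≠ b) (ha : OffPath p N a)
    (hb : OffPath p N b) (hx : OffPath p N x) (hla : G.Adj (f l) a) (hlb : G.Adj (f l) b)
    (hlx : G.Adj (f l) x) : x = a ∨ x = b := by
  rcases hg.four hla hlb (hf.adj l hl) hlx hab (ha l hl) (hb l hl) with h | h | h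
  · exact Or.inl h
  · exact Or.inr h
  · exact (hx l hl h).elim

theorem eq_leg {l : ℕ} (hl : 1 ≤ l) (hl' : l < N) {x : V} (hx : OffPath p N x)
    (hxl : G.Adj x (p l)) : x = f l :=
  hg.off_unique hl hl' hx (hf.off l hl'.le) hxl (hf.adj l hl'.le)

/-- No two common neighbours and no triangle at the places around `i = 82`. -/
theorem exists_no_common : ∃ i, 80 ≤ i ∧ i ≤ 84 ∧
    (∀ a b, OffPath p N a → OffPath p N b → G.Adj (f (i - 1)) a → G.Adj (f (i + 1)) a →
      G.Adj (f (i - 1)) b → G.Adj (f (i + 1)) b → a = b) ∧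
    (G.Adj (f (i - 1)) (f (i + 1)) → ∀ c, OffPath p N c → G.Adj (f (i - 1)) c →
      ¬ G.Adj (f (i + 1)) c) := by
  have hN := hf.long
  have hO : ∀ l ≤ 100, OffPath p N (f l) := fun l hl => hf.off l (by omega)
  -- The places 80, 82 and 84 suffice: each leg has only two neighbours off the geodesic, and f 79
  -- is too far from f 83 and f 85 to be adjacent to them.
  by_contra hcon
  push Not at hcon
  have hne : ∀ l, l ≠ 79 → l ≤ 100 → f 79 ≠ f l := fun l hl hl' =>
    hf.ne hg (by omega) (by omega) (by omega) hl.symm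
  have hfar : ∀ l, 83 ≤ l → l ≤ 100 → ¬ G.Adj (f l) (f 79) := fun l hl hl' h => by
    have := hf.adj_index hg (by omega) (by omega) h
    omega
  -- the neighbours of `f 81`, which are not adjacent to both `f 79` and `f 83`
  have h80 : ∃ a b, a ≠ b ∧ OffPath p N a ∧ OffPath p N b ∧ G.Adj (f 79) a ∧ G.Adj (f 81) a ∧
      G.Adj (f 79) b ∧ G.Adj (f 81) b := by
    by_contra hX
    push Not at hX
    obtain ⟨hY, c, hc, hc1, hc2⟩ := hcon 80 (by omega) (by omega) fun a b ha hb h1 h2 h3 h4 => by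
      by_contra hne
      exact hX a b hne ha hb h1 h2 h3 h4
    norm_num at hY hc1 hc2
    have hcne : f 79 ≠ c := hc1.ne
    have hfull : ∀ x, OffPath p N x → G.Adj (f 81) x → x = f 79 ∨ x = c := fun x hx h =>
      hf.full hg (by omega) hcne (hO 79 (by omega)) hc hx hY.symm hc2 h
    obtain ⟨hY', c', hc', hc1', hc2'⟩ := hcon 82 (by omega) (by omega)
      fun a b ha hb h1 h2 h3 h4 => by
        norm_num at h1 h2 h3 h4
        rcases hfull a ha h1 with rfl | rfl
        · exact (hfar 83 (by omega) (by omega) h2).elim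
        · rcases hfull b hb h3 with rfl | rfl
          · exact (hfar 83 (by omega) (by omega) h4).elim
          · rfl
    norm_num at hY' hc1' hc2'
    rcases hfull _ (hO 83 (by omega)) hY' with h | h
    · exact hne 83 (by omega) (by omega) h.symm
    · exact hfar 83 (by omega) (by omega) (h ▸ hc1.symm)
  obtain ⟨a, b, hab, ha, hb, h1, h2, h3, h4⟩ := h80
  have hfull : ∀ x, OffPath p N x → G.Adj (f 81) x → x = a ∨ x = b := fun x hx h =>
    hf.full hg (by omega) hab ha hb hx h2 h4 h
  -- The outer edges of f 81 lead to a and b, so failure at 82 makes both adjacent to f 83. Then a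
  -- and b have three neighbours already and cannot cause a failure at 84.
  have h82 : G.Adj (f 83) a ∧ G.Adj (f 83) b := by
    by_contra hX
    obtain ⟨hY, -⟩ := hcon 82 (by omega) (by omega) fun x y hx hy h5 h6 h7 h8 => by
      norm_num at h5 h6 h7 h8
      by_contra hxy
      rcases hfull x hx h5 with rfl | rfl <;> rcases hfull y hy h7 with rfl | rfl
      · exact hxy rfl
      · exact hX ⟨h6, h8⟩
      · exact hX ⟨h8, h6⟩
      · exact hxy rfl
    norm_num at hY
    rcases hfull _ (hO 83 (by omega)) hY with h | h
    · exact hfar 83 (by omega) (by omega) (h ▸ h1.symm)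
    · exact hfar 83 (by omega) (by omega) (h ▸ h3.symm)
  have hfull' : ∀ x, OffPath p N x → G.Adj (f 83) x → x = a ∨ x = b := fun x hx h =>
    hf.full hg (by omega) hab ha hb hx h82.1 h82.2 h
  have hthree : ∀ y, G.Adj (f 79) y → G.Adj (f 81) y → G.Adj (f 83) y → ¬ G.Adj (f 85) y := by
    intro y h5 h6 h7 h8
    rcases hg.four h5.symm h6.symm h7.symm h8.symm (hne 81 (by omega) (by omega))
      (hne 83 (by omega) (by omega))
      (hf.ne hg (a := 81) (b := 83) (by omega) (by omega) (by omega) (by omega)) with h | h | h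
    · exact hne 85 (by omega) (by omega) h.symm
    · exact hf.ne hg (a := 81) (b := 85) (by omega) (by omega) (by omega) (by omega) h.symm
    · exact hf.ne hg (a := 83) (b := 85) (by omega) (by omega) (by omega) (by omega) h.symm
  obtain ⟨hY, -⟩ := hcon 84 (by omega) (by omega) fun x y hx hy h5 h6 h7 h8 => by
    norm_num at h5 h6 h7 h8
    rcases hfull' x hx h5 with rfl | rfl
    · exact (hthree _ h1 h2 h82.1 h6).elim
    · exact (hthree _ h3 h4 h82.2 h6).elim
  norm_num at hY
  rcases hfull' _ (hO 85 (by omega)) hY with h | h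
  · exact hfar 85 (by omega) (by omega) (h ▸ h1.symm)
  · exact hfar 85 (by omega) (by omega) (h ▸ h3.symm)

/-- The triangle uses up the outer edges of f (i+1) and f (i+4), and each obstruction at i + 3 would
need a further one. -/
theorem isGoodLegs_of_right {i : ℕ} (hi : 75 ≤ i) (hi' : i ≤ 90)
    (h : G.Adj (f (i + 1)) (f (i + 3)) ∧ G.Adj (f (i + 1)) (f (i + 4)) ∧
      G.Adj (f (i + 3)) (f (i + 4))) : IsGoodLegs G p N f (i + 3) := by
  have hN := hf.long
  obtain ⟨h1, h2, h3⟩ := h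
  have hO : ∀ l ≤ 100, OffPath p N (f l) := fun l hl => hf.off l (by omega)
  have hne : ∀ a b, 55 ≤ a → a ≤ 100 → b ≤ 100 → a ≠ b → f a ≠ f b := fun a b h h' h'' h3 =>
    hf.ne hg h (by omega) (by omega) h3
  have hfull1 : ∀ x, OffPath p N x → G.Adj (f (i + 1)) x → x = f (i + 3) ∨ x = f (i + 4) :=
    fun x hx h => hf.full hg (by omega) h3.ne (hO _ (by omega)) (hO _ (by omega)) hx h1 h2 h
  have hfull4 : ∀ x, OffPath p N x → G.Adj (f (i + 4)) x → x = f (i + 1) ∨ x = f (i + 3) :=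
    fun x hx h => hf.full hg (by omega) h1.ne (hO _ (by omega)) (hO _ (by omega)) hx h2.symm
      h3.symm h
  have hno1 : ¬ G.Adj (f (i + 1)) (f (i + 2)) := fun h => by
    rcases hfull1 _ (hO _ (by omega)) h with h | h
    · exact hne _ _ (by omega) (by omega) (by omega) (by omega) h
    · exact hne _ _ (by omega) (by omega) (by omega) (by omega) h
  have hno1' : ¬ G.Adj (f (i + 1)) (f i) := fun h => by
    rcases hfull1 _ (hO _ (by omega)) h with h | h
    · exact hne _ _ (by omega) (by omega) (by omega) (by omega) h
    · exact hne _ _ (by omega) (by omega) (by omega) (by omega) h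
  have hno4 : ∀ l, l ≤ 100 → l ≠ i + 1 → l ≠ i + 3 → ¬ G.Adj (f (i + 4)) (f l) :=
    fun l hl h h' h4 => by
      rcases hfull4 _ (hO l hl) h4 with h5 | h5
      · exact hne (i + 1) l (by omega) (by omega) (by omega) (by omega) h5.symm
      · exact hne (i + 3) l (by omega) (by omega) (by omega) (by omega) h5.symm
  constructor
  · intro a b ha hb h5 h6 h7 h8
    change G.Adj (f (i + 2)) a at h5
    change G.Adj (f (i + 4)) a at h6
    change G.Adj (f (i + 2)) b at h7
    change G.Adj (f (i + 4)) b at h8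
    rcases hfull4 a ha h6 with rfl | rfl
    · exact (hno1 h5.symm).elim
    · rcases hfull4 b hb h8 with rfl | rfl
      · exact (hno1 h7.symm).elim
      · rfl
  · intro h5
    change G.Adj (f (i + 2)) (f (i + 4)) at h5
    exact (hno4 (i + 2) (by omega) (by omega) (by omega) h5.symm).elim
  · rintro ⟨-, h6, -⟩
    change G.Adj (f i) (f (i + 1)) at h6
    exact hno1' h6.symm
  · rintro ⟨h5, -⟩
    change G.Adj (f (i + 4)) (f (i + 6)) at h5
    exact hno4 (i + 6) (by omega) (by omega) (by omega) h5

/-- From a place without common neighbours, an obstruction on the left is avoided by moving one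
place to the left, and one on the right by then moving three places to the right. In each case the
obstruction uses up edges that a new one would need. -/
theorem exists_isGoodLegs : ∃ i, 75 ≤ i ∧ i ≤ 87 ∧ IsGoodLegs G p N f i := by
  have hN := hf.long
  have hO : ∀ l ≤ 100, OffPath p N (f l) := fun l hl => hf.off l (by omega)
  have hne : ∀ a b, 55 ≤ a → a ≤ 100 → b ≤ 100 → a ≠ b → f a ≠ f b := fun a b h h' h'' h3 =>
    hf.ne hg h (by omega) (by omega) h3
  obtain ⟨i, hi, hi', hX, hY⟩ := hf.exists_no_common hg
  have key : ∀ i, 79 ≤ i → i ≤ 84 →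
      (∀ a b, OffPath p N a → OffPath p N b → G.Adj (f (i - 1)) a → G.Adj (f (i + 1)) a →
        G.Adj (f (i - 1)) b → G.Adj (f (i + 1)) b → a = b) →
      (G.Adj (f (i - 1)) (f (i + 1)) → ∀ c, OffPath p N c → G.Adj (f (i - 1)) c →
        ¬ G.Adj (f (i + 1)) c) →
      ¬ (G.Adj (f (i - 3)) (f (i - 1)) ∧ G.Adj (f (i - 3)) (f (i - 2)) ∧
        (G.Adj (f (i - 2)) (f (i - 1)) ∨ G.Adj (f (i - 2)) (f (i + 1)))) →
      ∃ i, 75 ≤ i ∧ i ≤ 87 ∧ IsGoodLegs G p N f i := by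
    intro i hi hi' hX hY hL
    by_cases hR : G.Adj (f (i + 1)) (f (i + 3)) ∧ G.Adj (f (i + 1)) (f (i + 4)) ∧
        G.Adj (f (i + 3)) (f (i + 4))
    · exact ⟨i + 3, by omega, by omega, hf.isGoodLegs_of_right hg (by omega) (by omega) hR⟩
    · exact ⟨i, by omega, by omega, hX, hY, hL, hR⟩
  by_cases hL : G.Adj (f (i - 3)) (f (i - 1)) ∧ G.Adj (f (i - 3)) (f (i - 2)) ∧
      (G.Adj (f (i - 2)) (f (i - 1)) ∨ G.Adj (f (i - 2)) (f (i + 1)))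
  swap
  · exact key i (by omega) hi' hX hY hL
  obtain ⟨i, rfl⟩ : ∃ j, i = j + 3 := ⟨i - 3, by omega⟩
  change G.Adj (f i) (f (i + 2)) ∧ G.Adj (f i) (f (i + 1)) ∧
      (G.Adj (f (i + 1)) (f (i + 2)) ∨ G.Adj (f (i + 1)) (f (i + 4))) at hL
  obtain ⟨h1, h2, h3⟩ := hL
  have hno : ∀ l ≤ 100, l ≠ i + 1 → l ≠ i + 2 → ¬ G.Adj (f i) (f l) := fun l hl h h' h4 => by
    rcases hf.full hg (by omega) (hne (i + 2) (i + 1) (by omega) (by omega) (by omega) (by omega))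
      (hO _ (by omega)) (hO _ (by omega)) (hO l hl) h1 h2 h4 with h5 | h5
    · exact hne (i + 2) l (by omega) (by omega) (by omega) (by omega) h5.symm
    · exact hne (i + 1) l (by omega) (by omega) (by omega) (by omega) h5.symm
  obtain ⟨e, he, he', h4⟩ : ∃ e, 79 ≤ e ∧ (e = i + 2 ∨ e = i + 4) ∧ G.Adj (f (i + 1)) (f e) := by
    rcases h3 with h3 | h3
    · exact ⟨_, by omega, Or.inl rfl, h3⟩
    · exact ⟨_, by omega, Or.inr rfl, h3⟩
  have hfull : ∀ x, OffPath p N x → G.Adj (f (i + 1)) x → x = f i ∨ x = f e := fun x hx h =>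
    hf.full hg (by omega) (hne i e (by omega) (by omega) (by omega) (by omega)) (hO _ (by omega))
      (hO _ (by omega)) hx h2.symm h4 h
  have hno' : ¬ G.Adj (f (i + 3)) (f i) := fun h =>
    hno (i + 3) (by omega) (by omega) (by omega) h.symm
  refine key (i + 2) (by omega) (by omega) ?_ ?_ ?_
  · intro a b ha hb h5 h6 h7 h8
    change G.Adj (f (i + 1)) a at h5
    change G.Adj (f (i + 3)) a at h6
    change G.Adj (f (i + 1)) b at h7
    change G.Adj (f (i + 3)) b at h8
    rcases hfull a ha h5 with rfl | rfl
    · exact (hno' h6).elim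
    · rcases hfull b hb h7 with rfl | rfl
      · exact (hno' h8).elim
      · rfl
  · intro h5
    change G.Adj (f (i + 1)) (f (i + 3)) at h5
    rcases hfull _ (hO _ (by omega)) h5 with h | h
    · exact (hne _ _ (by omega) (by omega) (by omega) (by omega) h).elim
    · exact (hne _ _ (by omega) (by omega) (by omega) (by omega) h).elim
  · rintro ⟨-, h6, -⟩
    have h7 : i + 2 - 3 = i - 1 := by omega
    rw [h7] at h6
    change G.Adj (f (i - 1)) (f i) at h6
    exact hno (i - 1) (by omega) (by omega) (by omega) h6.symm

end IsLegs

end legs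

/-! ### Gadgets on such a stretch -/

section legs

variable {V : Type*} {G : SimpleGraph V} {p : ℕ → V} {N : ℕ} {f : ℕ → V} {K : ℕ → Prop}
  {s : ℕ → V} {sp : Prop} {k₀ : ℕ}

namespace IsLegs

variable (hg : IsGeodesic G p N) (hf : IsLegs G p N f) (hI : IsInsertion G p N K s sp k₀)
include hf hI

theorem not_ins {k : ℕ} (hk : 50 ≤ k) (hk' : k ≤ 110) : ¬ K k := by
  intro h
  obtain ⟨h1, h2, h3, h4⟩ := hI.apex k h
  have := hf.clear _ k (k + 1) h2 (by omega) h1 h3 h4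
  omega

theorem insPos_add {r a : ℕ} (hr : 50 ≤ r) (hra : r + a ≤ 110) :
    insPos K (r + a) = insPos K r + a := by
  induction a with
  | zero => rfl
  | succ a ih =>
    have h1 := insPos_succ_of_not (hf.not_ins hI (k := r + a) (by omega) (by omega))
    have h2 := ih (by omega)
    rw [show r + (a + 1) = r + a + 1 from rfl]
    omega

theorem insPath_add {r a : ℕ} (hr : 50 ≤ r) (hra : r + a ≤ 110) :
    insPath p K s (insPos K r + a) = p (r + a) := by
  rw [← hf.insPos_add hI hr hra, insPath_insPos]

include hg

theorem not_onPath {y : V} {d j : ℕ} (hy : OffPath p N y) (hw : WalkFrom G p N d j y) (hd : d ≤ 6)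
    (hj : 70 ≤ j) (hj' : j ≤ 95) : ¬ OnPath p N K s y := by
  rintro (⟨i, hi, rfl⟩ | ⟨k, hk, rfl⟩)
  · exact hy i hi rfl
  · obtain ⟨h1, h2, h3, h4⟩ := hI.apex k hk
    have h5 := hw.bound hg (WalkFrom.one (N := N) (by omega) h3)
    exact hf.not_ins hI (by omega) (by omega) hk

theorem on_index {y z : V} {d j : ℕ} (hw : WalkFrom G p N d j y) (hd : d ≤ 5)
    (hj : 70 ≤ j) (hj' : j ≤ 95) (hz : OnPath p N K s z) (hyz : G.Adj y z) :
    ∃ b ≤ N, z = p b ∧ b ≤ j + (d + 1) ∧ j ≤ b + (d + 1) := by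
  rcases hz with ⟨b, hb, rfl⟩ | ⟨k, hk, rfl⟩
  · have := (hw.step hyz).bound hg (WalkFrom.zero hb)
    exact ⟨b, hb, rfl, by omega, by omega⟩
  · exact (hf.not_onPath hg hI (hI.apex k hk).2.1 (hw.step hyz) (by omega) hj hj' (.ins hk)).elim

theorem leg_on {l : ℕ} (hl : 70 ≤ l) (hl' : l ≤ 95) {z : V} (hz : OnPath p N K s z)
    (h : G.Adj (f l) z) : z = p l := by
  have hN := hf.long
  obtain ⟨b, hb, rfl, -, -⟩ := hf.on_index hg hI (WalkFrom.one (by omega) (hf.adj l (by omega)))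
    (by omega) hl hl' hz h
  rw [hf.index_unique hg (hf.off l (by omega)) (by omega) (by omega) hb (hf.adj l (by omega)) h]

theorem leg_not_onPath {l : ℕ} (hl : 70 ≤ l) (hl' : l ≤ 95) : ¬ OnPath p N K s (f l) := by
  have hN := hf.long
  exact hf.not_onPath hg hI (hf.off l (by omega))
    (WalkFrom.one (by omega) (hf.adj l (by omega))) (by omega) hl hl'

/-- With m = `insPos K r` + 3 one has y = p (r+4), x₀ = p (r+5), x₁ = p (r+6), so goodness at r + 5
concerns the legs u and w of y and x₁. Its conditions `left` and `right` yield `no_square`. -/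
theorem lane {r : ℕ} (hr : 70 ≤ r) (hr' : r ≤ 82) (hgood : IsGoodLegs G p N f (r + 5)) {ℓ : ℕ}
    (hℓ : 3 ≤ ℓ) (hM : insPos K r + 3 + ℓ + 8 ≤ insPos K N)
    {Ee : V → V → Prop} (hE : IsExtra G p N K s Ee {f (r + 4), f (r + 6)})
    (hu : ∀ z, ¬ Ee (f (r + 4)) z) (hw : ∀ z, ¬ Ee (f (r + 6)) z)
    (hE1 : ∀ a z z', Ee a z → ExtraMark G p N K s Ee a z' → z = z') :
    (insScheme G p N K s (insPos K r + 3) ℓ Ee {f (r + 4), f (r + 6)}).Lane (f (r + 4))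
      (f (r + 6)) := by
  have hN := hf.long
  have hZ : ∀ x, (insScheme G p N K s (insPos K r + 3) ℓ Ee {f (r + 4), f (r + 6)}).Z x ↔
    OnPath p N K s x := fun x => hI.exists_iff
  have hq4 : insPath p K s (insPos K r + 3 + 1) = p (r + 4) :=
    hf.insPath_add hI (a := 4) (by omega) (by omega)
  have hq6 : insPath p K s (insPos K r + 3 + 3) = p (r + 6) :=
    hf.insPath_add hI (a := 6) (by omega) (by omega)
  have hw4 : WalkFrom G p N 1 (r + 4) (f (r + 4)) := .one (by omega) (hf.adj _ (by omega))
  have hw6 : WalkFrom G p N 1 (r + 6) (f (r + 6)) := .one (by omega) (hf.adj _ (by omega))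
  have hwx : ∀ x, G.Adj (f (r + 4)) x ∨ G.Adj (f (r + 6)) x →
      WalkFrom G p N 2 (r + 4) x ∨ WalkFrom G p N 2 (r + 6) x := fun x hx =>
    hx.imp (fun h => hw4.step h) (fun h => hw6.step h)
  -- neighbours on the path of the vertices near the gadget
  have hxon : ∀ x z, (G.Adj (f (r + 4)) x ∨ G.Adj (f (r + 6)) x) → ¬ OnPath p N K s x →
      OnPath p N K s z → G.Adj x z → ∃ b, r + 1 ≤ b ∧ b ≤ r + 9 ∧ z = p b ∧ x = f b := by
    intro x z hx hxO hz hxz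
    have h1 : ∃ b ≤ N, z = p b ∧ r + 1 ≤ b ∧ b ≤ r + 9 := by
      rcases hwx x hx with h | h
      · obtain ⟨b, hb, h1, h2, h3⟩ := hf.on_index hg hI h (by omega) (by omega) (by omega) hz hxz
        exact ⟨b, hb, h1, by omega, by omega⟩
      · obtain ⟨b, hb, h1, h2, h3⟩ := hf.on_index hg hI h (by omega) (by omega) (by omega) hz hxz
        exact ⟨b, hb, h1, by omega, by omega⟩
    obtain ⟨b, hb, rfl, h2, h3⟩ := h1
    exact ⟨b, h2, h3, rfl, hf.eq_leg hg (by omega) (by omega) (.of_not_onPath hxO) hxz⟩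
  have hmark : ∀ l, l = r + 4 ∨ l = r + 6 → (∀ z, ¬ Ee (f l) z) → ∀ c,
      (insScheme G p N K s (insPos K r + 3) ℓ Ee {f (r + 4), f (r + 6)}).Mark (f l) c →
      c = p l := by
    intro l hl hno c hc
    rw [mark_insScheme hI] at hc
    rcases hc with hc | ⟨hc, h1 | h1⟩
    · exact (hI.not_branchEdge_of_clearAt hg (by omega) (hf.clearAt (j := l) (by omega) (by omega))
        (WalkFrom.one (by omega) (hf.adj l (by omega))) (by omega) hc).elim
    · exact hf.leg_on hg hI (by omega) (by omega) h1 hc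
    · exact (hno c h1).elim
  refine
    { ne := hf.ne hg (by omega) (by omega) (by omega) (by omega)
      set := rfl
      not_Z_u := fun h => hf.leg_not_onPath hg hI (by omega) (by omega) ((hZ _).1 h)
      not_Z_w := fun h => hf.leg_not_onPath hg hI (by omega) (by omega) ((hZ _).1 h)
      adj_u := ?_
      adj_w := ?_
      mark_u := ?_
      mark_w := ?_
      common := ?_
      not_adj := ?_
      single := ?_
      not_mark := ?_
      no_square := ?_ }
  · change G.Adj _ (insPath p K s (insPos K r + 3 + 1))
    rw [hq4]
    exact hf.adj _ (by omega)
  · change G.Adj _ (insPath p K s (insPos K r + 3 + 3))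
    rw [hq6]
    exact hf.adj _ (by omega)
  · intro c hc
    exact (hmark (r + 4) (Or.inl rfl) hu c hc).trans hq4.symm
  · intro c hc
    exact (hmark (r + 6) (Or.inr rfl) hw c hc).trans hq6.symm
  · intro a b ha hb h1 h2 h3 h4
    rw [hZ] at ha hb
    exact hgood.common a b (.of_not_onPath ha) (.of_not_onPath hb) h1 h2 h3 h4
  · intro h c hc h1
    rw [hZ] at hc
    exact hgood.triangle h c (.of_not_onPath hc) h1
  · intro x z z' hx hxO hz hz' h1 h2
    rw [hZ] at hxO hz hz'
    obtain ⟨b, h3, h4, rfl, rfl⟩ := hxon x z hx hxO hz h1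
    exact (hf.leg_on hg hI (by omega) (by omega) hz' h2).symm
  · intro x c hx hxO hxc hc
    have hclear : ∃ j, 70 ≤ j ∧ j ≤ 90 ∧ WalkFrom G p N 3 j c := by
      rcases hwx x hx with h | h
      · exact ⟨_, by omega, by omega, h.step hxc⟩
      · exact ⟨_, by omega, by omega, h.step hxc⟩
    obtain ⟨j, hj, hj', h⟩ := hclear
    have hcore := hI.not_core_of_clearAt hg (by omega) (hf.clearAt hj hj') h (by omega)
    rcases hI.insScheme_mark2 hg (by omega) hE hc with (h1 | h1) | ⟨z, z', h1, h2, h3⟩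
    · exact hcore (Or.inl h1)
    · exact hcore (Or.inr (Or.inr h1.2.2.2))
    · exact h2 (hE1 c z z' h1 h3)
  · intro x y i j hx hy hxO hyO hxy hi hj hxi hyj
    rw [hZ] at hxO hyO
    -- The critical vertices within reach are q (m-1) and q m at p (r+2) and p (r+3) and, for small
    -- ℓ, the right end of the blue path and its successor.
    have hcrit : ∀ x i, (G.Adj (f (r + 4)) x ∨ G.Adj (f (r + 6)) x) → ¬ OnPath p N K s x →
        (insScheme G p N K s (insPos K r + 3) ℓ Ee {f (r + 4), f (r + 6)}).Crit i →
        G.Adj x (insPath p K s i) → ∃ b, x = f b ∧ (b = r + 2 ∨ b = r + 3 ∨ (b = r + 8 ∧ ℓ = 3) ∨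
          b = r + 9) := by
      intro x i hx hxO hi hxi
      change i = 0 ∨ i + 1 = insPos K r + 3 ∨ i = insPos K r + 3 ∨ i = insPos K r + 3 + ℓ + 2 ∨
        i = insPos K r + 3 + ℓ + 3 ∨ i = insPos K N at hi
      have hiM : i ≤ insPos K N := by omega
      obtain ⟨b, h1, h2, h3, h4⟩ := hxon x _ hx hxO (hI.exists_iff.1 ⟨i, hiM, rfl⟩) hxi
      obtain ⟨a, rfl⟩ : ∃ a, b = r + a := ⟨b - r, by omega⟩
      have h5 := hf.insPos_add hI (r := r) (a := a) (by omega) (by omega)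
      have h6 := insPos_bounds' K (i := r + a) (j := N) (by omega)
      have h7 : i = insPos K r + a := by
        refine hI.path_inj hg hiM (by omega) ?_
        rw [h3, hf.insPath_add hI (by omega) (by omega)]
      exact ⟨r + a, h4, by omega⟩
    obtain ⟨b, rfl, hb⟩ := hcrit x i hx hxO hi hxi
    obtain ⟨b', rfl, hb'⟩ := hcrit y j hy hyO hj hyj
    exfalso
    have hbb : b ≠ b' := fun h => hxy.ne (by rw [h])
    have h1 := hf.adj_index hg (by omega) (by omega) hxy
    have hlink : ∀ l, l ≤ N → (G.Adj (f (r + 4)) (f l) ∨ G.Adj (f (r + 6)) (f l)) →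
        (l ≤ r + 2 → G.Adj (f (r + 4)) (f l)) ∧ (r + 8 ≤ l → G.Adj (f (r + 6)) (f l)) := by
      intro l hl h
      refine ⟨fun hl' => h.resolve_right fun h => ?_, fun hl' => h.resolve_left fun h => ?_⟩
      · have := hf.adj_index hg (by omega) (by omega) h
        omega
      · have := hf.adj_index hg (by omega) (by omega) h
        omega
    have hleft : G.Adj (f (r + 2)) (f (r + 3)) →
        (G.Adj (f (r + 4)) (f (r + 2)) ∨ G.Adj (f (r + 6)) (f (r + 2))) →
        (G.Adj (f (r + 4)) (f (r + 3)) ∨ G.Adj (f (r + 6)) (f (r + 3))) → False :=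
      fun h h' h'' => hgood.left ⟨((hlink _ (by omega) h').1 le_rfl).symm, h,
        h''.imp (fun h => h.symm) (fun h => h.symm)⟩
    have hright : G.Adj (f (r + 8)) (f (r + 9)) →
        (G.Adj (f (r + 4)) (f (r + 8)) ∨ G.Adj (f (r + 6)) (f (r + 8))) →
        (G.Adj (f (r + 4)) (f (r + 9)) ∨ G.Adj (f (r + 6)) (f (r + 9))) → False :=
      fun h h' h'' => hgood.right ⟨(hlink _ (by omega) h').2 le_rfl,
        (hlink _ (by omega) h'').2 (by omega), h⟩
    have h2 : (b = r + 2 ∧ b' = r + 3) ∨ (b = r + 3 ∧ b' = r + 2) ∨ (b = r + 8 ∧ b' = r + 9) ∨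
        (b = r + 9 ∧ b' = r + 8) := by omega
    rcases h2 with ⟨rfl, rfl⟩ | ⟨rfl, rfl⟩ | ⟨rfl, rfl⟩ | ⟨rfl, rfl⟩
    · exact hleft hxy hx hy
    · exact hleft hxy.symm hy hx
    · exact hright hxy hx hy
    · exact hright hxy.symm hy hx

end IsLegs

end legs

section legs

variable {V : Type*} {G : SimpleGraph V} {p : ℕ → V} {N : ℕ} {f : ℕ → V} {K : ℕ → Prop}
  {s : ℕ → V} {sp : Prop} {k₀ : ℕ}

theorem le_insPos (K : ℕ → Prop) (k : ℕ) : k ≤ insPos K k := by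
  have := insPos_bounds K 0 k
  simp only [zero_add] at this
  omega

theorem isExtra_empty : IsExtra G p N K s (fun _ _ => False) ∅ where
  symm _ _ h := h
  adj _ _ h := h.elim
  off _ _ h := h.elim
  clear a h := by
    rcases h with h | ⟨_, h⟩
    · exact h.elim
    · exact h.elim
  max _ _ _ _ _ h := h.elim
  no_mark x a b _ _ ha := by
    rcases ha with h | ⟨_, _, h, _⟩
    · exact h.elim
    · exact h.elim

/-- The legs u and w can be saturated unless they have a common neighbour t without neighbours on
the path, which would get two blue edges and no red one. If the third neighbour t' of t is adjacent
to the path, the red path u t w closes the gadget instead. Otherwise tt' is coloured red and t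
becomes a tip. Goodness ensures that u and w have no further common neighbour. -/
theorem IsLegs.exists_valid (hg : IsGeodesic G p N) (hf : IsLegs G p N f)
    (hI : IsInsertion G p N K s sp k₀) (hsp : ¬ sp) {ℓ : ℕ} (hℓ : 3 ≤ ℓ) (hlen : 5 * ℓ + 200 ≤ N) :
    ∃ m Ee U0, (insScheme G p N K s m ℓ Ee U0).Valid := by
  have hN := hf.long
  obtain ⟨i, hi, hi', hgood⟩ := hf.exists_isGoodLegs hg
  obtain ⟨r, rfl⟩ : ∃ r, i = r + 5 := ⟨i - 5, by omega⟩
  have hm : 6 ≤ insPos K r + 3 := by have := le_insPos K r; omega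
  have hM : insPos K r + 3 + ℓ + 8 ≤ insPos K N := by
    have := insPos_bounds' K (i := r) (j := N) (by omega)
    omega
  set u := f (r + 4) with hu
  set w := f (r + 6) with hw
  have hZ : ∀ {ℓ m : ℕ} {Ee : V → V → Prop} {U0 : Set V} (x : V),
    (insScheme G p N K s m ℓ Ee U0).Z x ↔ OnPath p N K s x := fun x => hI.exists_iff
  have hq4 : insPath p K s (insPos K r + 3 + 1) = p (r + 4) :=
    hf.insPath_add hI (a := 4) (by omega) (by omega)
  have hq6 : insPath p K s (insPos K r + 3 + 3) = p (r + 6) :=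
    hf.insPath_add hI (a := 6) (by omega) (by omega)
  have huw : u ≠ w := hf.ne hg (by omega) (by omega) (by omega) (by omega)
  have hup : G.Adj u (p (r + 4)) := hf.adj _ (by omega)
  have hwp : G.Adj w (p (r + 6)) := hf.adj _ (by omega)
  have hw4 : WalkFrom G p N 1 (r + 4) u := .one (by omega) hup
  have hw6 : WalkFrom G p N 1 (r + 6) w := .one (by omega) hwp
  have huO : ¬ OnPath p N K s u := hf.leg_not_onPath hg hI (by omega) (by omega)
  have hwO : ¬ OnPath p N K s w := hf.leg_not_onPath hg hI (by omega) (by omega)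
  have hon4 : OnPath p N K s (p (r + 4)) := .base (by omega)
  have hon6 : OnPath p N K s (p (r + 6)) := .base (by omega)
  have hc4 := hf.clearAt (j := r + 4) (by omega) (by omega)
  have hc6 := hf.clearAt (j := r + 6) (by omega) (by omega)
  have hcommon : ∀ a b, ¬ OnPath p N K s a → ¬ OnPath p N K s b → G.Adj u a → G.Adj w a →
      G.Adj u b → G.Adj w b → a = b := fun a b ha hb =>
    hgood.common a b (.of_not_onPath ha) (.of_not_onPath hb)
  by_cases hhub : ∃ t, ¬ OnPath p N K s t ∧ G.Adj u t ∧ G.Adj w t ∧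
      ∀ z, OnPath p N K s z → ¬ G.Adj t z
  · obtain ⟨t, htO, hut, hwt, htZ⟩ := hhub
    obtain ⟨t', htt', ht'u, ht'w⟩ := hg.exists_third t u w
    have ht'O : ¬ OnPath p N K s t' := fun h => htZ _ h htt'
    have hnbr : ∀ x, G.Adj t x → x = u ∨ x = w ∨ x = t' := fun x hx =>
      hg.four hut.symm hwt.symm htt' hx huw ht'u.symm ht'w.symm
    by_cases ht' : ∃ z, OnPath p N K s z ∧ G.Adj t' z
    · obtain ⟨z₀, hz₀, hz₀'⟩ := ht'
      let Ee : V → V → Prop := fun a b => (a = u ∧ b = t) ∨ (a = t ∧ b = u) ∨ (a = t ∧ b = w) ∨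
        (a = w ∧ b = t)
      have hEdef : ∀ a b, Ee a b ↔ (a = u ∧ b = t) ∨ (a = t ∧ b = u) ∨ (a = t ∧ b = w) ∨
        (a = w ∧ b = t) := fun _ _ => Iff.rfl
      have hcases : ∀ a b, Ee a b → a = u ∨ a = t ∨ a = w := by
        intro a b h
        rw [hEdef] at h
        tauto
      have hmu : ∀ a, ExtraMark G p N K s Ee u a → a = p (r + 4) ∨ a = t := by
        rintro a ⟨h1, h2 | h2⟩
        · exact Or.inl (hf.leg_on hg hI (by omega) (by omega) h2 h1)
        · rcases h2 with h2 | h2 | h2 | h2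
          · exact Or.inr h2.2
          · exact (hut.ne h2.1).elim
          · exact (hut.ne h2.1).elim
          · exact (huw h2.1).elim
      have hmw : ∀ a, ExtraMark G p N K s Ee w a → a = p (r + 6) ∨ a = t := by
        rintro a ⟨h1, h2 | h2⟩
        · exact Or.inl (hf.leg_on hg hI (by omega) (by omega) h2 h1)
        · rcases h2 with h2 | h2 | h2 | h2
          · exact (huw h2.1.symm).elim
          · exact (hwt.ne h2.1).elim
          · exact (hwt.ne h2.1).elim
          · exact Or.inr h2.2
      have hmt : ∀ a, ExtraMark G p N K s Ee t a → a = u ∨ a = w := by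
        rintro a ⟨h1, h2 | h2⟩
        · exact (htZ a h2 h1).elim
        · rcases h2 with h2 | h2 | h2 | h2
          · exact (hut.ne h2.1.symm).elim
          · exact Or.inl h2.2
          · exact Or.inr h2.2
          · exact (hwt.ne h2.1.symm).elim
      have hE : IsExtra G p N K s Ee ∅ := by
        refine
          { symm := fun a b h => ?_
            adj := ?_
            off := ?_
            clear := ?_
            max := ?_
            no_mark := ?_ }
        · rw [hEdef] at h ⊢
          tauto
        · rintro a b (⟨rfl, rfl⟩ | ⟨rfl, rfl⟩ | ⟨rfl, rfl⟩ | ⟨rfl, rfl⟩)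
          exacts [hut, hut.symm, hwt.symm, hwt]
        · intro a b h
          rcases hcases a b h with rfl | rfl | rfl
          exacts [huO, htO, hwO]
        · rintro a (h | ⟨z, h⟩)
          · exact h.elim
          · rcases hcases a z h with rfl | rfl | rfl
            · exact ⟨1, by omega, _, hw4, hc4⟩
            · exact ⟨2, by omega, _, hw4.step hut, hc4⟩
            · exact ⟨1, by omega, _, hw6, hc6⟩
        · intro x z a b c h ha hb hc
          have key : ∀ α β : V, (∀ a, ExtraMark G p N K s Ee x a → a = α ∨ a = β) →
              a = b ∨ a = c ∨ b = c := by
            intro α β h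
            rcases h a ha with rfl | rfl <;> rcases h b hb with rfl | rfl <;>
              rcases h c hc with rfl | rfl <;> simp
          rcases hcases x z h with rfl | rfl | rfl
          · exact key _ _ hmu
          · exact key _ _ hmt
          · exact key _ _ hmw
        · intro x a b hxO hx ha hb hxa hxb
          have hxu : x ≠ u := fun h => hx (p (r + 4)) (h ▸ ⟨hup, Or.inl hon4⟩)
          have hxw : x ≠ w := fun h => hx (p (r + 6)) (h ▸ ⟨hwp, Or.inl hon6⟩)
          have hxt' : x ≠ t' := fun h => hx z₀ (h ▸ ⟨hz₀', Or.inl hz₀⟩)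
          have hxt : ¬ G.Adj x t := fun h => by
            rcases hnbr x h.symm with h | h | h
            exacts [hxu h, hxw h, hxt' h]
          have hxt2 : x ≠ t := fun h => hx u (h ▸ ⟨hut.symm, Or.inr (Or.inr (Or.inl ⟨rfl, rfl⟩))⟩)
          have hne : G.Adj x u → ¬ G.Adj x w := fun h1 h2 =>
            hxt2 (hcommon x t hxO htO h1.symm h2.symm hut hwt)
          have hred : ∀ a, (a ∈ (∅ : Set V) ∨ ∃ z z', Ee a z ∧ z ≠ z' ∧
              ExtraMark G p N K s Ee a z') → G.Adj x a → a = u ∨ a = w := by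
            rintro a (h | ⟨z, z', h, -⟩) hxa
            · exact h.elim
            · rcases hcases a z h with rfl | rfl | rfl
              · exact Or.inl rfl
              · exact (hxt hxa).elim
              · exact Or.inr rfl
          rcases hred a ha hxa with rfl | rfl <;> rcases hred b hb hxb with rfl | rfl
          · rfl
          · exact (hne hxa hxb).elim
          · exact (hne hxb hxa).elim
          · rfl
      refine ⟨_, Ee, ∅, hI.insScheme_valid hg (by omega) hE hℓ hm hM (fun h => (hsp h).elim)
        (Or.inr (Or.inl ⟨rfl, u, t, w, ⟨?_, ?_, ?_, ?_, ?_⟩, ?_⟩))⟩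
      · rwa [hZ]
      · rwa [hZ]
      · change G.Adj u (insPath p K s (insPos K r + 3 + 1))
        rwa [hq4]
      · change G.Adj w (insPath p K s (insPos K r + 3 + 3))
        rwa [hq6]
      · exact Or.inr ⟨huw, Or.inr (Or.inl ⟨rfl, rfl⟩), Or.inr (Or.inr (Or.inr (Or.inl ⟨rfl, rfl⟩)))⟩
      · intro a b h
        rw [hEdef] at h
        tauto
    · push Not at ht'
      let Ee : V → V → Prop := fun a b => (a = t ∧ b = t') ∨ (a = t' ∧ b = t)
      have hcases : ∀ a b, Ee a b → a = t ∨ a = t' := fun a b h => h.imp And.left And.left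
      have hmt : ∀ a, ExtraMark G p N K s Ee t a → a = t' := by
        rintro a ⟨h1, h2 | h2 | h2⟩
        · exact (htZ a h2 h1).elim
        · exact h2.2
        · exact (htt'.ne h2.1).elim
      have hmt' : ∀ a, ExtraMark G p N K s Ee t' a → a = t := by
        rintro a ⟨h1, h2 | h2 | h2⟩
        · exact (ht' a h2 h1).elim
        · exact (htt'.ne h2.1.symm).elim
        · exact h2.2
      have hadj : ∀ a b, Ee a b → G.Adj a b := by
        rintro a b (⟨rfl, rfl⟩ | ⟨rfl, rfl⟩)
        exacts [htt', htt'.symm]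
      have hE1 : ∀ a z z', Ee a z → ExtraMark G p N K s Ee a z' → z = z' := by
        intro a z z' h1 h2
        rcases hcases a z h1 with rfl | rfl
        · rw [hmt z ⟨hadj _ _ h1, Or.inr h1⟩, hmt z' h2]
        · rw [hmt' z ⟨hadj _ _ h1, Or.inr h1⟩, hmt' z' h2]
      have hE : IsExtra G p N K s Ee {u, w} := by
        refine
          { symm := fun a b h => h.symm.imp And.symm And.symm
            adj := hadj
            off := ?_
            clear := ?_
            max := ?_
            no_mark := ?_ }
        · intro a b h
          rcases hcases a b h with rfl | rfl
          exacts [htO, ht'O]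
        · rintro a ((rfl | rfl) | ⟨z, h⟩)
          · exact ⟨1, by omega, _, hw4, hc4⟩
          · exact ⟨1, by omega, _, hw6, hc6⟩
          · rcases hcases a z h with rfl | rfl
            · exact ⟨2, by omega, _, hw4.step hut, hc4⟩
            · exact ⟨3, by omega, _, (hw4.step hut).step htt', hc4⟩
        · intro x z a b c h ha hb hc
          exact Or.inl ((hE1 x z a h ha).symm.trans (hE1 x z b h hb))
        · intro x a b hxO hx ha hb hxa hxb
          have hxt : x ≠ t := fun h => hx t' (h ▸ ⟨htt', Or.inr (Or.inl ⟨rfl, rfl⟩)⟩)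
          have hne : G.Adj x u → ¬ G.Adj x w := fun h1 h2 =>
            hxt (hcommon x t hxO htO h1.symm h2.symm hut hwt)
          have hred : ∀ a, (a ∈ ({u, w} : Set V) ∨ ∃ z z', Ee a z ∧ z ≠ z' ∧
              ExtraMark G p N K s Ee a z') → a = u ∨ a = w := by
            rintro a (h | ⟨z, z', h, h1, h2⟩)
            · exact h
            · exact (h1 (hE1 a z z' h h2)).elim
          rcases hred a ha with rfl | rfl <;> rcases hred b hb with rfl | rfl
          · rfl
          · exact (hne hxa hxb).elim
          · exact (hne hxb hxa).elim
          · rfl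
      refine ⟨_, Ee, {u, w}, hI.insScheme_valid hg (by omega) hE hℓ hm hM (fun h => (hsp h).elim)
        (Or.inr (Or.inr ⟨?_, u, w, hf.lane hg hI (by omega) (by omega) hgood hℓ hM hE ?_ ?_ hE1⟩))⟩
      · have htip : (insScheme G p N K s (insPos K r + 3) ℓ Ee {u, w}).IsTip t t' := by
          refine ⟨fun c hc => ?_, fun c hc => ?_⟩
          · rw [mark_insScheme hI] at hc
            rcases hc with hc | hc
            · exact (hI.not_branchEdge_of_clearAt hg (by omega) hc4 (hw4.step hut) (by omega)
                hc).elim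
            · exact hmt c hc
          · rcases hnbr c hc with rfl | rfl | rfl
            · exact Or.inr (Or.inl (Or.inl rfl))
            · exact Or.inr (Or.inl (Or.inr rfl))
            · exact Or.inl rfl
        rintro a b (⟨rfl, rfl⟩ | ⟨rfl, rfl⟩)
        · exact Or.inl htip
        · exact Or.inr htip
      · intro z h
        rcases hcases _ _ h with h | h
        · exact hut.ne h
        · exact ht'u h.symm
      · intro z h
        rcases hcases _ _ h with h | h
        · exact hwt.ne h
        · exact ht'w h.symm
  · push Not at hhub
    have hE : IsExtra G p N K s (fun _ _ => False) {u, w} := by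
      refine
        { symm := fun a b h => h
          adj := fun a b h => h.elim
          off := fun a b h => h.elim
          clear := ?_
          max := fun x z a b c h => h.elim
          no_mark := ?_ }
      · rintro a ((rfl | rfl) | ⟨z, h⟩)
        · exact ⟨1, by omega, _, hw4, hc4⟩
        · exact ⟨1, by omega, _, hw6, hc6⟩
        · exact h.elim
      · intro x a b hxO hx ha hb hxa hxb
        have hne : G.Adj x u → ¬ G.Adj x w := fun h1 h2 => by
          obtain ⟨z, hz, hz'⟩ := hhub x hxO h1.symm h2.symm
          exact hx z ⟨hz', Or.inl hz⟩
        have hred : ∀ a, (a ∈ ({u, w} : Set V) ∨ ∃ z z', False ∧ z ≠ z' ∧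
            ExtraMark G p N K s (fun _ _ => False) a z') → a = u ∨ a = w := by
          rintro a (h | ⟨z, z', h, h1, h2⟩)
          · exact h
          · exact h.elim
        rcases hred a ha with rfl | rfl <;> rcases hred b hb with rfl | rfl
        · rfl
        · exact (hne hxa hxb).elim
        · exact (hne hxb hxa).elim
        · rfl
    exact ⟨_, _, {u, w}, hI.insScheme_valid hg (by omega) hE hℓ hm hM (fun h => (hsp h).elim)
        (Or.inr (Or.inr ⟨fun a b h => h.elim, u, w, hf.lane hg hI (by omega) (by omega) hgood hℓ hM
          hE (fun _ h => h) (fun _ h => h) (fun _ _ _ h => h.elim)⟩))⟩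

end legs

/-! ### The choice of the gadget -/

section events

variable {V : Type*} {G : SimpleGraph V} {p : ℕ → V} {N : ℕ}

theorem exists_apexMap (hg : IsGeodesic G p N) (hN : 2 ≤ N) :
    ∃ s : ℕ → V, ∀ k x, IsApex G p N k x → s k = x := by
  classical
  refine ⟨fun k => if h : ∃ x, IsApex G p N k x then h.choose else p 0, fun k x hx => ?_⟩
  have h : ∃ x, IsApex G p N k x := ⟨x, hx⟩
  simp only [dif_pos h]
  exact h.choose_spec.unique hg hN hx

/-- A gadget with a red triangle `p k`, `s k`, `p (k + 1)`. -/
theorem IsInsertion.valid_of_ins (hg : IsGeodesic G p N) {K : ℕ → Prop} {s : ℕ → V} {sp : Prop}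
    {k : ℕ} (hI : IsInsertion G p N K s sp k) {ℓ : ℕ} (hℓ : 3 ≤ ℓ) (hlen : 5 * ℓ + 200 ≤ N)
    (hk : 20 ≤ k) (hk' : k ≤ 140) (hK : K k) :
    (insScheme G p N K s (insPos K k - 1) ℓ (fun _ _ => False) ∅).Valid := by
  have h1 := le_insPos K k
  have h2 := insPos_bounds' K (i := k) (j := N) (by omega)
  refine hI.insScheme_valid hg (by omega) isExtra_empty hℓ (by omega) (by omega)
    (fun _ => by omega) (Or.inl ⟨rfl, fun a b h => h.elim, ?_⟩)
  -- The vertices q (m+1), q (m+2), q (m+3) are p k, s k, p (k+1), so the edge required from y to x₁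
  -- is a geodesic edge.
  have h3 : insPos K k - 1 + 1 = insPos K k := by omega
  have h4 : insPos K k - 1 + 3 = insPos K (k + 1) := by rw [insPos_succ_of hK]; omega
  rw [h3, h4, insPath_insPos, insPath_insPos]
  exact hg.adj k (by omega)

/-- A gadget with a red loop `p k`, `x`, `p (k + 2)`. -/
theorem IsInsertion.valid_of_not_ins (hg : IsGeodesic G p N) {K : ℕ → Prop} {s : ℕ → V} {sp : Prop}
    {k₀ : ℕ} (hI : IsInsertion G p N K s sp k₀) (hsp : ¬ sp) {ℓ : ℕ} (hℓ : 3 ≤ ℓ)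
    (hlen : 5 * ℓ + 200 ≤ N) {k : ℕ} (hk : 20 ≤ k) (hk' : k ≤ 140) (hK : ¬ K k) (hK' : ¬ K (k + 1))
    {x : V} (hx : ¬ OnPath p N K s x) (h1 : G.Adj x (p k)) (h2 : G.Adj x (p (k + 2))) :
    (insScheme G p N K s (insPos K k - 1) ℓ (fun _ _ => False) ∅).Valid := by
  have h3 := le_insPos K k
  have h4 := insPos_bounds' K (i := k) (j := N) (by omega)
  refine hI.insScheme_valid hg (by omega) isExtra_empty hℓ (by omega) (by omega)
    (fun h => (hsp h).elim) (Or.inr (Or.inl ⟨rfl, x, x, x, ⟨?_, ?_, ?_, ?_, Or.inl ⟨rfl, rfl⟩⟩,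
    fun a b h => h.elim⟩))
  · exact fun h => hx (hI.exists_iff.1 h)
  · exact fun h => hx (hI.exists_iff.1 h)
  · change G.Adj x (insPath p K s (insPos K k - 1 + 1))
    rwa [show insPos K k - 1 + 1 = insPos K k by omega, insPath_insPos]
  · change G.Adj x (insPath p K s (insPos K k - 1 + 3))
    rwa [show insPos K k - 1 + 3 = insPos K (k + 1 + 1) by
      rw [insPos_succ_of_not hK', insPos_succ_of_not hK]; omega, insPath_insPos]

/-- A vertex adjacent to p k and p (k+2) yields a red loop, or a red triangle if it is also adjacent
to p (k+1), since then it is inserted. If there is none in a wide window, an apex in a narrower one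
can be inserted by force. Without either, the narrower window is a stretch with private outer
neighbours. -/
theorem IsGeodesic.exists_valid (hg : IsGeodesic G p N) {ℓ : ℕ} (hℓ : 3 ≤ ℓ)
    (hlen : 5 * ℓ + 200 ≤ N) : ∃ K s m Ee U0, (insScheme G p N K s m ℓ Ee U0).Valid := by
  obtain ⟨s, hs⟩ := exists_apexMap hg (by omega)
  have hbase : ∀ k, IsInsertion G p N (InsertRule G p N (fun _ => False) s) s False k := fun k =>
    isInsertion_insertRule hg (by omega) hs (fun k => by simp) (fun h => h.elim) (fun h => h.elim)
  by_cases hpp : ∃ x k, OffPath p N x ∧ 20 ≤ k ∧ k ≤ 140 ∧ G.Adj x (p k) ∧ G.Adj x (p (k + 2))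
  · obtain ⟨x, k, hx, hk, hk', h1, h2⟩ := hpp
    by_cases h3 : G.Adj x (p (k + 1))
    · have hap : IsApex G p N k x := ⟨by omega, hx, h1, h3⟩
      have hsx := hs k x hap
      have hK : InsertRule G p N (fun _ => False) s k :=
        ⟨hsx.symm ▸ hap, Or.inr (Or.inl ⟨by omega, hsx.symm ▸ h2⟩)⟩
      exact ⟨_, s, _, _, _, (hbase k).valid_of_ins hg hℓ hlen hk hk' hK⟩
    · have hno : ∀ k', IsApex G p N k' x → False := by
        rintro k' ⟨h4, -, h5, h6⟩
        have h7 := hg.two_index (by omega) (by omega) h1 h6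
        have h8 := hg.two_index (i := k') (by omega) (by omega) h5 h2
        have h9 : k + 1 = k' ∨ k + 1 = k' + 1 := by omega
        rcases h9 with h9 | h9
        · exact h3 (h9.symm ▸ h5)
        · exact h3 (h9.symm ▸ h6)
      have hK : ∀ k', ¬ (InsertRule G p N (fun _ => False) s k' ∧ s k' = x) :=
        fun k' h => hno k' (h.2 ▸ h.1.1)
      refine ⟨_, s, _, _, _, (hbase 0).valid_of_not_ins hg not_false hℓ hlen hk hk'
        (fun h => hK k ⟨h, ?_⟩) (fun h => hK (k + 1) ⟨h, ?_⟩) ?_ h1 h2⟩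
      · exact hg.off_unique (by omega) (by omega) h.1.2.1 hx h.1.2.2.1 h1
      · exact hg.off_unique (by omega) (by omega) h.1.2.1 hx h.1.2.2.2 h2
      · rintro (⟨i, hi, h⟩ | ⟨k', h, rfl⟩)
        · exact hx i hi h
        · exact hK k' ⟨h, rfl⟩
  · by_cases hap : ∃ k, 50 ≤ k ∧ k ≤ 110 ∧ ∃ x, IsApex G p N k x
    · obtain ⟨k, hk, hk', x, hx⟩ := hap
      have hsx := hs k x hx
      subst hsx
      -- The window from 20 to 140 exceeds that from 50 to 110 by more than the 12 of `Quiet` on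
      -- both sides.
      have hq : Quiet G p N k := fun y j hy hj h1 h2 => by
        by_contra hcon
        exact hpp ⟨y, j, hy, by omega, by omega, h1, h2⟩
      have hI := isInsertion_insertRule hg (by omega) hs
        (F := fun j => True ∧ IsApex G p N j (s j) ∧ (j = k ∨ G.Adj (s j) (s k))) (sp := True)
        (k₀ := k) (fun j => Iff.rfl) (fun _ => hx) (fun _ => hq)
      exact ⟨_, s, _, _, _, hI.valid_of_ins hg hℓ hlen (by omega) (by omega)
        ⟨hx, Or.inl ⟨trivial, hx, Or.inl rfl⟩⟩⟩
    · haveI : Nonempty V := ⟨p 0⟩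
      choose! f hf using fun (l : ℕ) (hl : l ≤ N) => hg.exists_off hl
      have hlegs : IsLegs G p N f := by
        refine ⟨by omega, fun l hl => (hf l hl).1, fun l hl => (hf l hl).2, ?_⟩
        intro y i i' hy hii hi' h1 h2
        by_contra hcon
        have h3 := hg.two_index (by omega) hi' h1 h2
        have h4 : i' = i + 1 ∨ i' = i + 2 := by omega
        rcases h4 with rfl | rfl
        · exact hap ⟨i, by omega, by omega, y, hi', hy, h1, h2⟩
        · exact hpp ⟨y, i, hy, by omega, by omega, h1, h2⟩
      obtain ⟨m, Ee, U0, h⟩ := hlegs.exists_valid hg (hbase 0) not_false hℓ hlen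
      exact ⟨_, s, m, Ee, U0, h⟩

end events

/-! ### From a shortest walk to the colouring -/

/-- The vertices of a shortest walk in a cubic graph form a geodesic. -/
theorem SimpleGraph.Walk.isGeodesic_getVert {V : Type*} {G : SimpleGraph V} [G.LocallyFinite]
    (hG : G.IsRegularOfDegree 3) {a b : V} (P : G.Walk a b) (hP : P.length = G.dist a b) :
    IsGeodesic G P.getVert P.length where
  degree v := by
    rw [Set.encard_eq_coe_toFinset_card]
    have := hG v
    rw [SimpleGraph.degree, SimpleGraph.neighborFinset] at this
    rw [this]
    rfl
  adj i hi := P.adj_getVert_succ hi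
  dist i hi j hj w := by
    -- Replacing the part of `P` from position i to position j by w gives a walk from a to b again.
    have h := SimpleGraph.dist_le (((P.take i).append w).append (P.drop j))
    rw [SimpleGraph.Walk.length_append, SimpleGraph.Walk.length_append] at h
    rw [SimpleGraph.Walk.take_length, SimpleGraph.Walk.drop_length] at h
    omega
theorem lemma4p3 {V : Type u} [Finite V] (G : SimpleGraph V) [G.LocallyFinite]
    (hG : G.IsRegularOfDegree 3) (ℓ : ℕ) (hℓ : 3 ≤ ℓ) (a b : V) (P : G.Walk a b)
    (hgeo : P.length = G.dist a b) (hlen : 5 * ℓ + 200 ≤ P.length) :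
    ∃ φ : RedBlueGraph V, φ.IsPartialColouring G ∧
      (∀ x y, φ.graph.Adj x y →
        ∃ w ∈ P.support, G.edist x w ≤ 4 ∨ G.edist y w ≤ 4) ∧
      (∀ x ∈ φ.graph.support, ∀ y ∈ φ.graph.support, φ.graph.Reachable x y) ∧
      φ.ContainsBlueGadget ℓ ∧
      φ.SeesBothColours ∧
      φ.CyclesHaveGap G := by
  have hg := P.isGeodesic_getVert hG hgeo
  obtain ⟨K, s, m, Ee, U0, hS⟩ := hg.exists_valid hℓ hlen
  obtain ⟨φ, h1, h2, h3⟩ := hS.exists_colouring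
  refine ⟨φ, h1, fun x y hxy => ?_, h3⟩
  obtain ⟨w, ⟨i, hi, rfl⟩, hw⟩ := h2 x y hxy
  exact ⟨_, P.getVert_mem_support i, Or.inl hw⟩
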